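/- Let $U\subseteq\mathbb R^n$ be open with coordinates $u^1,\dots,u^n$ (a coordinate domain of the target space), let $L(U)$ be the space of smooth loops $u:S^1\to U$, with $x$ the coordinate on $S^1=\mathbb R/\mathbb Z$, and consider $$P^{ij}=a^{ij}\Big(\frac{d}{dx}\Big)^2+b^{ij}_k u^k_x\frac{d}{dx}+c^{ij}_{kl}u^k_xu^l_x+c^{ij}_ku^k_{xx},$$ where $a^{ij},b^{ij}_k,c^{ij}_{kl}=c^{ij}_{lk},c^{ij}_k$ are smooth functions of $u\in U$ and the matrix $(a^{ij})$ is invertible at every point, with inverse $a_{ij}$, $a_{ir}a^{rj}=\delta_i^j$ (repeated indices are summed). Let $\nabla$ be the connection with Christoffel symbols $\Gamma^k_{ij}=-a_{ir}c^{rk}_j$, i.e. $c^{ij}_k=-a^{ir}\Gamma^j_{rk}$, so that $\nabla_ka^{ij}=a^{ij}_{,k}+\Gamma^i_{rk}a^{rj}+\Gamma^j_{rk}a^{ir}$; a comma denotes a partial derivative, and round brackets around indices denote symmetrisation (with factor $\tfrac12$). Local functionals on $L(U)$ are those of the form $f[u]=\int_{S^1}h(x,u,u_x,\dots,u^{(m)})\,dx$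 with $h$ smooth and $m$ finite; $\delta f/\delta u^i$ is the variational derivative. Then $$\{f,g\}=\int_{S^1}\frac{\delta f}{\delta u^i}\,P^{ij}\Big(\frac{\delta g}{\delta u^j}\Big)\,dx$$ is a Poisson bracket on the local functionals on $L(U)$ (a bilinear operation on local functionals that is skew-symmetric and satisfies the Jacobi identity) if and only if the following hold on $U$: (A) $a^{ij}=-a^{ji}$; (B) $\nabla_ka^{ij}=b^{ij}_k-2c^{ij}_k$; (C) $a^{ir}\left(b^{jk}_r-2c^{jk}_r\right)=a^{kr}\left(b^{ij}_r-2c^{ij}_r\right)$; (D) $\nabla$ is flat, i.e. has zero torsion and zero curvature; (E) $c^{ij}_{kl}=c^{ij}_{(k,l)}-a_{pr}\,c^{ri}_{(k}c^{pj}_{l)}$. -/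

import Mathlib

namespace DegTwo

open scoped ContDiff

/-! ### Loops and local functionals

The target space is a coordinate domain: an open set `U` of `ℝⁿ` with coordinates `uⁱ`.
The circle is `ℝ / ℤ`; maps on the circle are `1`-periodic maps on `ℝ`. -/

/-- Smooth `1`-periodic maps `ℝ → ℝⁿ` (vector fields and covector fields along a loop). -/
def IsSmoothPeriodic {n : ℕ} (v : ℝ → Fin n → ℝ) : Prop :=
  ContDiff ℝ ∞ v ∧ Function.Periodic v 1

/-- The loop space `L(U)`: smooth maps from the circle to `U`. -/
def loopSpace {n : ℕ} (U : Set (Fin n → ℝ)) : Set (ℝ → Fin n → ℝ) :=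
  {u | IsSmoothPeriodic u ∧ ∀ x, u x ∈ U}

/-- Functionals. Only the values on the loop space are ever used. -/
abbrev Functional (n : ℕ) : Type := (ℝ → Fin n → ℝ) → ℝ

/-- The `m`-jet `(u, u_x, …, u^{(m)})` of `u` at `x`. -/
noncomputable def jet {n : ℕ} (m : ℕ) (u : ℝ → Fin n → ℝ) (x : ℝ) : Fin (m + 1) → Fin n → ℝ :=
  fun k => iteratedDeriv (k : ℕ) u x

/-- Points `(x, u, u_x, …, u^{(m)})` with `u ∈ U`. -/
def jetDomain {n : ℕ} (U : Set (Fin n → ℝ)) (m : ℕ) : Set (ℝ × (Fin (m + 1) → Fin n → ℝ)) :=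
  {p | p.2 0 ∈ U}

/-- Local functionals on `L(U)`: `F[u] = ∫ h(x, u, u_x, …, u^{(m)}) dx` over the circle, with a
smooth density `h` of some finite order `m`. -/
def IsLocalFunctional {n : ℕ} (U : Set (Fin n → ℝ)) (F : Functional n) : Prop :=
  ∃ (m : ℕ) (h : ℝ × (Fin (m + 1) → Fin n → ℝ) → ℝ),
    ContDiffOn ℝ ∞ h (jetDomain U m) ∧
    (∀ p ∈ jetDomain U m, h (p.1 + 1, p.2) = h p) ∧
    ∀ u ∈ loopSpace U, F u = ∫ x in (0 : ℝ)..1, h (x, jet m u x)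

/-- `q` is the variational derivative of `F` at `u`: a smooth covector field along `u` with
`d/dε F[u + ε v] = ∫ q_i v^i dx` at `ε = 0` for all smooth variations `v`. -/
def HasVarDeriv {n : ℕ} (F : Functional n) (u q : ℝ → Fin n → ℝ) : Prop :=
  IsSmoothPeriodic q ∧
  ∀ v : ℝ → Fin n → ℝ, IsSmoothPeriodic v →
    HasDerivAt (fun ε : ℝ => F (u + ε • v)) (∫ x in (0 : ℝ)..1, ∑ i, q x i * v x i) 0

open Classical in
/-- The variational derivative `δF/δu` at `u` (unique if it exists, `0` otherwise). -/
noncomputable def varDeriv {n : ℕ} (F : Functional n) (u : ℝ → Fin n → ℝ) : ℝ → Fin n → ℝ :=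
  if h : ∃ q, HasVarDeriv F u q then h.choose else 0

/-- `br` is a Poisson bracket on the space of local functionals on `L(U)`. -/
structure IsPoissonBracket {n : ℕ} (U : Set (Fin n → ℝ))
    (br : Functional n → Functional n → Functional n) : Prop where
  isLocal : ∀ F G, IsLocalFunctional U F → IsLocalFunctional U G → IsLocalFunctional U (br F G)
  linear : ∀ F G H, IsLocalFunctional U F → IsLocalFunctional U G → IsLocalFunctional U H →
    ∀ s t : ℝ, ∀ u ∈ loopSpace U, br (s • F + t • G) H u = s * br F H u + t * br G H u
  skew : ∀ F G, IsLocalFunctional U F → IsLocalFunctional U G →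
    ∀ u ∈ loopSpace U, br F G u = -br G F u
  jacobi : ∀ F G H, IsLocalFunctional U F → IsLocalFunctional U G → IsLocalFunctional U H →
    ∀ u ∈ loopSpace U, br (br F G) H u + br (br G H) F u + br (br H F) G u = 0

/-! ### Operators of degree two -/

/-- Coefficients of the operator
`P^{ij} = a^{ij} ∂² + b^{ij}_k u^k_x ∂ + c^{ij}_{kl} u^k_x u^l_x + c^{ij}_k u^k_{xx}`:
`a u i j = a^{ij}`, `b u i j k = b^{ij}_k`, `cc u i j k l = c^{ij}_{kl}`, `c u i j k = c^{ij}_k`. -/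
structure Operator (n : ℕ) where
  a : (Fin n → ℝ) → Matrix (Fin n) (Fin n) ℝ
  b : (Fin n → ℝ) → Fin n → Fin n → Fin n → ℝ
  cc : (Fin n → ℝ) → Fin n → Fin n → Fin n → Fin n → ℝ
  c : (Fin n → ℝ) → Fin n → Fin n → Fin n → ℝ

/-- The partial derivative `∂f/∂u^k`. -/
noncomputable def pd {n : ℕ} (k : Fin n) (f : (Fin n → ℝ) → ℝ) (u : Fin n → ℝ) : ℝ :=
  fderiv ℝ f u (Pi.single k 1)

namespace Operator

variable {n : ℕ} (P : Operator n)

/-- All coefficients are smooth functions on `U`. -/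
structure SmoothOn (U : Set (Fin n → ℝ)) : Prop where
  a : ∀ i j, ContDiffOn ℝ ∞ (fun u => P.a u i j) U
  b : ∀ i j k, ContDiffOn ℝ ∞ (fun u => P.b u i j k) U
  cc : ∀ i j k l, ContDiffOn ℝ ∞ (fun u => P.cc u i j k l) U
  c : ∀ i j k, ContDiffOn ℝ ∞ (fun u => P.c u i j k) U

/-- `P^{ij} ψ_j` along the loop `u`. -/
noncomputable def apply (u ψ : ℝ → Fin n → ℝ) : ℝ → Fin n → ℝ := fun x i =>
  ∑ j, (P.a (u x) i j * iteratedDeriv 2 ψ x j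
    + (∑ k, P.b (u x) i j k * deriv u x k) * deriv ψ x j
    + ((∑ k, ∑ l, P.cc (u x) i j k l * deriv u x k * deriv u x l)
      + ∑ k, P.c (u x) i j k * iteratedDeriv 2 u x k) * ψ x j)

/-- `{F, G} = ∫ (δF/δu^i) P^{ij} (δG/δu^j) dx`. -/
noncomputable def bracket (F G : Functional n) : Functional n := fun u =>
  ∫ x in (0 : ℝ)..1, ∑ i, varDeriv F u x i * P.apply u (varDeriv G u) x i

/-- Christoffel symbols `Γ^k_{ij} = -a_{ir} c^{rk}_j` (that is, `c^{ij}_k = -a^{ir} Γ^j_{rk}`) of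
the connection `∇`, where `a_{ij}` is the inverse matrix of `a^{ij}`. -/
noncomputable def christoffel (k i j : Fin n) (u : Fin n → ℝ) : ℝ :=
  -∑ r, (P.a u)⁻¹ i r * P.c u r k j

/-- `∇_k a^{ij} = ∂_k a^{ij} + Γ^i_{rk} a^{rj} + Γ^j_{rk} a^{ir}`. -/
noncomputable def covDerivA (k i j : Fin n) (u : Fin n → ℝ) : ℝ :=
  pd k (fun v => P.a v i j) u
    + (∑ r, P.christoffel i r k u * P.a u r j) + ∑ r, P.christoffel j r k u * P.a u i r

/-- The torsion `T^k_{ij}` of `∇`. -/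
noncomputable def torsion (k i j : Fin n) (u : Fin n → ℝ) : ℝ :=
  P.christoffel k i j u - P.christoffel k j i u

/-- The curvature of `∇`, `(∇_k ∇_l - ∇_l ∇_k) X^i = R^i_{jkl} X^j` up to torsion:
`R^i_{jkl} = ∂_k Γ^i_{jl} - ∂_l Γ^i_{jk} + Γ^i_{rk} Γ^r_{jl} - Γ^i_{rl} Γ^r_{jk}`. -/
noncomputable def curvature (i j k l : Fin n) (u : Fin n → ℝ) : ℝ :=
  pd k (P.christoffel i j l) u - pd l (P.christoffel i j k) u
    + ∑ r, (P.christoffel i r k u * P.christoffel r j l u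
      - P.christoffel i r l u * P.christoffel r j k u)

end Operator

end DegTwo

/-! A local functional has an Euler–Lagrange gradient and a symmetric second variation. In the
Jacobi sum of three local functionals the second variations therefore cancel as soon as P is
skew-adjoint, leaving a trilinear expression in the three gradients, the Schouten bracket [P,P]
(`schouten`). Since the functionals ∫ q_i u^i realise every smooth periodic covector field q as a
gradient, `isPoissonBracket_iff` reduces the bracket axioms to two statements about fields along a
loop: P is formally skew-adjoint, and [P,P] vanishes on all triples of smooth covector fields.

Let Dp = p_x − Γ(u_x)p be the covariant derivative of a covector field along the loop. Under (A) and
(B) the operator factors as P = D a D + S, where S is multiplication by the defect in (E) contracted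
twice with u_x (`hasDerivAt_flux`). Hence ∫ p·Pq = ∫ (−Dp·aDq + p·Sq), and varying the loop in a
direction w produces ∇_w a, the curvature, connection terms and the variation of S
(`opFormDeriv_eq`).

Sufficiency. Put ω = a⁻¹. Condition (C) makes ∇ω totally skew. If ∇ is flat and torsion-free, ∇∇ω is
symmetric in its first two arguments and skew in the last three, so it is zero (`covInv₂_eq_zero`).
The density of [P,P] is then the x-derivative of ∇ω evaluated, up to sign, on the three vector
fields aDp, aDq, aDr (`schouten_eq_zero`).

Necessity. Skew-adjointness at constant loops gives (A), and its first variation there gives (B)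
(`skewCoeff_of_isSkew`). Vanishing of [P,P] at constant loops gives zero torsion (`torsion_eq_zero`)
and then (C) (`isCyclic`). Curvature and defect always come with a factor u_x, so constant loops do
not isolate them; they are found by linearising at a constant loop, with one covector field parallel
to first order so that the other terms drop out (`integral_line_eq_zero`, `defMat_eq_zero`,
`curvMat_eq_zero`). The test fields are built from cos 2πx so that each integral becomes an unknown
constant times the integral of a nonzero square. -/

namespace DegTwo

open scoped ContDiff Topology
open Set

/-! ### Smooth periodic functions -/

section SmoothPer

variable {V : Type*} [NormedAddCommGroup V] [NormedSpace ℝ V]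

/-- Smooth `1`-periodic functions on the line. -/
def SmoothPer (f : ℝ → V) : Prop := ContDiff ℝ ∞ f ∧ Function.Periodic f 1

lemma SmoothPer.continuous {f : ℝ → V} (hf : SmoothPer f) : Continuous f := hf.1.continuous

lemma SmoothPer.differentiable {f : ℝ → V} (hf : SmoothPer f) : Differentiable ℝ f :=
  hf.1.differentiable (by simp)

lemma SmoothPer.hasDerivAt {f : ℝ → V} (hf : SmoothPer f) (x : ℝ) :
    HasDerivAt f (deriv f x) x := (hf.differentiable x).hasDerivAt

lemma SmoothPer.deriv {f : ℝ → V} (hf : SmoothPer f) : SmoothPer (deriv f) := by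
  refine ⟨(contDiff_infty_iff_deriv.1 hf.1).2, fun x => ?_⟩
  have h : (fun y => f (y + 1)) = f := funext hf.2
  rw [← deriv_comp_add_const f 1 x, h]

lemma SmoothPer.iteratedDeriv {f : ℝ → V} (hf : SmoothPer f) (k : ℕ) :
    SmoothPer (iteratedDeriv k f) := by
  induction k with
  | zero => simpa using hf
  | succ k ih => rw [iteratedDeriv_succ]; exact ih.deriv

lemma SmoothPer.const (c : V) : SmoothPer (fun _ : ℝ => c) := ⟨contDiff_const, fun _ => rfl⟩

lemma SmoothPer.add {f g : ℝ → V} (hf : SmoothPer f) (hg : SmoothPer g) :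
    SmoothPer (fun x => f x + g x) :=
  ⟨hf.1.add hg.1, fun x => by simp only [hf.2 x, hg.2 x]⟩

lemma SmoothPer.sub {f g : ℝ → V} (hf : SmoothPer f) (hg : SmoothPer g) :
    SmoothPer (fun x => f x - g x) :=
  ⟨hf.1.sub hg.1, fun x => by simp only [hf.2 x, hg.2 x]⟩

lemma SmoothPer.neg {f : ℝ → V} (hf : SmoothPer f) : SmoothPer (fun x => - f x) :=
  ⟨hf.1.neg, fun x => by simp only [hf.2 x]⟩

lemma SmoothPer.smul {f : ℝ → ℝ} {g : ℝ → V} (hf : SmoothPer f) (hg : SmoothPer g) :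
    SmoothPer (fun x => f x • g x) :=
  ⟨hf.1.smul hg.1, fun x => by simp only [hf.2 x, hg.2 x]⟩

lemma SmoothPer.mul {f g : ℝ → ℝ} (hf : SmoothPer f) (hg : SmoothPer g) :
    SmoothPer (fun x => f x * g x) :=
  ⟨hf.1.mul hg.1, fun x => by simp only [hf.2 x, hg.2 x]⟩

lemma SmoothPer.sum {ι : Type*} {s : Finset ι} {f : ι → ℝ → V} (hf : ∀ i ∈ s, SmoothPer (f i)) :
    SmoothPer (fun x => ∑ i ∈ s, f i x) :=
  ⟨ContDiff.sum fun i hi => (hf i hi).1, fun x => Finset.sum_congr rfl fun i hi => (hf i hi).2 x⟩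

lemma smoothPer_pi {ι : Type*} [Fintype ι] {f : ℝ → ι → V} :
    SmoothPer f ↔ ∀ i, SmoothPer (fun x => f x i) := by
  constructor
  · exact fun h i => ⟨contDiff_pi.1 h.1 i, fun x => congrFun (h.2 x) i⟩
  · exact fun h => ⟨contDiff_pi.2 fun i => (h i).1, fun x => funext fun i => (h i).2 x⟩

end SmoothPer

lemma SmoothPer.integral_deriv {f : ℝ → ℝ} (hf : SmoothPer f) :
    ∫ x in (0 : ℝ)..1, _root_.deriv f x = 0 := by
  rw [intervalIntegral.integral_deriv_eq_sub (fun x _ => hf.differentiable x)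
    (hf.deriv.continuous.intervalIntegrable _ _)]
  have := hf.2 0
  simp only [zero_add] at this
  rw [this, sub_self]

lemma SmoothPer.integral_eq_zero {f f' : ℝ → ℝ} (hf : SmoothPer f)
    (h : ∀ x, HasDerivAt f (f' x) x) : ∫ x in (0 : ℝ)..1, f' x = 0 := by
  refine Eq.trans ?_ hf.integral_deriv
  exact intervalIntegral.integral_congr fun x _ => (h x).deriv.symm

lemma SmoothPer.integral_mul_deriv {f g : ℝ → ℝ} (hf : SmoothPer f) (hg : SmoothPer g) :
    ∫ x in (0 : ℝ)..1, f x * _root_.deriv g x = -∫ x in (0 : ℝ)..1, _root_.deriv f x * g x := by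
  have h := (hf.mul hg).integral_eq_zero
    (fun x => (hf.hasDerivAt x).mul (hg.hasDerivAt x))
  rw [intervalIntegral.integral_add] at h
  · linarith
  · exact (hf.deriv.mul hg).continuous.intervalIntegrable _ _
  · exact (hf.mul hg.deriv).continuous.intervalIntegrable _ _

lemma SmoothPer.integral_mul_iteratedDeriv {f g : ℝ → ℝ} (hf : SmoothPer f) (hg : SmoothPer g)
    (k : ℕ) : ∫ x in (0 : ℝ)..1, f x * _root_.iteratedDeriv k g x
      = (-1) ^ k * ∫ x in (0 : ℝ)..1, _root_.iteratedDeriv k f x * g x := by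
  induction k generalizing f with
  | zero => simp
  | succ k ih =>
    simp only [iteratedDeriv_succ (f := g)]
    rw [hf.integral_mul_deriv (hg.iteratedDeriv k), ih hf.deriv]
    simp only [iteratedDeriv_succ' (f := f)]
    ring

lemma SmoothPer.eq_zero_of_integral_sq {f : ℝ → ℝ} (hf : SmoothPer f)
    (h : ∫ x in (0 : ℝ)..1, f x * f x = 0) (x : ℝ) : f x = 0 := by
  have hc : Continuous fun x => f x * f x := (hf.mul hf).continuous
  have key : ∀ y ∈ Icc (0 : ℝ) 1, f y = 0 := by
    by_contra! hne
    obtain ⟨y, hy, hy0⟩ := hne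
    have := intervalIntegral.integral_pos (a := (0 : ℝ)) (b := 1) one_pos hc.continuousOn
      (fun z _ => mul_self_nonneg _) ⟨y, hy, mul_self_pos.2 hy0⟩
    linarith
  obtain ⟨y, hy, hxy⟩ := hf.2.exists_mem_Ico₀ one_pos x
  rw [hxy]
  exact key y ⟨hy.1, hy.2.le⟩

lemma SmoothPer.deriv_apply {n : ℕ} {u : ℝ → Fin n → ℝ} (hu : SmoothPer u) (x : ℝ) (i : Fin n) :
    _root_.deriv u x i = _root_.deriv (fun y => u y i) x :=
  (hasDerivAt_pi.1 (hu.hasDerivAt x) i).deriv.symm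

lemma SmoothPer.iteratedDeriv_apply {n : ℕ} {u : ℝ → Fin n → ℝ} (hu : SmoothPer u) (k : ℕ)
    (x : ℝ) (i : Fin n) :
    _root_.iteratedDeriv k u x i = _root_.iteratedDeriv k (fun y => u y i) x := by
  induction k generalizing x with
  | zero => simp
  | succ k ih =>
    rw [iteratedDeriv_succ, iteratedDeriv_succ, (hu.iteratedDeriv k).deriv_apply]
    congr 1
    exact funext ih

lemma SmoothPer.eq_zero_of_forall_integral {n : ℕ} {q : ℝ → Fin n → ℝ} (hq : SmoothPer q)
    (h : ∀ v : ℝ → Fin n → ℝ, SmoothPer v → ∫ x in (0 : ℝ)..1, ∑ i, v x i * q x i = 0) (x : ℝ) :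
    q x = 0 := by
  funext i
  have hi := smoothPer_pi.1 hq i
  refine hi.eq_zero_of_integral_sq ?_ x
  -- Testing against the i-th component of `q` itself turns the pairing into ∫ q_i².
  have hv : SmoothPer (fun x => (Pi.single i (q x i) : Fin n → ℝ)) := by
    refine smoothPer_pi.2 fun j => ?_
    by_cases hj : j = i
    · subst hj; simpa using hi
    · simpa [Pi.single_apply, hj] using SmoothPer.const (V := ℝ) 0
  have := h _ hv
  refine Eq.trans ?_ this
  refine intervalIntegral.integral_congr fun x _ => ?_
  simp [Pi.single_apply]

lemma HasVarDeriv.unique {n : ℕ} {F : Functional n} {u q q' : ℝ → Fin n → ℝ}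
    (h : HasVarDeriv F u q) (h' : HasVarDeriv F u q') : q = q' := by
  have hs : SmoothPer (fun x => q x - q' x) := SmoothPer.sub h.1 h'.1
  funext x
  refine sub_eq_zero.1 (hs.eq_zero_of_forall_integral (fun v hv => ?_) x)
  have e := (h.2 v hv).unique (h'.2 v hv)
  have c : ∀ {q : ℝ → Fin n → ℝ}, SmoothPer q →
      IntervalIntegrable (fun x => ∑ i, q x i * v x i) MeasureTheory.volume 0 1 := fun hq =>
    (SmoothPer.sum (V := ℝ) fun i _ => (smoothPer_pi.1 hq i).mul
      (smoothPer_pi.1 hv i)).continuous.intervalIntegrable _ _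
  rw [← sub_eq_zero, ← intervalIntegral.integral_sub (c h.1) (c h'.1)] at e
  refine Eq.trans ?_ e
  refine intervalIntegral.integral_congr fun x _ => ?_
  simp only [← Finset.sum_sub_distrib]
  exact Finset.sum_congr rfl fun i _ => by simp only [Pi.sub_apply]; ring

/-- Uniqueness makes the choice in `varDeriv` harmless: any explicit gradient is the one it returns.
-/
lemma HasVarDeriv.varDeriv_eq {n : ℕ} {F : Functional n} {u q : ℝ → Fin n → ℝ}
    (h : HasVarDeriv F u q) : varDeriv F u = q := by
  have h' : ∃ q, HasVarDeriv F u q := ⟨q, h⟩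
  rw [varDeriv, dif_pos h']
  exact h'.choose_spec.unique h

/-! ### Functions depending smoothly on a parameter -/

section JointSmooth

variable {X Y : Type*} [NormedAddCommGroup X] [NormedSpace ℝ X]
  [NormedAddCommGroup Y] [NormedSpace ℝ Y]

/-- `f y x` is jointly smooth in `y ∈ V` and `x ∈ ℝ`. -/
def JointSmooth (V : Set X) (f : X → ℝ → ℝ) : Prop :=
  ContDiffOn ℝ ∞ (fun z : X × ℝ => f z.1 z.2) (V ×ˢ univ)

lemma JointSmooth.of_contDiff {V : Set X} {f : ℝ → ℝ} (hf : ContDiff ℝ ∞ f) :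
    JointSmooth V (fun _ => f) := (hf.comp contDiff_snd).contDiffOn

lemma JointSmooth.add {V : Set X} {f g : X → ℝ → ℝ} (hf : JointSmooth V f)
    (hg : JointSmooth V g) : JointSmooth V (fun y x => f y x + g y x) := ContDiffOn.add hf hg

lemma JointSmooth.mul {V : Set X} {f g : X → ℝ → ℝ} (hf : JointSmooth V f)
    (hg : JointSmooth V g) : JointSmooth V (fun y x => f y x * g y x) := ContDiffOn.mul hf hg

lemma JointSmooth.sum {ι : Type*} {s : Finset ι} {V : Set X} {f : ι → X → ℝ → ℝ}
    (hf : ∀ i ∈ s, JointSmooth V (f i)) : JointSmooth V (fun y x => ∑ i ∈ s, f i y x) :=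
  ContDiffOn.sum hf

lemma JointSmooth.comp_clm {V : Set X} {f : X → ℝ → ℝ} (hf : JointSmooth V f) (L : Y →L[ℝ] X)
    {W : Set Y} (hW : MapsTo L W V) : JointSmooth W (fun y x => f (L y) x) :=
  ContDiffOn.comp (g := fun z : X × ℝ => f z.1 z.2) (f := fun z : Y × ℝ => (L z.1, z.2)) hf
    ((L.contDiff.comp contDiff_fst).prodMk contDiff_snd).contDiffOn
    fun _ hz => ⟨hW hz.1, mem_univ _⟩

lemma JointSmooth.comp_pi {n : ℕ} {U : Set (Fin n → ℝ)} {V : Set X} {f : (Fin n → ℝ) → ℝ}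
    (hf : ContDiffOn ℝ ∞ f U) {w : X → ℝ → Fin n → ℝ} (hw : ∀ i, JointSmooth V (fun y x => w y x i))
    (hwU : ∀ y ∈ V, ∀ x, w y x ∈ U) : JointSmooth V (fun y x => f (w y x)) :=
  ContDiffOn.comp (f := fun z : X × ℝ => w z.1 z.2) hf (contDiffOn_pi.2 hw)
    fun _ hz => hwU _ hz.1 _

lemma JointSmooth.contDiffAt {V : Set X} {f : X → ℝ → ℝ} (hf : JointSmooth V f) (hV : IsOpen V)
    {y : X} (hy : y ∈ V) (x : ℝ) : ContDiffAt ℝ ∞ (fun z : X × ℝ => f z.1 z.2) (y, x) :=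
  ContDiffOn.contDiffAt hf ((hV.prod isOpen_univ).mem_nhds ⟨hy, mem_univ _⟩)

lemma JointSmooth.deriv {V : Set X} {f : X → ℝ → ℝ} (hf : JointSmooth V f) (hV : IsOpen V) :
    JointSmooth V (fun y x => _root_.deriv (f y) x) := by
  have h1 : ContDiffOn ℝ ∞ (fun z : X × ℝ => fderiv ℝ (fun z : X × ℝ => f z.1 z.2) z (0, 1))
      (V ×ˢ univ) :=
    (hf.fderiv_of_isOpen (hV.prod isOpen_univ) (by simp)).clm_apply contDiffOn_const
  refine h1.congr fun z hz => ?_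
  have h2 : HasFDerivAt (fun z : X × ℝ => f z.1 z.2) _ (z.1, z.2) :=
    ((hf.contDiffAt hV hz.1 z.2).differentiableAt (by simp)).hasFDerivAt
  have h3 : HasDerivAt (fun x : ℝ => (z.1, x)) ((0 : X), (1 : ℝ)) z.2 :=
    (hasDerivAt_const z.2 z.1).prodMk (hasDerivAt_id z.2)
  exact (h2.comp_hasDerivAt z.2 h3).deriv

lemma JointSmooth.iteratedDeriv {V : Set X} {f : X → ℝ → ℝ} (hf : JointSmooth V f)
    (hV : IsOpen V) (k : ℕ) : JointSmooth V (fun y x => _root_.iteratedDeriv k (f y) x) := by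
  induction k with
  | zero => simpa using hf
  | succ k ih => simp only [iteratedDeriv_succ]; exact ih.deriv hV

lemma JointSmooth.continuous_snd {V : Set X} {f : X → ℝ → ℝ} (hf : JointSmooth V f)
    {y : X} (hy : y ∈ V) : Continuous (f y) :=
  (ContDiffOn.continuousOn hf).comp_continuous (f := fun x : ℝ => (y, x)) (by fun_prop)
    fun x => ⟨hy, mem_univ _⟩

lemma JointSmooth.hasFDerivAt_fst {V : Set X} {f : X → ℝ → ℝ} (hf : JointSmooth V f)
    (hV : IsOpen V) {y : X} (hy : y ∈ V) (x : ℝ) :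
    HasFDerivAt (fun y => f y x) ((fderiv ℝ (fun z : X × ℝ => f z.1 z.2) (y, x)).comp
      (ContinuousLinearMap.inl ℝ X ℝ)) y :=
  HasFDerivAt.comp (g := fun z : X × ℝ => f z.1 z.2) (f := fun y => (y, x)) y
    ((hf.contDiffAt hV hy x).differentiableAt (by simp)).hasFDerivAt
    (hasFDerivAt_prodMk_left y x)

/-- The parameter derivative is continuous, hence bounded on a compact ball times [0,1]; that bound
is the dominating function. -/
lemma JointSmooth.hasFDerivAt_integral [FiniteDimensional ℝ X] {V : Set X} {f : X → ℝ → ℝ}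
    (hf : JointSmooth V f) (hV : IsOpen V) {y₀ : X} (hy : y₀ ∈ V) :
    HasFDerivAt (fun y => ∫ x in (0 : ℝ)..1, f y x)
      (∫ x in (0 : ℝ)..1, (fderiv ℝ (fun z : X × ℝ => f z.1 z.2) (y₀, x)).comp
        (ContinuousLinearMap.inl ℝ X ℝ)) y₀ := by
  set D : X × ℝ → X →L[ℝ] ℝ := fun z => (fderiv ℝ (fun z : X × ℝ => f z.1 z.2) z).comp
        (ContinuousLinearMap.inl ℝ X ℝ) with hD
  have hDc : ContinuousOn D (V ×ˢ univ) :=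
    ((hf.fderiv_of_isOpen (m := ∞) (hV.prod isOpen_univ) (by simp)).clm_comp
      contDiffOn_const).continuousOn
  obtain ⟨r, hr, hrV⟩ := Metric.nhds_basis_closedBall.mem_iff.1 (hV.mem_nhds hy)
  have hK : IsCompact (Metric.closedBall y₀ r ×ˢ Icc (0 : ℝ) 1) :=
    (isCompact_closedBall y₀ r).prod isCompact_Icc
  obtain ⟨C, hC⟩ := hK.exists_bound_of_continuousOn
    (hDc.mono (prod_mono hrV (subset_univ _)))
  have hder : ∀ y ∈ V, ∀ x, HasFDerivAt (fun y => f y x) (D (y, x)) y := fun y hy x =>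
    hf.hasFDerivAt_fst hV hy x
  refine intervalIntegral.hasFDerivAt_integral_of_dominated_of_fderiv_le
    (bound := fun _ => C) (F' := fun y x => D (y, x)) (Metric.closedBall_mem_nhds y₀ hr) ?_ ?_ ?_ ?_ ?_ ?_
  · filter_upwards [hV.mem_nhds hy] with y hy
    exact (hf.continuous_snd hy).aestronglyMeasurable
  · exact (hf.continuous_snd hy).intervalIntegrable _ _
  · exact (hDc.comp_continuous (f := fun x : ℝ => (y₀, x)) (by fun_prop)
      fun x => ⟨hy, mem_univ _⟩).aestronglyMeasurable
  · refine Filter.Eventually.of_forall fun x hx y hy => hC (y, x) ⟨hy, ?_⟩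
    rw [uIoc_of_le zero_le_one] at hx
    exact ⟨hx.1.le, hx.2⟩
  · exact intervalIntegrable_const
  · exact Filter.Eventually.of_forall fun x _ y hy => hder y (hrV hy) x

lemma JointSmooth.hasDerivAt_integral {V : Set ℝ} {f : ℝ → ℝ → ℝ}
    (hf : JointSmooth V f) (hV : IsOpen V) {y₀ : ℝ} (hy : y₀ ∈ V) {f' : ℝ → ℝ}
    (hf' : ∀ x, HasDerivAt (fun y => f y x) (f' x) y₀) :
    HasDerivAt (fun y => ∫ x in (0 : ℝ)..1, f y x) (∫ x in (0 : ℝ)..1, f' x) y₀ := by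
  have h := (hf.hasFDerivAt_integral hV hy).hasDerivAt
  convert h using 1
  rw [ContinuousLinearMap.intervalIntegral_apply]
  · refine intervalIntegral.integral_congr fun x _ => ?_
    exact (hf' x).unique (hf.hasFDerivAt_fst hV hy x).hasDerivAt
  · refine ContinuousOn.intervalIntegrable (Continuous.continuousOn ?_)
    exact ((hf.fderiv_of_isOpen (m := ∞) (hV.prod isOpen_univ) (by simp)).clm_comp
      contDiffOn_const).continuousOn.comp_continuous (f := fun x : ℝ => (y₀, x)) (by fun_prop)
      fun x => ⟨hy, mem_univ _⟩

end JointSmooth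

end DegTwo

namespace DegTwo

open scoped ContDiff Topology
open Set

/-! ### Differential functions and the variational derivative -/

section DiffFn

variable {n : ℕ} {U : Set (Fin n → ℝ)}

/-- One period is compact, so the tube lemma yields a radius valid for all x in it, and periodicity
extends this to the line. -/
lemma exists_pos_forall_add_smul_mem (hU : IsOpen U) {u v : ℝ → Fin n → ℝ} (hu : u ∈ loopSpace U)
    (hv : SmoothPer v) : ∃ r > 0, ∀ η ∈ Metric.ball (0 : ℝ) r, u + η • v ∈ loopSpace U := by
  have hus : SmoothPer u := hu.1
  have hO : IsOpen {z : ℝ × ℝ | u z.2 + z.1 • v z.2 ∈ U} := by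
    refine hU.preimage ?_
    have h1 := hus.continuous
    have h2 := hv.continuous
    fun_prop
  obtain ⟨V, W, hV, -, h0, hIW, hVW⟩ := generalized_tube_lemma
    (isCompact_singleton (x := (0 : ℝ))) (isCompact_Icc (a := (0 : ℝ)) (b := 1)) hO (by
      rintro ⟨η, x⟩ ⟨hη, -⟩
      simp only [mem_singleton_iff] at hη
      subst hη
      simpa using hu.2 x)
  obtain ⟨r, hr, hrV⟩ := Metric.isOpen_iff.1 hV 0 (h0 rfl)
  refine ⟨r, hr, fun η hη => ⟨hus.add ((SmoothPer.const η).smul hv), fun x => ?_⟩⟩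
  have hp : Function.Periodic (fun x => u x + η • v x) 1 :=
    (hus.add ((SmoothPer.const η).smul hv)).2
  obtain ⟨y, hy, hxy⟩ := hp.exists_mem_Ico₀ one_pos x
  have : (η, y) ∈ V ×ˢ W := ⟨hrV hη, hIW ⟨hy.1, hy.2.le⟩⟩
  have := hVW this
  simp only [Pi.add_apply, Pi.smul_apply]
  rw [hxy]
  exact this

lemma isOpen_jetDomain (hU : IsOpen U) (m : ℕ) : IsOpen (jetDomain U m) :=
  hU.preimage (by fun_prop : Continuous fun p : ℝ × (Fin (m + 1) → Fin n → ℝ) => p.2 0)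

lemma jet_mem_jetDomain {u : ℝ → Fin n → ℝ} (hu : u ∈ loopSpace U) (m : ℕ) (x : ℝ) :
    (x, jet m u x) ∈ jetDomain U m := by
  simpa [jetDomain, jet] using hu.2 x

lemma jet_add_smul {u v : ℝ → Fin n → ℝ} (hu : SmoothPer u) (hv : SmoothPer v) (m : ℕ) (η x : ℝ) :
    jet m (u + η • v) x = jet m u x + η • jet m v x := by
  funext k
  have h1 : ContDiff ℝ (k : ℕ) u := hu.1.of_le (by exact_mod_cast le_top)
  have h2 : ContDiff ℝ (k : ℕ) v := hv.1.of_le (by exact_mod_cast le_top)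
  simp only [jet, Pi.add_apply, Pi.smul_apply]
  rw [← iteratedDeriv_const_smul h2.contDiffAt]
  exact iteratedDeriv_add h1.contDiffAt (h2.const_smul η).contDiffAt

lemma smoothPer_jet {u : ℝ → Fin n → ℝ} (hu : SmoothPer u) (m : ℕ) : SmoothPer (jet m u) :=
  smoothPer_pi.2 fun k => hu.iteratedDeriv k

/-- Functions `Q[u](x) = h(x, u, u_x, …, u^{(m)})` of a loop `u` and a point `x`, with `h` smooth. -/
def IsDiffFn (U : Set (Fin n → ℝ)) (Q : (ℝ → Fin n → ℝ) → ℝ → ℝ) : Prop :=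
  ∃ (m : ℕ) (h : ℝ × (Fin (m + 1) → Fin n → ℝ) → ℝ),
    ContDiffOn ℝ ∞ h (jetDomain U m) ∧
    (∀ p ∈ jetDomain U m, h (p.1 + 1, p.2) = h p) ∧
    ∀ u ∈ loopSpace U, ∀ x, Q u x = h (x, jet m u x)

lemma IsDiffFn.congr {Q Q' : (ℝ → Fin n → ℝ) → ℝ → ℝ} (hQ : IsDiffFn U Q)
    (h : ∀ u ∈ loopSpace U, ∀ x, Q' u x = Q u x) : IsDiffFn U Q' := by
  obtain ⟨m, f, h1, h2, h3⟩ := hQ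
  exact ⟨m, f, h1, h2, fun u hu x => (h u hu x).trans (h3 u hu x)⟩

/-- Raising the order of a density allows two differential functions to be placed on the same jet
space. -/
lemma IsDiffFn.exists_of_le {Q : (ℝ → Fin n → ℝ) → ℝ → ℝ} (hQ : IsDiffFn U Q) :
    ∃ m₀, ∀ m, m₀ ≤ m → ∃ h : ℝ × (Fin (m + 1) → Fin n → ℝ) → ℝ,
      ContDiffOn ℝ ∞ h (jetDomain U m) ∧
      (∀ p ∈ jetDomain U m, h (p.1 + 1, p.2) = h p) ∧
      ∀ u ∈ loopSpace U, ∀ x, Q u x = h (x, jet m u x) := by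
  obtain ⟨m₀, f, h1, h2, h3⟩ := hQ
  refine ⟨m₀, fun m hm => ?_⟩
  have hle : m₀ + 1 ≤ m + 1 := by omega
  refine ⟨fun p => f (p.1, fun k => p.2 (Fin.castLE hle k)), ?_, ?_, ?_⟩
  · refine h1.comp (ContDiff.contDiffOn ?_) fun p hp => ?_
    · fun_prop
    · simpa [jetDomain] using hp
  · exact fun p hp => h2 (p.1, fun k => p.2 (Fin.castLE hle k)) (by simpa [jetDomain] using hp)
  · exact fun u hu x => h3 u hu x

lemma IsDiffFn.of_contDiff {f : ℝ × ℝ → ℝ} (hf : ContDiff ℝ ∞ f)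
    {Q R : (ℝ → Fin n → ℝ) → ℝ → ℝ} (hQ : IsDiffFn U Q) (hR : IsDiffFn U R) :
    IsDiffFn U (fun u x => f (Q u x, R u x)) := by
  obtain ⟨m, hm⟩ := hQ.exists_of_le
  obtain ⟨m', hm'⟩ := hR.exists_of_le
  obtain ⟨h, h1, h2, h3⟩ := hm (max m m') (le_max_left _ _)
  obtain ⟨k, k1, k2, k3⟩ := hm' (max m m') (le_max_right _ _)
  refine ⟨max m m', fun p => f (h p, k p), hf.comp_contDiffOn (h1.prodMk k1), fun p hp => ?_,
    fun u hu x => ?_⟩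
  · simp only [h2 p hp, k2 p hp]
  · simp only [h3 u hu x, k3 u hu x]

lemma IsDiffFn.add {Q R : (ℝ → Fin n → ℝ) → ℝ → ℝ} (hQ : IsDiffFn U Q) (hR : IsDiffFn U R) :
    IsDiffFn U (fun u x => Q u x + R u x) :=
  IsDiffFn.of_contDiff (f := fun z => z.1 + z.2) (by fun_prop) hQ hR

lemma IsDiffFn.mul {Q R : (ℝ → Fin n → ℝ) → ℝ → ℝ} (hQ : IsDiffFn U Q) (hR : IsDiffFn U R) :
    IsDiffFn U (fun u x => Q u x * R u x) :=
  IsDiffFn.of_contDiff (f := fun z => z.1 * z.2) (by fun_prop) hQ hR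

lemma IsDiffFn.of_smoothPer {f : ℝ → ℝ} (hf : SmoothPer f) : IsDiffFn U (fun _ x => f x) :=
  ⟨0, fun p => f p.1, (hf.1.comp contDiff_fst).contDiffOn, fun p _ => hf.2 p.1, fun _ _ _ => rfl⟩

lemma IsDiffFn.of_contDiffOn {f : (Fin n → ℝ) → ℝ} (hf : ContDiffOn ℝ ∞ f U) :
    IsDiffFn U (fun u x => f (u x)) :=
  ⟨0, fun p => f (p.2 0), hf.comp (ContDiff.contDiffOn (by fun_prop)) fun _ hp => hp,
    fun _ _ => rfl, fun u _ x => by simp [jet]⟩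

lemma IsDiffFn.coord (k : ℕ) (i : Fin n) : IsDiffFn U (fun u x => iteratedDeriv k u x i) :=
  ⟨k, fun p => p.2 (Fin.last k) i, ContDiff.contDiffOn (by fun_prop), fun _ _ => rfl,
    fun u _ x => by simp [jet]⟩

lemma IsDiffFn.sum {ι : Type*} {s : Finset ι} {Q : ι → (ℝ → Fin n → ℝ) → ℝ → ℝ}
    (hQ : ∀ i ∈ s, IsDiffFn U (Q i)) : IsDiffFn U (fun u x => ∑ i ∈ s, Q i u x) := by
  classical
  induction s using Finset.induction_on with
  | empty => simpa using IsDiffFn.of_smoothPer (SmoothPer.const (V := ℝ) 0)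
  | insert i s hi ih =>
    simp only [Finset.sum_insert hi]
    exact (hQ i (Finset.mem_insert_self _ _)).add
      (ih fun j hj => hQ j (Finset.mem_insert_of_mem hj))

lemma hasDerivAt_jet {u : ℝ → Fin n → ℝ} (hu : SmoothPer u) (m : ℕ) (x : ℝ) :
    HasDerivAt (jet m u) (fun k => iteratedDeriv (k + 1 : ℕ) u x) x := by
  refine hasDerivAt_pi.2 fun k => ?_
  rw [iteratedDeriv_succ]
  exact (hu.iteratedDeriv k).hasDerivAt x

/-- Periodicity in x is assumed only on `jetDomain`; as this set is open, the identity holds near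
each point and can be differentiated. -/
lemma fderiv_add_one_period {m : ℕ} (hU : IsOpen U) {h : ℝ × (Fin (m + 1) → Fin n → ℝ) → ℝ}
    (h2 : ∀ p ∈ jetDomain U m, h (p.1 + 1, p.2) = h p) {p : ℝ × (Fin (m + 1) → Fin n → ℝ)}
    (hp : p ∈ jetDomain U m) : fderiv ℝ h (p.1 + 1, p.2) = fderiv ℝ h p := by
  have e : (fun q : ℝ × (Fin (m + 1) → Fin n → ℝ) => h (q + (1, 0))) =ᶠ[𝓝 p] h := by
    filter_upwards [(isOpen_jetDomain hU m).mem_nhds hp] with q hq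
    rw [← h2 q hq]
    congr 1
    ext <;> simp
  rw [← e.fderiv_eq, fderiv_comp_add_right]
  congr 1
  ext <;> simp

/-- The total derivative is the derivative of the density in the direction (1, shifted jet), which
raises the order by one. -/
lemma IsDiffFn.deriv (hU : IsOpen U) {Q : (ℝ → Fin n → ℝ) → ℝ → ℝ} (hQ : IsDiffFn U Q) :
    IsDiffFn U (fun u x => deriv (Q u) x) := by
  obtain ⟨m, h, h1, h2, h3⟩ := hQ
  refine ⟨m + 1, fun p => fderiv ℝ h (p.1, fun k => p.2 k.castSucc) (1, fun k => p.2 k.succ),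
    ?_, ?_, ?_⟩
  · refine ContDiffOn.clm_apply ?_ (ContDiff.contDiffOn (by fun_prop))
    exact (h1.fderiv_of_isOpen (isOpen_jetDomain hU m) (by simp)).comp
      (ContDiff.contDiffOn (by fun_prop)) fun p hp => hp
  · intro p hp
    exact congrArg (fun L : ℝ × (Fin (m + 1) → Fin n → ℝ) →L[ℝ] ℝ => L (1, fun k => p.2 k.succ))
      (fderiv_add_one_period hU h2 (p := (p.1, fun k => p.2 k.castSucc)) hp)
  · intro u hu x
    have e : Q u = fun x => h (x, jet m u x) := funext (h3 u hu)
    have hd : HasFDerivAt h _ (x, jet m u x) :=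
      ((h1.contDiffAt ((isOpen_jetDomain hU m).mem_nhds (jet_mem_jetDomain hu m x))).differentiableAt
        (by simp)).hasFDerivAt
    have := hd.comp_hasDerivAt x ((hasDerivAt_id x).prodMk (hasDerivAt_jet hu.1 m x))
    beta_reduce
    rw [e]
    exact this.deriv

lemma IsDiffFn.iteratedDeriv (hU : IsOpen U) {Q : (ℝ → Fin n → ℝ) → ℝ → ℝ} (hQ : IsDiffFn U Q)
    (k : ℕ) : IsDiffFn U (fun u x => iteratedDeriv k (Q u) x) := by
  induction k with
  | zero => simpa using hQ
  | succ k ih => simp only [iteratedDeriv_succ]; exact ih.deriv hU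

lemma IsDiffFn.smoothPer {Q : (ℝ → Fin n → ℝ) → ℝ → ℝ} (hQ : IsDiffFn U Q)
    {u : ℝ → Fin n → ℝ} (hu : u ∈ loopSpace U) : SmoothPer (Q u) := by
  obtain ⟨m, h, h1, h2, h3⟩ := hQ
  have e : Q u = fun x => h (x, jet m u x) := funext (h3 u hu)
  rw [e]
  refine ⟨?_, fun x => ?_⟩
  · exact h1.comp_contDiff (contDiff_id.prodMk (smoothPer_jet hu.1 m).1)
      fun x => jet_mem_jetDomain hu m x
  · beta_reduce
    rw [(smoothPer_jet hu.1 m).2 x]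
    exact h2 _ (jet_mem_jetDomain hu m x)

lemma contDiff_jet_line {u v : ℝ → Fin n → ℝ} (hu : SmoothPer u) (hv : SmoothPer v) (m : ℕ) :
    ContDiff ℝ ∞ (fun z : ℝ × ℝ => (z.2, jet m u z.2 + z.1 • jet m v z.2)) := by
  have h1 := (smoothPer_jet hu m).1
  have h2 := (smoothPer_jet hv m).1
  exact contDiff_snd.prodMk ((h1.comp contDiff_snd).add
    (contDiff_fst.smul (h2.comp contDiff_snd)))

lemma IsDiffFn.jointSmooth {Q : (ℝ → Fin n → ℝ) → ℝ → ℝ} (hQ : IsDiffFn U Q)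
    {u v : ℝ → Fin n → ℝ} (hu : SmoothPer u) (hv : SmoothPer v) {V : Set ℝ}
    (hV : ∀ η ∈ V, u + η • v ∈ loopSpace U) : JointSmooth V (fun η x => Q (u + η • v) x) := by
  obtain ⟨m, h, h1, h2, h3⟩ := hQ
  have : ContDiffOn ℝ ∞ (fun z : ℝ × ℝ => h (z.2, jet m u z.2 + z.1 • jet m v z.2))
      (V ×ˢ univ) := by
    refine h1.comp (contDiff_jet_line hu hv m).contDiffOn fun z hz => ?_
    rw [← jet_add_smul hu hv]
    exact jet_mem_jetDomain (hV z.1 hz.1) m z.2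
  refine this.congr fun z hz => ?_
  beta_reduce
  rw [h3 _ (hV z.1 hz.1), jet_add_smul hu hv]

lemma IsDiffFn.isLocalFunctional {Q : (ℝ → Fin n → ℝ) → ℝ → ℝ} (hQ : IsDiffFn U Q)
    {F : Functional n} (hF : ∀ u ∈ loopSpace U, F u = ∫ x in (0 : ℝ)..1, Q u x) :
    IsLocalFunctional U F := by
  obtain ⟨m, h, h1, h2, h3⟩ := hQ
  refine ⟨m, h, h1, h2, fun u hu => ?_⟩
  rw [hF u hu]
  exact intervalIntegral.integral_congr fun x _ => h3 u hu x

lemma hasDerivAt_add_smul_jet {W : Type*} [NormedAddCommGroup W] [NormedSpace ℝ W] {m : ℕ}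
    (hU : IsOpen U) {h : ℝ × (Fin (m + 1) → Fin n → ℝ) → W}
    (h1 : ContDiffOn ℝ ∞ h (jetDomain U m)) {u : ℝ → Fin n → ℝ} (hu : u ∈ loopSpace U)
    (v : ℝ → Fin n → ℝ) (x : ℝ) :
    HasDerivAt (fun η : ℝ => h (x, jet m u x + η • jet m v x))
      (fderiv ℝ h (x, jet m u x) (0, jet m v x)) 0 := by
  have hd : HasFDerivAt h (fderiv ℝ h (x, jet m u x)) (x, jet m u x + (0 : ℝ) • jet m v x) := by
    rw [zero_smul, add_zero]
    exact ((h1.contDiffAt ((isOpen_jetDomain hU m).mem_nhds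
      (jet_mem_jetDomain hu m x))).differentiableAt (by simp)).hasFDerivAt
  have h2 : HasDerivAt (fun η : ℝ => (x, jet m u x + η • jet m v x)) (0, jet m v x) 0 := by
    refine (hasDerivAt_const _ _).prodMk ?_
    simpa using ((hasDerivAt_id (0 : ℝ)).smul_const (jet m v x)).const_add (jet m u x)
  exact hd.comp_hasDerivAt 0 h2

/-- The first variation of a local functional. -/
lemma hasDerivAt_localFunctional (hU : IsOpen U) {F : Functional n} {m : ℕ}
    {h : ℝ × (Fin (m + 1) → Fin n → ℝ) → ℝ} (h1 : ContDiffOn ℝ ∞ h (jetDomain U m))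
    (h3 : ∀ u ∈ loopSpace U, F u = ∫ x in (0 : ℝ)..1, h (x, jet m u x))
    {u v : ℝ → Fin n → ℝ} (hu : u ∈ loopSpace U) (hv : SmoothPer v) :
    HasDerivAt (fun η : ℝ => F (u + η • v))
      (∫ x in (0 : ℝ)..1, fderiv ℝ h (x, jet m u x) (0, jet m v x)) 0 := by
  obtain ⟨r, hr, hV⟩ := exists_pos_forall_add_smul_mem hU hu hv
  have hs : JointSmooth (Metric.ball (0 : ℝ) r)
      (fun η x => h (x, jet m u x + η • jet m v x)) := by
    refine h1.comp (contDiff_jet_line hu.1 hv m).contDiffOn fun z hz => ?_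
    rw [← jet_add_smul hu.1 hv]
    exact jet_mem_jetDomain (hV z.1 hz.1) m z.2
  refine (hs.hasDerivAt_integral Metric.isOpen_ball (Metric.mem_ball_self hr)
    (hasDerivAt_add_smul_jet hU h1 hu v)).congr_of_eventuallyEq ?_
  filter_upwards [Metric.ball_mem_nhds _ hr] with η hη
  rw [h3 _ (hV η hη)]
  simp only [jet_add_smul hu.1 hv]

lemma sum_single_single {m : ℕ} (w : Fin (m + 1) → Fin n → ℝ)
    (L : ℝ × (Fin (m + 1) → Fin n → ℝ) →L[ℝ] ℝ) :
    L (0, w) = ∑ i, ∑ k, L (0, Pi.single k (Pi.single i 1)) * w k i := by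
  have e : ((0 : ℝ), w) = ∑ i, ∑ k, w k i •
      ((0 : ℝ), (Pi.single k (Pi.single i 1) : Fin (m + 1) → Fin n → ℝ)) := by
    refine Prod.ext ?_ ?_
    · simp [Prod.fst_sum]
    · simp only [Prod.snd_sum, Prod.smul_snd]
      funext k i
      simp [Finset.sum_apply, Pi.single_apply, Finset.sum_ite_eq]
  rw [e]
  simp only [map_sum, map_smul, smul_eq_mul, mul_comm]

/-- Every local functional has a variational derivative, which is given by differential functions. -/
lemma IsLocalFunctional.exists_hasVarDeriv (hU : IsOpen U) {F : Functional n}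
    (hF : IsLocalFunctional U F) : ∃ Q : Fin n → (ℝ → Fin n → ℝ) → ℝ → ℝ,
      (∀ i, IsDiffFn U (Q i)) ∧ ∀ u ∈ loopSpace U, HasVarDeriv F u (fun x i => Q i u x) := by
  obtain ⟨m, h, h1, h2, h3⟩ := hF
  set R : Fin n → Fin (m + 1) → (ℝ → Fin n → ℝ) → ℝ → ℝ := fun i k u x =>
    fderiv ℝ h (x, jet m u x) (0, Pi.single k (Pi.single i 1)) with hRdef
  have hR : ∀ i k, IsDiffFn U (R i k) := fun i k =>
    ⟨m, fun p => fderiv ℝ h p (0, Pi.single k (Pi.single i 1)),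
      (h1.fderiv_of_isOpen (isOpen_jetDomain hU m) (by simp)).clm_apply contDiffOn_const,
      fun p hp => by simp only [fderiv_add_one_period hU h2 hp], fun _ _ _ => rfl⟩
  -- The Euler–Lagrange expression; `R i k` is the partial derivative of the density in the k-th jet
  -- variable of u^i.
  set Q : Fin n → (ℝ → Fin n → ℝ) → ℝ → ℝ := fun i u x =>
    ∑ k : Fin (m + 1), (-1) ^ (k : ℕ) * iteratedDeriv k (R i k u) x with hQdef
  have hQ : ∀ i, IsDiffFn U (Q i) := fun i => IsDiffFn.sum fun k _ =>
    (IsDiffFn.of_smoothPer (SmoothPer.const _)).mul ((hR i k).iteratedDeriv hU k)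
  refine ⟨Q, hQ, fun u hu => ⟨smoothPer_pi.2 fun i => (hQ i).smoothPer hu, fun v hv => ?_⟩⟩
  have hv' : SmoothPer v := hv
  have hvi := smoothPer_pi.1 hv'
  convert hasDerivAt_localFunctional hU h1 h3 hu hv' using 1
  have e1 : ∀ x, fderiv ℝ h (x, jet m u x) (0, jet m v x)
      = ∑ i, ∑ k : Fin (m + 1), R i k u x * iteratedDeriv k (fun y => v y i) x := fun x => by
    rw [sum_single_single]
    simp only [jet, hv'.iteratedDeriv_apply, hRdef]
  have e2 : ∀ x, ∑ i, Q i u x * v x i = ∑ i, ∑ k : Fin (m + 1),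
      (-1) ^ (k : ℕ) * (iteratedDeriv k (R i k u) x * v x i) := fun x => by
    simp only [hQdef, Finset.sum_mul, mul_assoc]
  simp only [e1, e2]
  have c1 : ∀ i (k : Fin (m + 1)), SmoothPer fun x =>
      R i k u x * iteratedDeriv k (fun y => v y i) x := fun i k =>
    ((hR i k).smoothPer hu).mul ((hvi i).iteratedDeriv k)
  have c2 : ∀ i (k : Fin (m + 1)), SmoothPer fun x =>
      (-1) ^ (k : ℕ) * (iteratedDeriv k (R i k u) x * v x i) := fun i k =>
    (SmoothPer.const _).mul ((((hR i k).smoothPer hu).iteratedDeriv k).mul (hvi i))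
  rw [intervalIntegral.integral_finsetSum fun i _ =>
      (SmoothPer.sum fun k _ => c2 i k).continuous.intervalIntegrable _ _,
    intervalIntegral.integral_finsetSum fun i _ =>
      (SmoothPer.sum fun k _ => c1 i k).continuous.intervalIntegrable _ _]
  refine Finset.sum_congr rfl fun i _ => ?_
  rw [intervalIntegral.integral_finsetSum fun k _ =>
      (c2 i k).continuous.intervalIntegrable _ _,
    intervalIntegral.integral_finsetSum fun k _ =>
      (c1 i k).continuous.intervalIntegrable _ _]
  refine Finset.sum_congr rfl fun k _ => ?_
  rw [((hR i k).smoothPer hu).integral_mul_iteratedDeriv (hvi i),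
    intervalIntegral.integral_const_mul]

lemma IsLocalFunctional.hasVarDeriv (hU : IsOpen U) {F : Functional n}
    (hF : IsLocalFunctional U F) {u : ℝ → Fin n → ℝ} (hu : u ∈ loopSpace U) :
    HasVarDeriv F u (varDeriv F u) := by
  obtain ⟨Q, -, h⟩ := hF.exists_hasVarDeriv hU
  rw [(h u hu).varDeriv_eq]
  exact h u hu

lemma IsLocalFunctional.isDiffFn_varDeriv (hU : IsOpen U) {F : Functional n}
    (hF : IsLocalFunctional U F) (i : Fin n) : IsDiffFn U (fun u x => varDeriv F u x i) := by
  obtain ⟨Q, hQ, h⟩ := hF.exists_hasVarDeriv hU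
  exact (hQ i).congr fun u hu x => by rw [(h u hu).varDeriv_eq]

lemma IsLocalFunctional.smoothPer_varDeriv (hU : IsOpen U) {F : Functional n}
    (hF : IsLocalFunctional U F) {u : ℝ → Fin n → ℝ} (hu : u ∈ loopSpace U) :
    SmoothPer (varDeriv F u) := (hF.hasVarDeriv hU hu).1

/-- The second variation of a local functional is symmetric. -/
lemma IsLocalFunctional.exists_hessian (hU : IsOpen U) {F : Functional n}
    (hF : IsLocalFunctional U F) {u : ℝ → Fin n → ℝ} (hu : u ∈ loopSpace U) :
    ∃ B : (ℝ → Fin n → ℝ) → (ℝ → Fin n → ℝ) → ℝ, (∀ v w, B v w = B w v) ∧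
      ∀ v w : ℝ → Fin n → ℝ, SmoothPer v → SmoothPer w →
        HasDerivAt (fun η : ℝ => ∫ x in (0 : ℝ)..1, ∑ i, varDeriv F (u + η • v) x i * w x i)
          (B v w) 0 := by
  obtain ⟨m, h, h1, h2, h3⟩ := id hF
  have hO := isOpen_jetDomain hU m
  have h1' : ContDiffOn ℝ ∞ (fderiv ℝ h) (jetDomain U m) := h1.fderiv_of_isOpen hO (by simp)
  refine ⟨fun v w => ∫ x in (0 : ℝ)..1,
    fderiv ℝ (fderiv ℝ h) (x, jet m u x) (0, jet m v x) (0, jet m w x), fun v w => ?_,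
    fun v w hv hw => ?_⟩
  -- Symmetry is already pointwise: it is that of the second derivative of the density.
  · refine intervalIntegral.integral_congr fun x _ => ?_
    exact (h1.contDiffAt (hO.mem_nhds (jet_mem_jetDomain hu m x))).isSymmSndFDerivAt
      (by simpa using WithTop.coe_le_coe.2 (le_top (a := (2 : ℕ∞)))) _ _
  · obtain ⟨r, hr, hV⟩ := exists_pos_forall_add_smul_mem hU hu hv
    have hs : JointSmooth (Metric.ball (0 : ℝ) r)
        (fun η x => fderiv ℝ h (x, jet m u x + η • jet m v x) (0, jet m w x)) := by
      refine ContDiffOn.clm_apply (h1'.comp (contDiff_jet_line hu.1 hv m).contDiffOn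
        fun z hz => ?_) (contDiff_const.prodMk
          ((smoothPer_jet hw m).1.comp contDiff_snd)).contDiffOn
      rw [← jet_add_smul hu.1 hv]
      exact jet_mem_jetDomain (hV z.1 hz.1) m z.2
    refine (hs.hasDerivAt_integral Metric.isOpen_ball (Metric.mem_ball_self hr)
      (fun x => ?_)).congr_of_eventuallyEq ?_
    · simpa using (hasDerivAt_add_smul_jet hU h1' hu v x).clm_apply
        (hasDerivAt_const (0 : ℝ) ((0 : ℝ), jet m w x))
    · filter_upwards [Metric.ball_mem_nhds _ hr] with η hη
      have e := ((hF.hasVarDeriv hU (hV η hη)).2 w hw).unique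
        (hasDerivAt_localFunctional hU h1 h3 (hV η hη) hw)
      rw [e]
      simp only [jet_add_smul hu.1 hv]

end DiffFn

end DegTwo

namespace DegTwo

open scoped ContDiff Topology
open Set

/-! ### Reduction of the Poisson property to identities on smooth covector fields -/

namespace Operator

variable {n : ℕ} {U : Set (Fin n → ℝ)} {P : Operator n}

/-- The bilinear form `∫ p_i P^{ij} q_j dx` along the loop `u`. -/
noncomputable def opForm (P : Operator n) (u p q : ℝ → Fin n → ℝ) : ℝ :=
  ∫ x in (0 : ℝ)..1, ∑ i, p x i * P.apply u q x i

/-- The derivative of `opForm` with respect to the loop, in the direction `w`. -/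
noncomputable def opFormDeriv (P : Operator n) (u p q w : ℝ → Fin n → ℝ) : ℝ :=
  deriv (fun η : ℝ => P.opForm (u + η • w) p q) 0

/-- The Schouten bracket `[P, P]` evaluated on three covector fields. -/
noncomputable def schouten (P : Operator n) (u p q r : ℝ → Fin n → ℝ) : ℝ :=
  P.opFormDeriv u p q (P.apply u r) + P.opFormDeriv u q r (P.apply u p)
    + P.opFormDeriv u r p (P.apply u q)

/-- `P` is formally skew-adjoint along all loops in `U`. -/
def IsSkew (P : Operator n) (U : Set (Fin n → ℝ)) : Prop :=
  ∀ u ∈ loopSpace U, ∀ p q, SmoothPer p → SmoothPer q → P.opForm u p q = -P.opForm u q p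

lemma bracket_eq_opForm (F G : Functional n) (u : ℝ → Fin n → ℝ) :
    P.bracket F G u = P.opForm u (varDeriv F u) (varDeriv G u) := rfl

/-- Both the loop and the covector field may depend on the parameter, as they do when a bracket of
two functionals is varied. -/
lemma jointSmooth_apply {X : Type*} [NormedAddCommGroup X] [NormedSpace ℝ X] (hP : P.SmoothOn U)
    {V : Set X} (hV : IsOpen V) {w q : X → ℝ → Fin n → ℝ}
    (hw : ∀ i, JointSmooth V (fun y x => w y x i)) (hq : ∀ i, JointSmooth V (fun y x => q y x i))
    (hwU : ∀ y ∈ V, w y ∈ loopSpace U) (hqs : ∀ y ∈ V, SmoothPer (q y)) (i : Fin n) :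
    JointSmooth V (fun y x => P.apply (w y) (q y) x i) := by
  have hw1 : ∀ k, JointSmooth V (fun y x => deriv (w y) x k) := fun k =>
    ((hw k).deriv hV).congr fun z hz => SmoothPer.deriv_apply (hwU z.1 hz.1).1 z.2 k
  have hw2 : ∀ k, JointSmooth V (fun y x => iteratedDeriv 2 (w y) x k) := fun k =>
    ((hw k).iteratedDeriv hV 2).congr fun z hz =>
      SmoothPer.iteratedDeriv_apply (hwU z.1 hz.1).1 2 z.2 k
  have hq1 : ∀ k, JointSmooth V (fun y x => deriv (q y) x k) := fun k =>
    ((hq k).deriv hV).congr fun z hz => SmoothPer.deriv_apply (hqs z.1 hz.1) z.2 k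
  have hq2 : ∀ k, JointSmooth V (fun y x => iteratedDeriv 2 (q y) x k) := fun k =>
    ((hq k).iteratedDeriv hV 2).congr fun z hz =>
      SmoothPer.iteratedDeriv_apply (hqs z.1 hz.1) 2 z.2 k
  have hf : ∀ f : (Fin n → ℝ) → ℝ, ContDiffOn ℝ ∞ f U → JointSmooth V (fun y x => f (w y x)) :=
    fun f hf => JointSmooth.comp_pi hf hw fun y hy x => (hwU y hy).2 x
  refine JointSmooth.sum fun j _ => (((hf _ (hP.a i j)).mul (hq2 j)).add
    ((JointSmooth.sum fun k _ => (hf _ (hP.b i j k)).mul (hw1 k)).mul (hq1 j))).add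
    (((JointSmooth.sum fun k _ => JointSmooth.sum fun l _ =>
      ((hf _ (hP.cc i j k l)).mul (hw1 k)).mul (hw1 l)).add
      (JointSmooth.sum fun k _ => (hf _ (hP.c i j k)).mul (hw2 k))).mul (hq j))

lemma isDiffFn_apply (hU : IsOpen U) (hP : P.SmoothOn U)
    {Q : (ℝ → Fin n → ℝ) → ℝ → Fin n → ℝ}
    (hQ : ∀ i, IsDiffFn U (fun u x => Q u x i)) (i : Fin n) :
    IsDiffFn U (fun u x => P.apply u (Q u) x i) := by
  have hQs : ∀ u ∈ loopSpace U, SmoothPer (Q u) := fun u hu =>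
    smoothPer_pi.2 fun i => (hQ i).smoothPer hu
  have hu1 : ∀ k, IsDiffFn U (fun u x => deriv u x k) := fun k =>
    (IsDiffFn.coord 1 k).congr fun u _ x => by rw [iteratedDeriv_one]
  have hu2 : ∀ k, IsDiffFn U (fun u x => iteratedDeriv 2 u x k) := IsDiffFn.coord 2
  have hq1 : ∀ k, IsDiffFn U (fun u x => deriv (Q u) x k) := fun k =>
    ((hQ k).deriv hU).congr fun u hu x => SmoothPer.deriv_apply (hQs u hu) x k
  have hq2 : ∀ k, IsDiffFn U (fun u x => iteratedDeriv 2 (Q u) x k) := fun k =>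
    ((hQ k).iteratedDeriv hU 2).congr fun u hu x => SmoothPer.iteratedDeriv_apply (hQs u hu) 2 x k
  refine IsDiffFn.sum fun j _ => (((IsDiffFn.of_contDiffOn (hP.a i j)).mul (hq2 j)).add
    ((IsDiffFn.sum fun k _ => (IsDiffFn.of_contDiffOn (hP.b i j k)).mul (hu1 k)).mul (hq1 j))).add
    (((IsDiffFn.sum fun k _ => IsDiffFn.sum fun l _ =>
      ((IsDiffFn.of_contDiffOn (hP.cc i j k l)).mul (hu1 k)).mul (hu1 l)).add
      (IsDiffFn.sum fun k _ => (IsDiffFn.of_contDiffOn (hP.c i j k)).mul (hu2 k))).mul (hQ j))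

lemma smoothPer_apply (hU : IsOpen U) (hP : P.SmoothOn U) {u q : ℝ → Fin n → ℝ}
    (hu : u ∈ loopSpace U) (hq : SmoothPer q) : SmoothPer (P.apply u q) :=
  smoothPer_pi.2 fun i => (isDiffFn_apply hU hP (Q := fun _ => q)
    (fun i => IsDiffFn.of_smoothPer (smoothPer_pi.1 hq i)) i).smoothPer hu

lemma isLocalFunctional_bracket (hU : IsOpen U) (hP : P.SmoothOn U) {F G : Functional n}
    (hF : IsLocalFunctional U F) (hG : IsLocalFunctional U G) :
    IsLocalFunctional U (P.bracket F G) :=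
  (IsDiffFn.sum fun i _ => (hF.isDiffFn_varDeriv hU i).mul
    (isDiffFn_apply hU hP (hG.isDiffFn_varDeriv hU) i)).isLocalFunctional fun _ _ => rfl

lemma jointSmooth_line {u v : ℝ → Fin n → ℝ} (hu : SmoothPer u) (hv : SmoothPer v) (V : Set ℝ)
    (i : Fin n) : JointSmooth V (fun η x => (u + η • v) x i) := by
  have h1 := (smoothPer_pi.1 hu i).1
  have h2 := (smoothPer_pi.1 hv i).1
  exact ((h1.comp contDiff_snd).add (contDiff_fst.mul (h2.comp contDiff_snd))).contDiffOn

lemma jointSmooth_opForm (hP : P.SmoothOn U) {u p q w : ℝ → Fin n → ℝ}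
    (hu : u ∈ loopSpace U) (hp : SmoothPer p) (hq : SmoothPer q) (hw : SmoothPer w) {r : ℝ}
    (hV : ∀ η ∈ Metric.ball (0 : ℝ) r, u + η • w ∈ loopSpace U) :
    JointSmooth (Metric.ball (0 : ℝ) r) (fun η x => ∑ i, p x i * P.apply (u + η • w) q x i) :=
  JointSmooth.sum fun i _ => (JointSmooth.of_contDiff (smoothPer_pi.1 hp i).1).mul
    (jointSmooth_apply hP Metric.isOpen_ball (w := fun η => u + η • w) (q := fun _ => q)
      (jointSmooth_line hu.1 hw _)
      (fun i => JointSmooth.of_contDiff (smoothPer_pi.1 hq i).1) hV (fun _ _ => hq) i)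

lemma hasDerivAt_opForm (hU : IsOpen U) (hP : P.SmoothOn U) {u p q w : ℝ → Fin n → ℝ}
    (hu : u ∈ loopSpace U) (hp : SmoothPer p) (hq : SmoothPer q) (hw : SmoothPer w) :
    HasDerivAt (fun η : ℝ => P.opForm (u + η • w) p q) (P.opFormDeriv u p q w) 0 := by
  obtain ⟨r, hr, hV⟩ := exists_pos_forall_add_smul_mem hU hu hw
  exact ((jointSmooth_opForm hP hu hp hq hw hV).hasFDerivAt_integral Metric.isOpen_ball
    (Metric.mem_ball_self hr)).differentiableAt.hasDerivAt

/-- The derivative of a bracket of local functionals along a variation of the loop. -/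
lemma hasDerivAt_bracket (hU : IsOpen U) (hP : P.SmoothOn U) (hs : P.IsSkew U)
    {F G : Functional n} (hF : IsLocalFunctional U F) (hG : IsLocalFunctional U G)
    {u v : ℝ → Fin n → ℝ} (hu : u ∈ loopSpace U) (hv : SmoothPer v) {b₁ b₂ : ℝ}
    (h₁ : HasDerivAt (fun η : ℝ => ∫ x in (0 : ℝ)..1, ∑ i, varDeriv F (u + η • v) x i *
      P.apply u (varDeriv G u) x i) b₁ 0)
    (h₂ : HasDerivAt (fun η : ℝ => ∫ x in (0 : ℝ)..1, ∑ i, varDeriv G (u + η • v) x i *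
      P.apply u (varDeriv F u) x i) b₂ 0) :
    HasDerivAt (fun η : ℝ => P.bracket F G (u + η • v))
      (b₁ - b₂ + P.opFormDeriv u (varDeriv F u) (varDeriv G u) v) 0 := by
  obtain ⟨r, hr, hV⟩ := exists_pos_forall_add_smul_mem hU hu hv
  -- The loop enters the bracket through the operator and through both gradients. The three
  -- occurrences receive independent parameters; differentiability in all three then expresses the
  -- derivative along the diagonal as a sum of three partial derivatives.
  set V : Set (ℝ × ℝ × ℝ) := Metric.ball 0 r with hVdef
  have m1 : ∀ y ∈ V, y.1 ∈ Metric.ball (0 : ℝ) r := fun y hy => by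
    rw [mem_ball_zero_iff] at *; exact (norm_fst_le y).trans_lt hy
  have m2 : ∀ y ∈ V, y.2.1 ∈ Metric.ball (0 : ℝ) r := fun y hy => by
    rw [mem_ball_zero_iff] at *
    exact ((norm_fst_le y.2).trans (norm_snd_le y)).trans_lt hy
  have m3 : ∀ y ∈ V, y.2.2 ∈ Metric.ball (0 : ℝ) r := fun y hy => by
    rw [mem_ball_zero_iff] at *
    exact ((norm_snd_le y.2).trans (norm_snd_le y)).trans_lt hy
  have hVo : IsOpen V := Metric.isOpen_ball
  set f : ℝ × ℝ × ℝ → ℝ → ℝ := fun y x => ∑ i, varDeriv F (u + y.2.1 • v) x i *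
    P.apply (u + y.1 • v) (varDeriv G (u + y.2.2 • v)) x i with hf
  have hfs : JointSmooth V f := by
    refine JointSmooth.sum fun i _ => JointSmooth.mul ?_ ?_
    · exact ((hF.isDiffFn_varDeriv hU i).jointSmooth hu.1 hv hV).comp_clm
        ((ContinuousLinearMap.fst ℝ ℝ ℝ).comp (ContinuousLinearMap.snd ℝ ℝ (ℝ × ℝ))) m2
    · refine jointSmooth_apply hP hVo (w := fun y => u + y.1 • v)
        (q := fun y => varDeriv G (u + y.2.2 • v)) (fun i => ?_) (fun i => ?_)
        (fun y hy => hV _ (m1 y hy)) (fun y hy => hG.smoothPer_varDeriv hU (hV _ (m3 y hy))) i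
      · exact (jointSmooth_line hu.1 hv (Metric.ball 0 r) i).comp_clm
          (ContinuousLinearMap.fst ℝ ℝ (ℝ × ℝ)) m1
      · exact ((hG.isDiffFn_varDeriv hU i).jointSmooth hu.1 hv hV).comp_clm
          ((ContinuousLinearMap.snd ℝ ℝ ℝ).comp (ContinuousLinearMap.snd ℝ ℝ (ℝ × ℝ))) m3
  have hΦ := hfs.hasFDerivAt_integral hVo (Metric.mem_ball_self hr)
  set L := ∫ x in (0 : ℝ)..1, (fderiv ℝ (fun z : (ℝ × ℝ × ℝ) × ℝ => f z.1 z.2) (0, x)).comp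
        (ContinuousLinearMap.inl ℝ (ℝ × ℝ × ℝ) ℝ)
  have hdir : ∀ e : ℝ × ℝ × ℝ,
      HasDerivAt (fun η : ℝ => ∫ x in (0 : ℝ)..1, f (η • e) x) (L e) 0 := fun e => by
    have h : HasDerivAt (fun η : ℝ => η • e) e 0 := by
      simpa using (hasDerivAt_id (0 : ℝ)).smul_const e
    have h' : HasFDerivAt (fun y => ∫ x in (0 : ℝ)..1, f y x) L ((0 : ℝ) • e) := by
      rw [zero_smul]; exact hΦ
    exact h'.comp_hasDerivAt 0 h
  have d1 := (hdir (1, 0, 0)).unique (by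
    simpa [hf, opForm] using hasDerivAt_opForm hU hP hu (hF.smoothPer_varDeriv hU hu)
      (hG.smoothPer_varDeriv hU hu) hv)
  have d2 := (hdir (0, 1, 0)).unique (by simpa [hf] using h₁)
  -- Skew-adjointness at the fixed loop `u` moves the varying gradient of `G` to the left slot,
  -- which accounts for the sign of `b₂`.
  have d3 := (hdir (0, 0, 1)).unique (h₂.neg.congr_of_eventuallyEq (by
    filter_upwards [Metric.ball_mem_nhds _ hr] with η hη
    have := hs u hu _ _ (hF.smoothPer_varDeriv hU hu) (hG.smoothPer_varDeriv hU (hV η hη))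
    simpa [hf, opForm] using this))
  have d4 := hdir (1, 1, 1)
  have e : ((1 : ℝ), (1 : ℝ), (1 : ℝ)) = (1, 0, 0) + (0, 1, 0) + (0, 0, 1) := by simp
  have eL : L (1, 1, 1) = b₁ - b₂ + P.opFormDeriv u (varDeriv F u) (varDeriv G u) v := by
    rw [e, map_add, map_add, d1, d2, d3]; ring
  rw [eL] at d4
  simpa [hf, bracket] using d4

/-- The outer bracket pairs the gradient of {F,G} with the vector field PδH, so it is a directional
derivative of {F,G}. -/
lemma bracket_bracket (hU : IsOpen U) (hP : P.SmoothOn U)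
    {F G H : Functional n} (hF : IsLocalFunctional U F) (hG : IsLocalFunctional U G)
    (hH : IsLocalFunctional U H)
    {u : ℝ → Fin n → ℝ} (hu : u ∈ loopSpace U) {d : ℝ}
    (hd : HasDerivAt (fun η : ℝ => P.bracket F G (u + η • P.apply u (varDeriv H u))) d 0) :
    P.bracket (P.bracket F G) H u = d :=
  (((isLocalFunctional_bracket hU hP hF hG).hasVarDeriv hU hu).2 _
    (smoothPer_apply hU hP hu (hH.smoothPer_varDeriv hU hu))).unique hd

/-- Each of the three second variations occurs twice, with opposite signs and exchanged arguments,
so symmetry cancels all six terms. Only the variation of the operator remains. -/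
lemma jacobi_sum_eq_schouten (hU : IsOpen U) (hP : P.SmoothOn U) (hs : P.IsSkew U)
    {F G H : Functional n} (hF : IsLocalFunctional U F) (hG : IsLocalFunctional U G)
    (hH : IsLocalFunctional U H) {u : ℝ → Fin n → ℝ} (hu : u ∈ loopSpace U) :
    P.bracket (P.bracket F G) H u + P.bracket (P.bracket G H) F u + P.bracket (P.bracket H F) G u
      = P.schouten u (varDeriv F u) (varDeriv G u) (varDeriv H u) := by
  obtain ⟨BF, sF, dF⟩ := hF.exists_hessian hU hu
  obtain ⟨BG, sG, dG⟩ := hG.exists_hessian hU hu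
  obtain ⟨BH, sH, dH⟩ := hH.exists_hessian hU hu
  have aF := smoothPer_apply hU hP hu (hF.smoothPer_varDeriv hU hu)
  have aG := smoothPer_apply hU hP hu (hG.smoothPer_varDeriv hU hu)
  have aH := smoothPer_apply hU hP hu (hH.smoothPer_varDeriv hU hu)
  rw [bracket_bracket hU hP hF hG hH hu (hasDerivAt_bracket hU hP hs hF hG hu aH
      (dF _ _ aH aG) (dG _ _ aH aF)),
    bracket_bracket hU hP hG hH hF hu (hasDerivAt_bracket hU hP hs hG hH hu aF
      (dG _ _ aF aH) (dH _ _ aF aG)),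
    bracket_bracket hU hP hH hF hG hu (hasDerivAt_bracket hU hP hs hH hF hu aG
      (dH _ _ aG aF) (dF _ _ aG aH)), schouten,
    sF (P.apply u (varDeriv H u)), sG (P.apply u (varDeriv H u)), sH (P.apply u (varDeriv F u))]
  ring

/-- The linear functional `∫ q_i u^i dx`. -/
noncomputable def linFunctional (q : ℝ → Fin n → ℝ) : Functional n := fun u =>
  ∫ x in (0 : ℝ)..1, ∑ i, q x i * u x i

lemma isLocalFunctional_linFunctional {q : ℝ → Fin n → ℝ} (hq : SmoothPer q) :
    IsLocalFunctional U (linFunctional q) :=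
  (IsDiffFn.sum (s := Finset.univ) fun i _ => (IsDiffFn.of_smoothPer (smoothPer_pi.1 hq i)).mul
    (IsDiffFn.coord 0 i)).isLocalFunctional fun u _ => by simp [linFunctional]

/-- Every smooth periodic covector field is thus a gradient, so the axioms can be tested on
arbitrary fields. -/
lemma varDeriv_linFunctional {q u : ℝ → Fin n → ℝ} (hq : SmoothPer q) (hu : SmoothPer u) :
    varDeriv (linFunctional q) u = q := by
  refine HasVarDeriv.varDeriv_eq ⟨hq, fun v hv => ?_⟩
  have hi : ∀ v : ℝ → Fin n → ℝ, SmoothPer v →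
      IntervalIntegrable (fun x => ∑ i, q x i * v x i) MeasureTheory.volume 0 1 := fun v hv =>
    (SmoothPer.sum (V := ℝ) fun i _ => (smoothPer_pi.1 hq i).mul
      (smoothPer_pi.1 hv i)).continuous.intervalIntegrable _ _
  have e : (fun η : ℝ => linFunctional q (u + η • v)) = fun η =>
      linFunctional q u + η * linFunctional q v := by
    funext η
    simp only [linFunctional]
    rw [← intervalIntegral.integral_const_mul,
      ← intervalIntegral.integral_add (hi u hu) ((hi v hv).const_mul η)]
    refine intervalIntegral.integral_congr fun x _ => ?_
    simp only [Finset.mul_sum, ← Finset.sum_add_distrib, Pi.add_apply, Pi.smul_apply, smul_eq_mul]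
    exact Finset.sum_congr rfl fun i _ => by ring
  rw [e]
  simpa [linFunctional] using ((hasDerivAt_id (0 : ℝ)).mul_const
    (linFunctional q v)).const_add (linFunctional q u)

lemma varDeriv_linear_comb (hU : IsOpen U) {F G : Functional n} (hF : IsLocalFunctional U F)
    (hG : IsLocalFunctional U G) (s t : ℝ) {u : ℝ → Fin n → ℝ} (hu : u ∈ loopSpace U) :
    varDeriv (s • F + t • G) u = fun x => s • varDeriv F u x + t • varDeriv G u x := by
  have hF' := hF.hasVarDeriv hU hu
  have hG' := hG.hasVarDeriv hU hu
  refine HasVarDeriv.varDeriv_eq ⟨((SmoothPer.const s).smul hF'.1).add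
    ((SmoothPer.const t).smul hG'.1), fun v hv => ?_⟩
  have hi : ∀ q : ℝ → Fin n → ℝ, SmoothPer q →
      IntervalIntegrable (fun x => ∑ i, q x i * v x i) MeasureTheory.volume 0 1 := fun q hq =>
    (SmoothPer.sum (V := ℝ) fun i _ => (smoothPer_pi.1 hq i).mul
      (smoothPer_pi.1 hv i)).continuous.intervalIntegrable _ _
  refine (((hF'.2 v hv).const_mul s).add ((hG'.2 v hv).const_mul t)).congr_deriv (Eq.symm ?_)
  rw [← intervalIntegral.integral_const_mul, ← intervalIntegral.integral_const_mul,
      ← intervalIntegral.integral_add ((hi _ hF'.1).const_mul s) ((hi _ hG'.1).const_mul t)]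
  refine intervalIntegral.integral_congr fun x _ => ?_
  simp only [Finset.mul_sum, ← Finset.sum_add_distrib, Pi.add_apply, Pi.smul_apply, smul_eq_mul]
  exact Finset.sum_congr rfl fun i _ => by ring

/-- The bracket is Poisson iff `P` is skew-adjoint and its Schouten bracket with itself vanishes. -/
theorem isPoissonBracket_iff (hU : IsOpen U) (hP : P.SmoothOn U) :
    IsPoissonBracket U P.bracket ↔ P.IsSkew U ∧ ∀ u ∈ loopSpace U, ∀ p q r,
      SmoothPer p → SmoothPer q → SmoothPer r → P.schouten u p q r = 0 := by
  constructor
  · intro h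
    have hs : P.IsSkew U := fun u hu p q hp hq => by
      have := h.skew _ _ (isLocalFunctional_linFunctional hp) (isLocalFunctional_linFunctional hq)
        u hu
      simpa only [bracket_eq_opForm, varDeriv_linFunctional hp hu.1,
        varDeriv_linFunctional hq hu.1] using this
    refine ⟨hs, fun u hu p q r hp hq hr => ?_⟩
    have hp' := isLocalFunctional_linFunctional (U := U) hp
    have hq' := isLocalFunctional_linFunctional (U := U) hq
    have hr' := isLocalFunctional_linFunctional (U := U) hr
    have := h.jacobi _ _ _ hp' hq' hr' u hu
    rwa [jacobi_sum_eq_schouten hU hP hs hp' hq' hr' hu, varDeriv_linFunctional hp hu.1,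
      varDeriv_linFunctional hq hu.1, varDeriv_linFunctional hr hu.1] at this
  · rintro ⟨hs, hJ⟩
    refine ⟨fun F G hF hG => isLocalFunctional_bracket hU hP hF hG, ?_, ?_, ?_⟩
    · intro F G H hF hG hH s t u hu
      simp only [bracket_eq_opForm, varDeriv_linear_comb hU hF hG s t hu, opForm]
      have hi : ∀ {F : Functional n}, IsLocalFunctional U F →
          IntervalIntegrable (fun x => ∑ i, varDeriv F u x i * P.apply u (varDeriv H u) x i)
            MeasureTheory.volume 0 1 := fun hF =>
        (SmoothPer.sum (V := ℝ) fun i _ => (smoothPer_pi.1 (hF.smoothPer_varDeriv hU hu) i).mul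
          (smoothPer_pi.1 (smoothPer_apply hU hP hu
            (hH.smoothPer_varDeriv hU hu)) i)).continuous.intervalIntegrable _ _
      rw [← intervalIntegral.integral_const_mul, ← intervalIntegral.integral_const_mul,
        ← intervalIntegral.integral_add ((hi hF).const_mul s) ((hi hG).const_mul t)]
      refine intervalIntegral.integral_congr fun x _ => ?_
      simp only [Finset.mul_sum, ← Finset.sum_add_distrib, Pi.add_apply, Pi.smul_apply,
        smul_eq_mul]
      exact Finset.sum_congr rfl fun i _ => by ring
    · intro F G hF hG u hu
      exact hs u hu _ _ (hF.smoothPer_varDeriv hU hu) (hG.smoothPer_varDeriv hU hu)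
    · intro F G H hF hG hH u hu
      rw [jacobi_sum_eq_schouten hU hP hs hF hG hH hu]
      exact hJ u hu _ _ _ (hF.smoothPer_varDeriv hU hu) (hG.smoothPer_varDeriv hU hu)
        (hH.smoothPer_varDeriv hU hu)

end Operator

end DegTwo

namespace DegTwo

open scoped ContDiff Topology
open Set

/-! ### The connection along a loop -/

lemma fderiv_eq_sum_pd {n : ℕ} (f : (Fin n → ℝ) → ℝ) (u v : Fin n → ℝ) :
    fderiv ℝ f u v = ∑ k, pd k f u * v k := by
  have e : v = ∑ k, v k • (Pi.single k 1 : Fin n → ℝ) := by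
    funext i
    simp [Finset.sum_apply, Pi.single_apply]
  conv_lhs => rw [e]
  simp only [map_sum, map_smul, smul_eq_mul, pd, mul_comm]

lemma contDiffOn_pd {n : ℕ} {U : Set (Fin n → ℝ)} (hU : IsOpen U) {f : (Fin n → ℝ) → ℝ}
    (hf : ContDiffOn ℝ ∞ f U) (k : Fin n) : ContDiffOn ℝ ∞ (pd k f) U :=
  (hf.fderiv_of_isOpen hU (by simp)).clm_apply contDiffOn_const

/-! ### Calculus of matrix-valued functions -/

section MatrixCalculus

open Matrix

variable {n : ℕ}

lemma hasDerivAt_mulVec {A : ℝ → Matrix (Fin n) (Fin n) ℝ} {p : ℝ → Fin n → ℝ}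
    {A' : Matrix (Fin n) (Fin n) ℝ} {p' : Fin n → ℝ} {x : ℝ}
    (hA : ∀ i j, HasDerivAt (fun t => A t i j) (A' i j) x) (hp : HasDerivAt p p' x) :
    HasDerivAt (fun t => A t *ᵥ p t) (A' *ᵥ p x + A x *ᵥ p') x := by
  refine hasDerivAt_pi.2 fun i => ?_
  simp only [mulVec, dotProduct, Pi.add_apply, ← Finset.sum_add_distrib]
  exact HasDerivAt.fun_sum fun j _ => (hA i j).mul (hasDerivAt_pi.1 hp j)

lemma hasDerivAt_dotProduct {p q : ℝ → Fin n → ℝ} {p' q' : Fin n → ℝ} {x : ℝ}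
    (hp : HasDerivAt p p' x) (hq : HasDerivAt q q' x) :
    HasDerivAt (fun t => p t ⬝ᵥ q t) (p' ⬝ᵥ q x + p x ⬝ᵥ q') x := by
  simp only [dotProduct, ← Finset.sum_add_distrib]
  exact HasDerivAt.fun_sum fun j _ => (hasDerivAt_pi.1 hp j).mul (hasDerivAt_pi.1 hq j)

lemma SmoothPer.mulVec {A : ℝ → Matrix (Fin n) (Fin n) ℝ} {p : ℝ → Fin n → ℝ}
    (hA : ∀ i j, SmoothPer fun x => A x i j) (hp : SmoothPer p) :
    SmoothPer (fun x => A x *ᵥ p x) :=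
  smoothPer_pi.2 fun i => SmoothPer.sum (s := Finset.univ) fun j _ => (hA i j).mul (smoothPer_pi.1 hp j)

lemma SmoothPer.dotProduct {p q : ℝ → Fin n → ℝ} (hp : SmoothPer p) (hq : SmoothPer q) :
    SmoothPer (fun x => p x ⬝ᵥ q x) :=
  SmoothPer.sum (s := Finset.univ) fun j _ => (smoothPer_pi.1 hp j).mul (smoothPer_pi.1 hq j)

lemma contDiffOn_det {E : Type*} [NormedAddCommGroup E] [NormedSpace ℝ E] {U : Set E}
    {A : E → Matrix (Fin n) (Fin n) ℝ} (hA : ∀ i j, ContDiffOn ℝ ∞ (fun u => A u i j) U) :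
    ContDiffOn ℝ ∞ (fun u => (A u).det) U := by
  simp only [det_apply']
  exact ContDiffOn.sum fun σ _ => contDiffOn_const.mul (contDiffOn_prod fun i _ => hA _ _)

/-- Cramer's rule: the entries are polynomials in the entries of `A` divided by the determinant. -/
lemma contDiffOn_inv_apply {E : Type*} [NormedAddCommGroup E] [NormedSpace ℝ E] {U : Set E}
    {A : E → Matrix (Fin n) (Fin n) ℝ} (hA : ∀ i j, ContDiffOn ℝ ∞ (fun u => A u i j) U)
    (hdet : ∀ u ∈ U, (A u).det ≠ 0) (i j : Fin n) :
    ContDiffOn ℝ ∞ (fun u => (A u)⁻¹ i j) U := by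
  simp only [inv_def, Ring.inverse_eq_inv', Matrix.smul_apply, adjugate_apply, smul_eq_mul]
  refine ((contDiffOn_det hA).inv hdet).mul (contDiffOn_det fun k l => ?_)
  by_cases hk : k = j
  · subst hk; simpa only [updateRow_self] using contDiffOn_const
  · simpa only [updateRow_ne hk] using hA k l

end MatrixCalculus

namespace Operator

open Matrix

variable {n : ℕ} {U : Set (Fin n → ℝ)} (P : Operator n)

/-- The derivative of `a` at `u` in the direction `v`. -/
noncomputable def dA (u v : Fin n → ℝ) : Matrix (Fin n) (Fin n) ℝ :=
  of fun i j => fderiv ℝ (fun y => P.a y i j) u v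

/-- The matrix `b^{ij}_k v^k`. -/
noncomputable def bMat (u v : Fin n → ℝ) : Matrix (Fin n) (Fin n) ℝ :=
  of fun i j => ∑ k, P.b u i j k * v k

/-- The matrix `c^{ij}_k v^k`. -/
noncomputable def cMat (u v : Fin n → ℝ) : Matrix (Fin n) (Fin n) ℝ :=
  of fun i j => ∑ k, P.c u i j k * v k

/-- The matrix `c^{ij}_{kl} v^k w^l`. -/
noncomputable def ccMat (u v w : Fin n → ℝ) : Matrix (Fin n) (Fin n) ℝ :=
  of fun i j => ∑ k, ∑ l, P.cc u i j k l * v k * w l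

/-- The matrix `c^{ij}_{k,l} v^l w^k`. -/
noncomputable def dC (u v w : Fin n → ℝ) : Matrix (Fin n) (Fin n) ℝ :=
  of fun i j => ∑ k, fderiv ℝ (fun y => P.c y i j k) u v * w k

/-- The connection matrix `Γ^k_{jm} v^m` with row index `j` and column index `k`. -/
noncomputable def conn (u v : Fin n → ℝ) : Matrix (Fin n) (Fin n) ℝ :=
  of fun j k => ∑ m, P.christoffel k j m u * v m

/-- The matrix `Γ^k_{jm,l} v^l w^m`. -/
noncomputable def dConn (u v w : Fin n → ℝ) : Matrix (Fin n) (Fin n) ℝ :=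
  of fun j k => ∑ m, fderiv ℝ (P.christoffel k j m) u v * w m

/-- The defect in the formula for `c^{ij}_{kl}`. -/
noncomputable def defect (i j k l : Fin n) (u : Fin n → ℝ) : ℝ :=
  P.cc u i j k l - ((pd l (fun v => P.c v i j k) u + pd k (fun v => P.c v i j l) u) / 2
    - ∑ p, ∑ r, (P.a u)⁻¹ p r * ((P.c u r i k * P.c u p j l + P.c u r i l * P.c u p j k) / 2))

/-- The defect contracted with two vectors. -/
noncomputable def defMat (u v w : Fin n → ℝ) : Matrix (Fin n) (Fin n) ℝ :=
  of fun i j => ∑ k, ∑ l, P.defect i j k l u * v k * w l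

/-- The derivative of the defect in the direction `w`, contracted with two vectors. -/
noncomputable def dDef (u w v z : Fin n → ℝ) : Matrix (Fin n) (Fin n) ℝ :=
  of fun i j => ∑ k, ∑ l, fderiv ℝ (P.defect i j k l) u w * v k * z l

/-- The curvature matrix `R^k_{jlm} v^l w^m`. -/
noncomputable def curvMat (u v w : Fin n → ℝ) : Matrix (Fin n) (Fin n) ℝ :=
  P.dConn u v w - P.dConn u w v - (P.conn u v * P.conn u w - P.conn u w * P.conn u v)

/-- The covariant derivative of `a` in the direction `w`. -/
noncomputable def covA (u w : Fin n → ℝ) : Matrix (Fin n) (Fin n) ℝ :=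
  P.dA u w + (P.conn u w)ᵀ * P.a u + P.a u * P.conn u w

variable {P}

lemma covA_apply (u w : Fin n → ℝ) (i j : Fin n) :
    P.covA u w i j = ∑ k, P.covDerivA k i j u * w k := by
  simp only [covA, dA, conn, Matrix.add_apply, of_apply, mul_apply, transpose_apply,
    fderiv_eq_sum_pd, covDerivA, add_mul, Finset.sum_add_distrib, Finset.sum_mul, Finset.mul_sum]
  congr 1
  · congr 1
    rw [Finset.sum_comm]
    exact Finset.sum_congr rfl fun k _ => Finset.sum_congr rfl fun r _ => by ring
  · rw [Finset.sum_comm]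
    exact Finset.sum_congr rfl fun k _ => Finset.sum_congr rfl fun r _ => by ring

/-- `conn` acts on covectors, so its products compose in the order opposite to that on vectors; this
is why the commutator enters `curvMat` with a minus sign. -/
lemma curvMat_apply (u v w : Fin n → ℝ) (j i : Fin n) :
    P.curvMat u v w j i = ∑ k, ∑ l, P.curvature i j k l u * v k * w l := by
  have e1 : P.dConn u v w j i = ∑ k, ∑ l, pd k (P.christoffel i j l) u * v k * w l := by
    simp only [dConn, of_apply, fderiv_eq_sum_pd, Finset.sum_mul]
    rw [Finset.sum_comm]
  have e2 : P.dConn u w v j i = ∑ k, ∑ l, pd l (P.christoffel i j k) u * v k * w l := by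
    simp only [dConn, of_apply, fderiv_eq_sum_pd, Finset.sum_mul]
    exact Finset.sum_congr rfl fun k _ => Finset.sum_congr rfl fun r _ => by ring
  have e3 : (P.conn u v * P.conn u w) j i = ∑ k, ∑ l, (∑ r,
      P.christoffel i r l u * P.christoffel r j k u) * v k * w l := by
    simp only [mul_apply, conn, of_apply, Finset.sum_mul, Finset.mul_sum]
    rw [Finset.sum_comm]
    conv_rhs => rw [Finset.sum_comm]
    refine Finset.sum_congr rfl fun l _ => ?_
    rw [Finset.sum_comm]
    exact Finset.sum_congr rfl fun k _ => Finset.sum_congr rfl fun r _ => by ring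
  have e4 : (P.conn u w * P.conn u v) j i = ∑ k, ∑ l, (∑ r,
      P.christoffel i r k u * P.christoffel r j l u) * v k * w l := by
    simp only [mul_apply, conn, of_apply, Finset.sum_mul, Finset.mul_sum]
    rw [Finset.sum_comm]
    refine Finset.sum_congr rfl fun l _ => ?_
    rw [Finset.sum_comm]
    exact Finset.sum_congr rfl fun k _ => Finset.sum_congr rfl fun r _ => by ring
  simp only [curvMat, Matrix.sub_apply, e1, e2, e3, e4, ← Finset.sum_sub_distrib]
  refine Finset.sum_congr rfl fun k _ => Finset.sum_congr rfl fun l _ => ?_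
  simp only [curvature, Finset.sum_sub_distrib]
  ring

/-- The symmetrisations in `defect` disappear when both slots carry the same vector. What remains is
the form in which the defect arises from differentiating `flux`. -/
lemma defMat_self (u v : Fin n → ℝ) : P.defMat u v v =
    P.ccMat u v v - P.dC u v v + (P.cMat u v)ᵀ * (P.a u)⁻¹ᵀ * P.cMat u v := by
  ext i j
  have e1 : P.dC u v v i j = ∑ k, ∑ l, ((pd l (fun v => P.c v i j k) u
      + pd k (fun v => P.c v i j l) u) / 2) * v k * v l := by
    have h1 : P.dC u v v i j = ∑ k, ∑ l, pd l (fun v => P.c v i j k) u * v k * v l := by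
      simp only [dC, of_apply, fderiv_eq_sum_pd, Finset.sum_mul]
      exact Finset.sum_congr rfl fun k _ => Finset.sum_congr rfl fun r _ => by ring
    have h2 : P.dC u v v i j = ∑ k, ∑ l, pd k (fun v => P.c v i j l) u * v k * v l := by
      rw [h1, Finset.sum_comm]
      exact Finset.sum_congr rfl fun k _ => Finset.sum_congr rfl fun r _ => by ring
    have h3 : P.dC u v v i j = (P.dC u v v i j + P.dC u v v i j) / 2 := by ring
    rw [h3]
    nth_rewrite 1 [h1]
    rw [h2, ← Finset.sum_add_distrib, Finset.sum_div]
    refine Finset.sum_congr rfl fun k _ => ?_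
    rw [← Finset.sum_add_distrib, Finset.sum_div]
    exact Finset.sum_congr rfl fun l _ => by ring
  have e2 : ((P.cMat u v)ᵀ * (P.a u)⁻¹ᵀ * P.cMat u v) i j = ∑ k, ∑ l, (∑ p, ∑ r, (P.a u)⁻¹ p r *
      ((P.c u r i k * P.c u p j l + P.c u r i l * P.c u p j k) / 2)) * v k * v l := by
    have h0 : ((P.cMat u v)ᵀ * (P.a u)⁻¹ᵀ * P.cMat u v) i j
        = ∑ p, ∑ r, (P.a u)⁻¹ p r * (P.cMat u v r i * P.cMat u v p j) := by
      simp only [mul_apply, transpose_apply, Finset.sum_mul]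
      exact Finset.sum_congr rfl fun k _ => Finset.sum_congr rfl fun r _ => by ring
    have h1 : ∀ p r, P.cMat u v r i * P.cMat u v p j = ∑ k, ∑ l,
        ((P.c u r i k * P.c u p j l + P.c u r i l * P.c u p j k) / 2) * v k * v l := fun p r => by
      have g1 : P.cMat u v r i * P.cMat u v p j = ∑ k, ∑ l,
          (P.c u r i k * P.c u p j l) * v k * v l := by
        simp only [cMat, of_apply, Finset.sum_mul_sum]
        exact Finset.sum_congr rfl fun k _ => Finset.sum_congr rfl fun r _ => by ring
      have g2 : P.cMat u v r i * P.cMat u v p j = ∑ k, ∑ l,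
          (P.c u r i l * P.c u p j k) * v k * v l := by
        rw [g1, Finset.sum_comm]
        exact Finset.sum_congr rfl fun k _ => Finset.sum_congr rfl fun r _ => by ring
      have g3 : P.cMat u v r i * P.cMat u v p j
          = (P.cMat u v r i * P.cMat u v p j + P.cMat u v r i * P.cMat u v p j) / 2 := by ring
      rw [g3]
      nth_rewrite 1 [g1]
      rw [g2, ← Finset.sum_add_distrib, Finset.sum_div]
      refine Finset.sum_congr rfl fun k _ => ?_
      rw [← Finset.sum_add_distrib, Finset.sum_div]
      exact Finset.sum_congr rfl fun l _ => by ring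
    rw [h0]
    simp only [h1, Finset.mul_sum, Finset.sum_mul]
    have sw : ∀ f : Fin n → Fin n → Fin n → Fin n → ℝ,
        ∑ p, ∑ r, ∑ k, ∑ l, f p r k l = ∑ k, ∑ l, ∑ p, ∑ r, f p r k l := fun f => by
      have h : ∀ p, ∑ r, ∑ k, ∑ l, f p r k l = ∑ k, ∑ l, ∑ r, f p r k l := fun p => by
        rw [Finset.sum_comm]
        exact Finset.sum_congr rfl fun k _ => Finset.sum_comm
      simp only [h]
      rw [Finset.sum_comm]
      exact Finset.sum_congr rfl fun k _ => Finset.sum_comm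
    rw [sw]
    refine Finset.sum_congr rfl fun k _ => Finset.sum_congr rfl fun l _ =>
      Finset.sum_congr rfl fun p _ => Finset.sum_congr rfl fun r _ => by ring
  simp only [Matrix.add_apply, Matrix.sub_apply]
  rw [e1, e2]
  simp only [defMat, ccMat, of_apply, ← Finset.sum_sub_distrib, ← Finset.sum_add_distrib]
  exact Finset.sum_congr rfl fun k _ => Finset.sum_congr rfl fun l _ => by rw [defect]; ring

/-- The definition of the Christoffel symbols with the inverse of a cleared. It is what identifies
`flux` with aDq. -/
lemma a_mul_conn {u : Fin n → ℝ} (hdet : (P.a u).det ≠ 0) (v : Fin n → ℝ) :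
    P.a u * P.conn u v = -P.cMat u v := by
  have h : P.conn u v = -((P.a u)⁻¹ * P.cMat u v) := by
    ext j k
    simp only [conn, cMat, christoffel, of_apply, Matrix.neg_apply, mul_apply, neg_mul,
      Finset.sum_neg_distrib, Finset.sum_mul, Finset.mul_sum]
    rw [Finset.sum_comm]
    congr 1
    exact Finset.sum_congr rfl fun k _ => Finset.sum_congr rfl fun r _ => by ring
  rw [h, mul_neg, ← mul_assoc, mul_nonsing_inv _ (isUnit_iff_ne_zero.2 hdet), one_mul]

lemma apply_eq (u q : ℝ → Fin n → ℝ) (x : ℝ) :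
    P.apply u q x = P.a (u x) *ᵥ iteratedDeriv 2 q x + P.bMat (u x) (deriv u x) *ᵥ deriv q x
      + (P.ccMat (u x) (deriv u x) (deriv u x) + P.cMat (u x) (iteratedDeriv 2 u x)) *ᵥ q x := by
  funext i
  simp only [apply, mulVec, dotProduct, Pi.add_apply, ← Finset.sum_add_distrib, bMat, ccMat, cMat,
    of_apply, Matrix.add_apply]

end Operator

end DegTwo

/-! ### Vector- and matrix-valued differential functions -/

namespace DegTwo

open scoped ContDiff Topology
open Set

open Matrix

variable {n : ℕ} {U : Set (Fin n → ℝ)}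

/-- Vector-valued differential functions. -/
def IsDiffVec (U : Set (Fin n → ℝ)) (V : (ℝ → Fin n → ℝ) → ℝ → Fin n → ℝ) : Prop :=
  ∀ i, IsDiffFn U (fun u x => V u x i)

/-- Matrix-valued differential functions. -/
def IsDiffMat (U : Set (Fin n → ℝ))
    (M : (ℝ → Fin n → ℝ) → ℝ → Matrix (Fin n) (Fin n) ℝ) : Prop :=
  ∀ i j, IsDiffFn U (fun u x => M u x i j)

lemma IsDiffFn.const (c : ℝ) : IsDiffFn U (fun _ _ => c) := IsDiffFn.of_smoothPer (SmoothPer.const c)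

lemma IsDiffFn.neg {Q : (ℝ → Fin n → ℝ) → ℝ → ℝ} (hQ : IsDiffFn U Q) :
    IsDiffFn U (fun u x => -Q u x) :=
  ((IsDiffFn.const (-1)).mul hQ).congr fun _ _ _ => by ring

lemma IsDiffFn.sub {Q R : (ℝ → Fin n → ℝ) → ℝ → ℝ} (hQ : IsDiffFn U Q) (hR : IsDiffFn U R) :
    IsDiffFn U (fun u x => Q u x - R u x) :=
  (hQ.add hR.neg).congr fun _ _ _ => by ring

lemma IsDiffVec.of_smoothPer {p : ℝ → Fin n → ℝ} (hp : SmoothPer p) :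
    IsDiffVec U (fun _ => p) := fun i => IsDiffFn.of_smoothPer (smoothPer_pi.1 hp i)

lemma IsDiffVec.add {V W : (ℝ → Fin n → ℝ) → ℝ → Fin n → ℝ} (hV : IsDiffVec U V)
    (hW : IsDiffVec U W) : IsDiffVec U (fun u x => V u x + W u x) := fun i => (hV i).add (hW i)

lemma IsDiffVec.sub {V W : (ℝ → Fin n → ℝ) → ℝ → Fin n → ℝ} (hV : IsDiffVec U V)
    (hW : IsDiffVec U W) : IsDiffVec U (fun u x => V u x - W u x) := fun i => (hV i).sub (hW i)

lemma IsDiffVec.smoothPer {V : (ℝ → Fin n → ℝ) → ℝ → Fin n → ℝ} (hV : IsDiffVec U V)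
    {u : ℝ → Fin n → ℝ} (hu : u ∈ loopSpace U) : SmoothPer (V u) :=
  smoothPer_pi.2 fun i => (hV i).smoothPer hu

lemma IsDiffVec.deriv (hU : IsOpen U) {V : (ℝ → Fin n → ℝ) → ℝ → Fin n → ℝ}
    (hV : IsDiffVec U V) : IsDiffVec U (fun u x => deriv (V u) x) := fun i =>
  ((hV i).deriv hU).congr fun _ hu x => (hV.smoothPer hu).deriv_apply x i

lemma isDiffVec_loop : IsDiffVec U (fun u x => u x) := fun i =>
  (IsDiffFn.coord 0 i).congr fun u _ x => by simp

lemma isDiffVec_deriv_loop : IsDiffVec U (fun u x => deriv u x) := fun i =>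
  (IsDiffFn.coord 1 i).congr fun u _ x => by rw [iteratedDeriv_one]

lemma IsDiffMat.add {M N : (ℝ → Fin n → ℝ) → ℝ → Matrix (Fin n) (Fin n) ℝ} (hM : IsDiffMat U M)
    (hN : IsDiffMat U N) : IsDiffMat U (fun u x => M u x + N u x) :=
  fun i j => (hM i j).add (hN i j)

lemma IsDiffMat.sub {M N : (ℝ → Fin n → ℝ) → ℝ → Matrix (Fin n) (Fin n) ℝ} (hM : IsDiffMat U M)
    (hN : IsDiffMat U N) : IsDiffMat U (fun u x => M u x - N u x) :=
  fun i j => (hM i j).sub (hN i j)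

lemma IsDiffMat.transpose {M : (ℝ → Fin n → ℝ) → ℝ → Matrix (Fin n) (Fin n) ℝ}
    (hM : IsDiffMat U M) : IsDiffMat U (fun u x => (M u x)ᵀ) := fun i j => hM j i

lemma IsDiffMat.mul {M N : (ℝ → Fin n → ℝ) → ℝ → Matrix (Fin n) (Fin n) ℝ} (hM : IsDiffMat U M)
    (hN : IsDiffMat U N) : IsDiffMat U (fun u x => M u x * N u x) := fun i j => by
  simp only [mul_apply]
  exact IsDiffFn.sum fun k _ => (hM i k).mul (hN k j)

lemma IsDiffMat.mulVec {M : (ℝ → Fin n → ℝ) → ℝ → Matrix (Fin n) (Fin n) ℝ}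
    {V : (ℝ → Fin n → ℝ) → ℝ → Fin n → ℝ} (hM : IsDiffMat U M)
    (hV : IsDiffVec U V) : IsDiffVec U (fun u x => M u x *ᵥ V u x) := fun i => by
  simp only [Matrix.mulVec, dotProduct]
  exact IsDiffFn.sum fun k _ => (hM i k).mul (hV k)

lemma IsDiffVec.dotProduct {V W : (ℝ → Fin n → ℝ) → ℝ → Fin n → ℝ} (hV : IsDiffVec U V)
    (hW : IsDiffVec U W) : IsDiffFn U (fun u x => V u x ⬝ᵥ W u x) := by
  simp only [_root_.dotProduct]
  exact IsDiffFn.sum fun k _ => (hV k).mul (hW k)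

lemma IsDiffFn.fderiv_apply (hU : IsOpen U) {f : (Fin n → ℝ) → ℝ} (hf : ContDiffOn ℝ ∞ f U)
    {V : (ℝ → Fin n → ℝ) → ℝ → Fin n → ℝ} (hV : IsDiffVec U V) :
    IsDiffFn U (fun u x => fderiv ℝ f (u x) (V u x)) := by
  simp only [fderiv_eq_sum_pd]
  exact IsDiffFn.sum fun k _ => (IsDiffFn.of_contDiffOn (contDiffOn_pd hU hf k)).mul (hV k)

lemma hasDerivAt_comp_curve (hU : IsOpen U) {f : (Fin n → ℝ) → ℝ} (hf : ContDiffOn ℝ ∞ f U)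
    {u : ℝ → Fin n → ℝ} {u' : Fin n → ℝ} {t : ℝ} (ht : u t ∈ U) (hu : HasDerivAt u u' t) :
    HasDerivAt (fun s => f (u s)) (fderiv ℝ f (u t) u') t :=
  ((hf.contDiffAt (hU.mem_nhds ht)).differentiableAt (by simp)).hasFDerivAt.comp_hasDerivAt t hu

/-! ### The covariant form D a D + S of the operator -/

namespace Operator

variable {P : Operator n}

/-- The conditions on `a` and `b` that follow from skew-adjointness. -/
structure SkewCoeff (P : Operator n) (U : Set (Fin n → ℝ)) : Prop where
  a_transpose : ∀ u ∈ U, (P.a u)ᵀ = -P.a u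
  bMat_eq : ∀ u ∈ U, ∀ v, P.bMat u v = P.dA u v + P.cMat u v + (P.cMat u v)ᵀ

/-- The standing assumptions on the operator: smooth coefficients and `a` invertible. -/
structure Regular (P : Operator n) (U : Set (Fin n → ℝ)) : Prop where
  isOpen : IsOpen U
  smooth : P.SmoothOn U
  det_ne_zero : ∀ u ∈ U, (P.a u).det ≠ 0

lemma Regular.contDiffOn_inv (h : P.Regular U) (i j : Fin n) :
    ContDiffOn ℝ ∞ (fun u => (P.a u)⁻¹ i j) U :=
  contDiffOn_inv_apply h.smooth.a h.det_ne_zero i j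

lemma Regular.contDiffOn_christoffel (h : P.Regular U) (k i j : Fin n) :
    ContDiffOn ℝ ∞ (P.christoffel k i j) U :=
  (ContDiffOn.sum fun r _ => (h.contDiffOn_inv i r).mul (h.smooth.c r k j)).neg

lemma Regular.contDiffOn_defect (h : P.Regular U) (i j k l : Fin n) :
    ContDiffOn ℝ ∞ (P.defect i j k l) U :=
  (h.smooth.cc i j k l).sub ((((contDiffOn_pd h.isOpen (h.smooth.c i j k) l).add
    (contDiffOn_pd h.isOpen (h.smooth.c i j l) k)).div_const 2).sub
    (ContDiffOn.sum fun p _ => ContDiffOn.sum fun r _ => (h.contDiffOn_inv p r).mul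
      ((((h.smooth.c r i k).mul (h.smooth.c p j l)).add
        ((h.smooth.c r i l).mul (h.smooth.c p j k))).div_const 2)))

lemma Regular.isDiffMat_a (h : P.Regular U) : IsDiffMat U (fun u x => P.a (u x)) :=
  fun i j => IsDiffFn.of_contDiffOn (h.smooth.a i j)

lemma Regular.isDiffMat_dA (h : P.Regular U) {V : (ℝ → Fin n → ℝ) → ℝ → Fin n → ℝ}
    (hV : IsDiffVec U V) : IsDiffMat U (fun u x => P.dA (u x) (V u x)) :=
  fun i j => IsDiffFn.fderiv_apply h.isOpen (h.smooth.a i j) hV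

lemma Regular.isDiffMat_cMat (h : P.Regular U) {V : (ℝ → Fin n → ℝ) → ℝ → Fin n → ℝ}
    (hV : IsDiffVec U V) : IsDiffMat U (fun u x => P.cMat (u x) (V u x)) :=
  fun i j => IsDiffFn.sum (s := Finset.univ) fun k _ =>
    (IsDiffFn.of_contDiffOn (h.smooth.c i j k)).mul (hV k)

lemma Regular.isDiffMat_conn (h : P.Regular U) {V : (ℝ → Fin n → ℝ) → ℝ → Fin n → ℝ}
    (hV : IsDiffVec U V) : IsDiffMat U (fun u x => P.conn (u x) (V u x)) :=
  fun i j => IsDiffFn.sum (s := Finset.univ) fun k _ =>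
    (IsDiffFn.of_contDiffOn (h.contDiffOn_christoffel j i k)).mul (hV k)

lemma Regular.isDiffMat_dConn (h : P.Regular U) {V W : (ℝ → Fin n → ℝ) → ℝ → Fin n → ℝ}
    (hV : IsDiffVec U V) (hW : IsDiffVec U W) :
    IsDiffMat U (fun u x => P.dConn (u x) (V u x) (W u x)) :=
  fun i j => IsDiffFn.sum (s := Finset.univ) fun k _ =>
    (IsDiffFn.fderiv_apply h.isOpen (h.contDiffOn_christoffel j i k) hV).mul (hW k)

lemma Regular.isDiffMat_defMat (h : P.Regular U) {V W : (ℝ → Fin n → ℝ) → ℝ → Fin n → ℝ}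
    (hV : IsDiffVec U V) (hW : IsDiffVec U W) :
    IsDiffMat U (fun u x => P.defMat (u x) (V u x) (W u x)) :=
  fun i j => IsDiffFn.sum (s := Finset.univ) fun k _ => IsDiffFn.sum (s := Finset.univ) fun l _ =>
    ((IsDiffFn.of_contDiffOn (h.contDiffOn_defect i j k l)).mul (hV k)).mul (hW l)

lemma Regular.isDiffMat_dDef (h : P.Regular U) {T V W : (ℝ → Fin n → ℝ) → ℝ → Fin n → ℝ}
    (hT : IsDiffVec U T) (hV : IsDiffVec U V) (hW : IsDiffVec U W) :
    IsDiffMat U (fun u x => P.dDef (u x) (T u x) (V u x) (W u x)) :=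
  fun i j => IsDiffFn.sum (s := Finset.univ) fun k _ => IsDiffFn.sum (s := Finset.univ) fun l _ =>
    ((IsDiffFn.fderiv_apply h.isOpen (h.contDiffOn_defect i j k l) hT).mul (hV k)).mul (hW l)

lemma Regular.isDiffMat_curvMat (h : P.Regular U) {V W : (ℝ → Fin n → ℝ) → ℝ → Fin n → ℝ}
    (hV : IsDiffVec U V) (hW : IsDiffVec U W) :
    IsDiffMat U (fun u x => P.curvMat (u x) (V u x) (W u x)) :=
  ((h.isDiffMat_dConn hV hW).sub (h.isDiffMat_dConn hW hV)).sub
    (((h.isDiffMat_conn hV).mul (h.isDiffMat_conn hW)).sub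
      ((h.isDiffMat_conn hW).mul (h.isDiffMat_conn hV)))

lemma Regular.isDiffMat_covA (h : P.Regular U) {V : (ℝ → Fin n → ℝ) → ℝ → Fin n → ℝ}
    (hV : IsDiffVec U V) : IsDiffMat U (fun u x => P.covA (u x) (V u x)) :=
  ((h.isDiffMat_dA hV).add ((h.isDiffMat_conn hV).transpose.mul h.isDiffMat_a)).add
    (h.isDiffMat_a.mul (h.isDiffMat_conn hV))

section Curves

variable {u v w : ℝ → Fin n → ℝ} {u' v' w' : Fin n → ℝ} {t : ℝ}

lemma Regular.hasDerivAt_a (h : P.Regular U) (ht : u t ∈ U) (hu : HasDerivAt u u' t) (i j : Fin n) :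
    HasDerivAt (fun s => P.a (u s) i j) (P.dA (u t) u' i j) t :=
  hasDerivAt_comp_curve h.isOpen (h.smooth.a i j) ht hu

lemma Regular.hasDerivAt_cMat (h : P.Regular U) (ht : u t ∈ U) (hu : HasDerivAt u u' t)
    (hv : HasDerivAt v v' t) (i j : Fin n) : HasDerivAt (fun s => P.cMat (u s) (v s) i j)
      ((P.dC (u t) u' (v t) + P.cMat (u t) v') i j) t := by
  simp only [cMat, dC, of_apply, Matrix.add_apply, ← Finset.sum_add_distrib]
  exact HasDerivAt.fun_sum fun k _ => (hasDerivAt_comp_curve h.isOpen (h.smooth.c i j k) ht hu).mul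
    (hasDerivAt_pi.1 hv k)

lemma Regular.hasDerivAt_conn (h : P.Regular U) (ht : u t ∈ U) (hu : HasDerivAt u u' t)
    (hv : HasDerivAt v v' t) (i j : Fin n) : HasDerivAt (fun s => P.conn (u s) (v s) i j)
      ((P.dConn (u t) u' (v t) + P.conn (u t) v') i j) t := by
  simp only [conn, dConn, of_apply, Matrix.add_apply, ← Finset.sum_add_distrib]
  exact HasDerivAt.fun_sum fun k _ =>
    (hasDerivAt_comp_curve h.isOpen (h.contDiffOn_christoffel j i k) ht hu).mul
      (hasDerivAt_pi.1 hv k)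

lemma Regular.hasDerivAt_defMat (h : P.Regular U) (ht : u t ∈ U) (hu : HasDerivAt u u' t)
    (hv : HasDerivAt v v' t) (hw : HasDerivAt w w' t) (i j : Fin n) :
    HasDerivAt (fun s => P.defMat (u s) (v s) (w s) i j)
      ((P.dDef (u t) u' (v t) (w t) + P.defMat (u t) v' (w t) + P.defMat (u t) (v t) w') i j) t := by
  simp only [defMat, dDef, of_apply, Matrix.add_apply, ← Finset.sum_add_distrib]
  refine HasDerivAt.fun_sum fun k _ => HasDerivAt.fun_sum fun l _ => ?_
  refine (((hasDerivAt_comp_curve h.isOpen (h.contDiffOn_defect i j k l) ht hu).mul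
      (hasDerivAt_pi.1 hv k)).mul (hasDerivAt_pi.1 hw l)).congr_deriv ?_
  simp only [Pi.mul_apply]
  ring

end Curves

/-- The covariant derivative of a covector field along a loop. -/
noncomputable def covD (P : Operator n) (u p : ℝ → Fin n → ℝ) (x : ℝ) : Fin n → ℝ :=
  deriv p x - P.conn (u x) (deriv u x) *ᵥ p x

/-- The vector field `a^{ij} D q_j` along a loop. -/
noncomputable def flux (P : Operator n) (u q : ℝ → Fin n → ℝ) (x : ℝ) : Fin n → ℝ :=
  P.a (u x) *ᵥ deriv q x + P.cMat (u x) (deriv u x) *ᵥ q x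

lemma Regular.flux_eq (h : P.Regular U) {u : ℝ → Fin n → ℝ} (hu : u ∈ loopSpace U)
    (q : ℝ → Fin n → ℝ) (x : ℝ) : P.flux u q x = P.a (u x) *ᵥ P.covD u q x := by
  rw [covD, mulVec_sub, mulVec_mulVec, a_mul_conn (h.det_ne_zero _ (hu.2 x)), neg_mulVec,
    sub_neg_eq_add, flux]

lemma Regular.isDiffVec_covD (h : P.Regular U) {p : (ℝ → Fin n → ℝ) → ℝ → Fin n → ℝ}
    (hp : IsDiffVec U p) : IsDiffVec U (fun u x => P.covD u (p u) x) :=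
  (hp.deriv h.isOpen).sub ((h.isDiffMat_conn isDiffVec_deriv_loop).mulVec hp)

lemma Regular.isDiffVec_flux (h : P.Regular U) {p : (ℝ → Fin n → ℝ) → ℝ → Fin n → ℝ}
    (hp : IsDiffVec U p) : IsDiffVec U (fun u x => P.flux u (p u) x) :=
  (h.isDiffMat_a.mulVec (hp.deriv h.isOpen)).add
    ((h.isDiffMat_cMat isDiffVec_deriv_loop).mulVec hp)

lemma conn_transpose_mul_a {u : Fin n → ℝ} (hdet : (P.a u).det ≠ 0) (hA : (P.a u)ᵀ = -P.a u)
    (v : Fin n → ℝ) : (P.conn u v)ᵀ * P.a u = (P.cMat u v)ᵀ := by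
  have h := congrArg Matrix.transpose (a_mul_conn hdet v)
  rw [transpose_mul, hA, transpose_neg, mul_neg, neg_inj] at h
  exact h

lemma conn_transpose_mul_cMat {u : Fin n → ℝ} (hdet : (P.a u).det ≠ 0) (v : Fin n → ℝ) :
    (P.conn u v)ᵀ * P.cMat u v = -((P.cMat u v)ᵀ * (P.a u)⁻¹ᵀ * P.cMat u v) := by
  have h : P.conn u v = -((P.a u)⁻¹ * P.cMat u v) := by
    rw [← mul_neg, ← a_mul_conn hdet, ← mul_assoc, nonsing_inv_mul _ (isUnit_iff_ne_zero.2 hdet),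
      one_mul]
  rw [h, transpose_neg, transpose_mul, neg_mul]

/-- The operator is `D a D` plus multiplication by the defect. -/
lemma Regular.hasDerivAt_flux (h : P.Regular U) (hs : P.SkewCoeff U) {u q : ℝ → Fin n → ℝ}
    (hu : u ∈ loopSpace U) (hq : SmoothPer q) (x : ℝ) :
    HasDerivAt (P.flux u q) (P.apply u q x - (P.conn (u x) (deriv u x))ᵀ *ᵥ P.flux u q x
      - P.defMat (u x) (deriv u x) (deriv u x) *ᵥ q x) x := by
  have hus : SmoothPer u := hu.1
  have hux := hu.2 x
  have e2 : ∀ f : ℝ → Fin n → ℝ, iteratedDeriv 2 f x = deriv (deriv f) x := fun f => by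
    rw [iteratedDeriv_succ, iteratedDeriv_one]
  have d := (hasDerivAt_mulVec (h.hasDerivAt_a hux (hus.hasDerivAt x)) (hq.deriv.hasDerivAt x)).add
    (hasDerivAt_mulVec (h.hasDerivAt_cMat hux (hus.hasDerivAt x) (hus.deriv.hasDerivAt x))
      (hq.hasDerivAt x))
  refine d.congr_deriv ?_
  -- Of the three parts of b = ∂a + c + cᵀ, the first two come from differentiating the flux and the
  -- third from Γᵀa = cᵀ. Similarly Γᵀc supplies the quadratic term of the defect.
  rw [apply_eq, defMat_self, hs.bMat_eq _ hux, e2, e2, flux, mulVec_add, mulVec_mulVec,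
    mulVec_mulVec, conn_transpose_mul_a (h.det_ne_zero _ hux) (hs.a_transpose _ hux),
    conn_transpose_mul_cMat (h.det_ne_zero _ hux)]
  simp only [add_mulVec, sub_mulVec, neg_mulVec]
  abel

/-- Integration by parts with primitive p·flux q: the Γᵀ term in the derivative of the flux
completes p_x to Dp. -/
lemma Regular.opForm_eq (h : P.Regular U) (hs : P.SkewCoeff U) {u p q : ℝ → Fin n → ℝ}
    (hu : u ∈ loopSpace U) (hp : SmoothPer p) (hq : SmoothPer q) :
    P.opForm u p q = ∫ x in (0 : ℝ)..1, (-(P.covD u p x ⬝ᵥ P.a (u x) *ᵥ P.covD u q x)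
      + p x ⬝ᵥ P.defMat (u x) (deriv u x) (deriv u x) *ᵥ q x) := by
  have hp' : IsDiffVec U fun _ => p := IsDiffVec.of_smoothPer hp
  have hq' : IsDiffVec U fun _ => q := IsDiffVec.of_smoothPer hq
  have hD := (h.isDiffVec_covD hp').smoothPer hu
  have hX := (h.isDiffVec_flux hq').smoothPer hu
  have hS := ((h.isDiffMat_defMat isDiffVec_deriv_loop isDiffVec_deriv_loop).mulVec hq').smoothPer hu
  have hP := smoothPer_apply h.isOpen h.smooth hu hq
  have key := (hp.dotProduct hX).integral_eq_zero
    (f' := fun x => p x ⬝ᵥ P.apply u q x - (-(P.covD u p x ⬝ᵥ P.a (u x) *ᵥ P.covD u q x)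
      + p x ⬝ᵥ P.defMat (u x) (deriv u x) (deriv u x) *ᵥ q x)) fun x => by
    refine (hasDerivAt_dotProduct (hp.hasDerivAt x) (h.hasDerivAt_flux hs hu hq x)).congr_deriv ?_
    rw [← h.flux_eq hu]
    simp only [covD, sub_dotProduct, dotProduct_sub, dotProduct_mulVec, vecMul_transpose]
    ring
  rw [intervalIntegral.integral_sub, sub_eq_zero] at key
  · exact key
  · exact (hp.dotProduct hP).continuous.intervalIntegrable _ _
  · simp only [← h.flux_eq hu]
    exact ((hD.dotProduct hX).neg.add (hp.dotProduct hS)).continuous.intervalIntegrable _ _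

/-- The integrand of the covariant formula for `opFormDeriv`. -/
noncomputable def covIntegrand (P : Operator n) (u p q w : ℝ → Fin n → ℝ) (x : ℝ) : ℝ :=
  -(P.covD u p x ⬝ᵥ P.covA (u x) (w x) *ᵥ P.covD u q x)
    + (P.curvMat (u x) (w x) (deriv u x) *ᵥ p x) ⬝ᵥ P.flux u q x
    - (P.curvMat (u x) (w x) (deriv u x) *ᵥ q x) ⬝ᵥ P.flux u p x
    - (P.conn (u x) (w x) *ᵥ p x) ⬝ᵥ
        (P.apply u q x - P.defMat (u x) (deriv u x) (deriv u x) *ᵥ q x)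
    + (P.conn (u x) (w x) *ᵥ q x) ⬝ᵥ
        (P.apply u p x - P.defMat (u x) (deriv u x) (deriv u x) *ᵥ p x)
    + p x ⬝ᵥ (P.dDef (u x) (w x) (deriv u x) (deriv u x)
        + P.defMat (u x) (deriv w x) (deriv u x) + P.defMat (u x) (deriv u x) (deriv w x)) *ᵥ q x

lemma Regular.isDiffFn_covIntegrand (h : P.Regular U)
    {p q w : (ℝ → Fin n → ℝ) → ℝ → Fin n → ℝ} (hp : IsDiffVec U p) (hq : IsDiffVec U q)
    (hw : IsDiffVec U w) : IsDiffFn U (fun u x => P.covIntegrand u (p u) (q u) (w u) x) := by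
  have hu := isDiffVec_deriv_loop (U := U)
  have hw' := hw.deriv h.isOpen
  have hS := h.isDiffMat_defMat hu hu
  have hR := h.isDiffMat_curvMat hw hu
  have hH := h.isDiffMat_conn hw
  have hPp : IsDiffVec U fun u x => P.apply u (p u) x := isDiffFn_apply h.isOpen h.smooth hp
  have hPq : IsDiffVec U fun u x => P.apply u (q u) x := isDiffFn_apply h.isOpen h.smooth hq
  exact ((((((h.isDiffVec_covD hp).dotProduct ((h.isDiffMat_covA hw).mulVec
    (h.isDiffVec_covD hq))).neg.add ((hR.mulVec hp).dotProduct (h.isDiffVec_flux hq))).sub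
    ((hR.mulVec hq).dotProduct (h.isDiffVec_flux hp))).sub
    ((hH.mulVec hp).dotProduct (hPq.sub (hS.mulVec hq)))).add
    ((hH.mulVec hq).dotProduct (hPp.sub (hS.mulVec hp)))).add
    (hp.dotProduct ((((h.isDiffMat_dDef hw hu hu).add (h.isDiffMat_defMat hw' hu)).add
      (h.isDiffMat_defMat hu hw')).mulVec hq))

end Operator

end DegTwo

/-! ### Variation of the covariant form and of the Schouten bracket -/

namespace DegTwo

open scoped ContDiff Topology
open Set

open Matrix

variable {n : ℕ} {U : Set (Fin n → ℝ)}

lemma dotProduct_mulVec_skew {A : Matrix (Fin n) (Fin n) ℝ} (hA : Aᵀ = -A) (y z : Fin n → ℝ) :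
    y ⬝ᵥ A *ᵥ z = -(z ⬝ᵥ A *ᵥ y) := by
  rw [dotProduct_mulVec, ← mulVec_transpose, hA, neg_mulVec, neg_dotProduct, dotProduct_comm]

namespace Operator

variable {P : Operator n}

/-- The covariant formula for the derivative of `opForm` with respect to the loop. -/
lemma Regular.opFormDeriv_eq (h : P.Regular U) (hs : P.SkewCoeff U) {u p q w : ℝ → Fin n → ℝ}
    (hu : u ∈ loopSpace U) (hp : SmoothPer p) (hq : SmoothPer q) (hw : SmoothPer w) :
    P.opFormDeriv u p q w = ∫ x in (0 : ℝ)..1, P.covIntegrand u p q w x := by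
  have hus : SmoothPer u := hu.1
  have hp' : IsDiffVec U fun _ => p := IsDiffVec.of_smoothPer hp
  have hq' : IsDiffVec U fun _ => q := IsDiffVec.of_smoothPer hq
  have hw' : IsDiffVec U fun _ => w := IsDiffVec.of_smoothPer hw
  obtain ⟨r, hr, hV⟩ := exists_pos_forall_add_smul_mem h.isOpen hu hw
  -- the variation of the connection matrix
  set δG : ℝ → Matrix (Fin n) (Fin n) ℝ := fun x =>
    P.dConn (u x) (w x) (deriv u x) + P.conn (u x) (deriv w x) with hδG
  set S' : ℝ → Matrix (Fin n) (Fin n) ℝ := fun x => P.dDef (u x) (w x) (deriv u x) (deriv u x)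
        + P.defMat (u x) (deriv w x) (deriv u x) + P.defMat (u x) (deriv u x) (deriv w x) with hS'
  -- The product rule for −Dp·aDq + p·Sq, with the variation of Dp equal to −δG p.
  set I' : ℝ → ℝ := fun x => (δG x *ᵥ p x) ⬝ᵥ P.a (u x) *ᵥ P.covD u q x
    - P.covD u p x ⬝ᵥ P.dA (u x) (w x) *ᵥ P.covD u q x
    + P.covD u p x ⬝ᵥ P.a (u x) *ᵥ (δG x *ᵥ q x) + p x ⬝ᵥ S' x *ᵥ q x with hI'
  have hQ : IsDiffFn U fun u x => -(P.covD u p x ⬝ᵥ P.a (u x) *ᵥ P.covD u q x)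
      + p x ⬝ᵥ P.defMat (u x) (deriv u x) (deriv u x) *ᵥ q x :=
    ((h.isDiffVec_covD hp').dotProduct (h.isDiffMat_a.mulVec (h.isDiffVec_covD hq'))).neg.add
      (hp'.dotProduct
        ((h.isDiffMat_defMat isDiffVec_deriv_loop isDiffVec_deriv_loop).mulVec hq'))
  have hder : HasDerivAt (fun η : ℝ => P.opForm (u + η • w) p q) (∫ x in (0 : ℝ)..1, I' x) 0 := by
    refine ((hQ.jointSmooth hus hw hV).hasDerivAt_integral Metric.isOpen_ball
      (Metric.mem_ball_self hr) (f' := I') fun x => ?_).congr_of_eventuallyEq ?_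
    · have hdu : ∀ η : ℝ, deriv (u + η • w) x = deriv u x + η • deriv w x := fun η => by
        rw [deriv_add (hus.differentiable x) ((hw.differentiable x).const_smul η),
          deriv_const_smul η (hw.differentiable x)]
      have hline : ∀ a b : Fin n → ℝ, HasDerivAt (fun η : ℝ => a + η • b) b 0 := fun a b => by
        simpa using ((hasDerivAt_id (0 : ℝ)).smul_const b).const_add a
      have e0 : ∀ a b : Fin n → ℝ, a + (0 : ℝ) • b = a := fun a b => by simp
      have hux : u x + (0 : ℝ) • w x ∈ U := by rw [e0]; exact hu.2 x
      have hG := h.hasDerivAt_conn (t := 0) hux (hline (u x) (w x))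
        (hline (deriv u x) (deriv w x))
      have hA := h.hasDerivAt_a (t := 0) hux (hline (u x) (w x))
      have hS := h.hasDerivAt_defMat (t := 0) hux (hline (u x) (w x))
        (hline (deriv u x) (deriv w x)) (hline (deriv u x) (deriv w x))
      simp only [e0] at hG hA hS
      have hD : ∀ f : ℝ → Fin n → ℝ, HasDerivAt (fun η : ℝ => deriv f x
          - P.conn (u x + η • w x) (deriv u x + η • deriv w x) *ᵥ f x)
          (-(δG x *ᵥ f x)) 0 := fun f => by
        simpa using (hasDerivAt_mulVec hG (hasDerivAt_const (0 : ℝ) (f x))).const_sub (deriv f x)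
      have hfin := (hasDerivAt_dotProduct (hD p) (hasDerivAt_mulVec hA (hD q))).neg.add
        (hasDerivAt_dotProduct (hasDerivAt_const (0 : ℝ) (p x))
          (hasDerivAt_mulVec hS (hasDerivAt_const (0 : ℝ) (q x))))
      simp only [covD, Pi.add_apply, Pi.smul_apply, hdu]
      refine hfin.congr_deriv ?_
      simp only [e0, hI', hS', covD, zero_dotProduct, mulVec_zero, add_zero, zero_add,
        dotProduct_add, neg_dotProduct, mulVec_neg, dotProduct_neg]
      ring
    · filter_upwards [Metric.ball_mem_nhds _ hr] with η hη
      exact h.opForm_eq hs (hV η hη) hp hq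
  have hI : P.opFormDeriv u p q w = ∫ x in (0 : ℝ)..1, I' x := hder.deriv
  rw [hI]
  -- the difference of the integrands is a total derivative
  have hH := h.isDiffMat_conn hw'
  -- `δG` involves the x-derivative of `w`. Subtracting the derivative of this primitive leaves `w`
  -- undifferentiated outside the defect terms.
  have hK : SmoothPer fun x => (P.conn (u x) (w x) *ᵥ p x) ⬝ᵥ P.flux u q x
      - (P.conn (u x) (w x) *ᵥ q x) ⬝ᵥ P.flux u p x :=
    (((hH.mulVec hp').dotProduct (h.isDiffVec_flux hq')).sub
      ((hH.mulVec hq').dotProduct (h.isDiffVec_flux hp'))).smoothPer hu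
  have key := hK.integral_eq_zero (f' := fun x => I' x - P.covIntegrand u p q w x) fun x => by
    have hHd := h.hasDerivAt_conn (hu.2 x) (hus.hasDerivAt x) (hw.hasDerivAt x)
    refine ((hasDerivAt_dotProduct (hasDerivAt_mulVec hHd (hp.hasDerivAt x))
      (h.hasDerivAt_flux hs hu hq x)).sub (hasDerivAt_dotProduct (hasDerivAt_mulVec hHd
        (hq.hasDerivAt x)) (h.hasDerivAt_flux hs hu hp x))).congr_deriv ?_
    -- The variation of the connection matrix is the covariant x-derivative of Γ(w) plus curvature.
    have hδ : δG x = P.dConn (u x) (deriv u x) (w x) + P.conn (u x) (deriv w x)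
        + (P.conn (u x) (w x) * P.conn (u x) (deriv u x)
          - P.conn (u x) (deriv u x) * P.conn (u x) (w x))
        + P.curvMat (u x) (w x) (deriv u x) := by
      simp only [hδG, curvMat]; abel
    have hflip : ∀ y z : Fin n → ℝ, y ⬝ᵥ P.a (u x) *ᵥ z = -(z ⬝ᵥ P.a (u x) *ᵥ y) := 
      dotProduct_mulVec_skew (hs.a_transpose _ (hu.2 x))
    have hcov : ∀ y z : Fin n → ℝ, y ⬝ᵥ P.covA (u x) (w x) *ᵥ z = y ⬝ᵥ P.dA (u x) (w x) *ᵥ z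
        + (P.conn (u x) (w x) *ᵥ y) ⬝ᵥ P.a (u x) *ᵥ z
        - (P.conn (u x) (w x) *ᵥ z) ⬝ᵥ P.a (u x) *ᵥ y := fun y z => by
      simp only [covA, add_mulVec, dotProduct_add, ← mulVec_mulVec]
      rw [hflip y, dotProduct_mulVec y _ᵀ, vecMul_transpose]
      ring
    have hpd : deriv p x = P.covD u p x + P.conn (u x) (deriv u x) *ᵥ p x := by simp [covD]
    have hqd : deriv q x = P.covD u q x + P.conn (u x) (deriv u x) *ᵥ q x := by simp [covD]
    simp only [hI', covIntegrand, hcov, hpd, hqd]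
    rw [hflip (P.covD u p x) (δG x *ᵥ q x), hδ]
    simp only [← h.flux_eq hu, add_mulVec, sub_mulVec, mulVec_add, ← mulVec_mulVec,
      add_dotProduct, sub_dotProduct, dotProduct_sub, dotProduct_mulVec _ (_ᵀ), vecMul_transpose,
      hS', dotProduct_add]
    ring
  -- `I'` written out as a differential function, for the sake of its continuity.
  have hSm : IsDiffFn U fun u x => (((P.dConn (u x) (w x) (deriv u x)
      + P.conn (u x) (deriv w x)) *ᵥ p x) ⬝ᵥ P.a (u x) *ᵥ P.covD u q x
    - P.covD u p x ⬝ᵥ P.dA (u x) (w x) *ᵥ P.covD u q x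
    + P.covD u p x ⬝ᵥ P.a (u x) *ᵥ ((P.dConn (u x) (w x) (deriv u x)
      + P.conn (u x) (deriv w x)) *ᵥ q x)
    + p x ⬝ᵥ (P.dDef (u x) (w x) (deriv u x) (deriv u x)
        + P.defMat (u x) (deriv w x) (deriv u x)
        + P.defMat (u x) (deriv u x) (deriv w x)) *ᵥ q x) := by
    have hl := isDiffVec_deriv_loop (U := U)
    have hwd := hw'.deriv h.isOpen
    have hG := (h.isDiffMat_dConn hw' hl).add (h.isDiffMat_conn hwd)
    have hDp := h.isDiffVec_covD hp'
    have hDq := h.isDiffVec_covD hq'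
    exact ((((hG.mulVec hp').dotProduct (h.isDiffMat_a.mulVec hDq)).sub
      (hDp.dotProduct ((h.isDiffMat_dA hw').mulVec hDq))).add
      (hDp.dotProduct (h.isDiffMat_a.mulVec (hG.mulVec hq')))).add
      (hp'.dotProduct ((((h.isDiffMat_dDef hw' hl hl).add (h.isDiffMat_defMat hwd hl)).add
        (h.isDiffMat_defMat hl hwd)).mulVec hq'))
  rw [intervalIntegral.integral_sub, sub_eq_zero] at key
  · exact key
  · exact (hSm.smoothPer hu).continuous.intervalIntegrable _ _
  · exact ((h.isDiffFn_covIntegrand hp' hq' hw').smoothPer hu).continuous.intervalIntegrable _ _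

/-- The covariant formula for the Schouten bracket. -/
lemma Regular.schouten_eq (h : P.Regular U) (hs : P.SkewCoeff U) {u p q r : ℝ → Fin n → ℝ}
    (hu : u ∈ loopSpace U) (hp : SmoothPer p) (hq : SmoothPer q) (hr : SmoothPer r) :
    P.schouten u p q r = ∫ x in (0 : ℝ)..1, (P.covIntegrand u p q (P.apply u r) x
      + P.covIntegrand u q r (P.apply u p) x + P.covIntegrand u r p (P.apply u q) x) := by
  have ha : ∀ {p : ℝ → Fin n → ℝ}, SmoothPer p → SmoothPer (P.apply u p) := fun hp =>
    smoothPer_apply h.isOpen h.smooth hu hp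
  have hi : ∀ {p q w : ℝ → Fin n → ℝ}, SmoothPer p → SmoothPer q → SmoothPer w →
      IntervalIntegrable (P.covIntegrand u p q w) MeasureTheory.volume 0 1 := fun hp hq hw =>
    ((h.isDiffFn_covIntegrand (IsDiffVec.of_smoothPer hp) (IsDiffVec.of_smoothPer hq)
      (IsDiffVec.of_smoothPer hw)).smoothPer hu).continuous.intervalIntegrable _ _
  rw [schouten, h.opFormDeriv_eq hs hu hp hq (ha hr), h.opFormDeriv_eq hs hu hq hr (ha hp),
    h.opFormDeriv_eq hs hu hr hp (ha hq), ← intervalIntegral.integral_add (hi hp hq (ha hr))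
      (hi hq hr (ha hp)), ← intervalIntegral.integral_add ((hi hp hq (ha hr)).add
      (hi hq hr (ha hp))) (hi hr hp (ha hq))]

end Operator

end DegTwo

/-! ### The covariant derivatives of a and of its inverse -/

namespace DegTwo

open scoped ContDiff Topology
open Set

open Matrix

variable {n : ℕ} {U : Set (Fin n → ℝ)}

lemma hasDerivAt_matrix_mul {A B : ℝ → Matrix (Fin n) (Fin n) ℝ}
    {A' B' : Matrix (Fin n) (Fin n) ℝ} {x : ℝ}
    (hA : ∀ i j, HasDerivAt (fun t => A t i j) (A' i j) x)
    (hB : ∀ i j, HasDerivAt (fun t => B t i j) (B' i j) x) (i j : Fin n) :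
    HasDerivAt (fun t => (A t * B t) i j) ((A' * B x + A x * B') i j) x := by
  simp only [mul_apply, Matrix.add_apply, ← Finset.sum_add_distrib]
  exact HasDerivAt.fun_sum fun k _ => (hA i k).mul (hB k j)

lemma dotProduct_mulVec_eq_sum (M : Matrix (Fin n) (Fin n) ℝ) (α β : Fin n → ℝ) :
    α ⬝ᵥ M *ᵥ β = ∑ i, ∑ j, M i j * α i * β j := by
  simp only [dotProduct, mulVec, Finset.mul_sum]
  exact Finset.sum_congr rfl fun i _ => Finset.sum_congr rfl fun j _ => by ring

namespace Operator

variable {P : Operator n}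

lemma covA_eq {u : Fin n → ℝ} (hdet : (P.a u).det ≠ 0) (hA : (P.a u)ᵀ = -P.a u)
    (v : Fin n → ℝ) : P.covA u v = P.dA u v + (P.cMat u v)ᵀ - P.cMat u v := by
  rw [covA, conn_transpose_mul_a hdet hA, a_mul_conn hdet, ← sub_eq_add_neg]

/-- For skew a the definition of Γ gives ∇a = ∂a + cᵀ − c, so (B) amounts to b = ∂a + c + cᵀ. The
latter is what skew-adjointness yields and what the factorisation of P uses. -/
lemma Regular.skewCoeff_iff (h : P.Regular U) : P.SkewCoeff U ↔
    (∀ u ∈ U, ∀ i j, P.a u i j = -P.a u j i) ∧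
      (∀ u ∈ U, ∀ i j k, P.covDerivA k i j u = P.b u i j k - 2 * P.c u i j k) := by
  have hA : (∀ u ∈ U, (P.a u)ᵀ = -P.a u) ↔ ∀ u ∈ U, ∀ i j, P.a u i j = -P.a u j i := by
    refine forall₂_congr fun u _ => ⟨fun h i j => ?_, fun h => ?_⟩
    · simpa using congrFun (congrFun h j) i
    · ext i j
      simpa using h j i
  have hB : (∀ u ∈ U, ∀ v, P.covA u v = P.bMat u v - (2 : ℝ) • P.cMat u v) ↔
      ∀ u ∈ U, ∀ i j k, P.covDerivA k i j u = P.b u i j k - 2 * P.c u i j k := by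
    refine forall₂_congr fun u _ => ⟨fun h i j k => ?_, fun h v => ?_⟩
    · have := congrFun (congrFun (h (Pi.single k 1)) i) j
      rw [covA_apply] at this
      simpa [bMat, cMat, Pi.single_apply] using this
    · ext i j
      simp only [covA_apply, h, bMat, cMat, Matrix.sub_apply, Matrix.smul_apply, of_apply,
        Finset.mul_sum, ← Finset.sum_sub_distrib, smul_eq_mul]
      exact Finset.sum_congr rfl fun k _ => by ring
  rw [← hA, ← hB]
  constructor
  · refine fun hs => ⟨hs.a_transpose, fun u hu v => ?_⟩
    rw [covA_eq (h.det_ne_zero u hu) (hs.a_transpose u hu), hs.bMat_eq u hu]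
    module
  · refine fun ⟨h1, h2⟩ => ⟨h1, fun u hu v => ?_⟩
    have := h2 u hu v
    rw [covA_eq (h.det_ne_zero u hu) (h1 u hu)] at this
    rw [← sub_add_cancel (P.bMat u v) ((2 : ℝ) • P.cMat u v), ← this]
    module

/-- The minus sign comes from exchanging the indices of the contracted a, to match the index
placement in (C). -/
lemma dotProduct_covA_mulVec_eq_sum {u : Fin n → ℝ} (hA : (P.a u)ᵀ = -P.a u)
    (α β γ : Fin n → ℝ) : α ⬝ᵥ P.covA u (P.a u *ᵥ γ) *ᵥ β
      = -∑ i, ∑ j, ∑ k, (∑ r, P.a u k r * P.covDerivA r i j u) * α i * β j * γ k := by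
  have hA' : ∀ i j, P.a u i j = -P.a u j i := fun i j => by
    simpa using congrFun (congrFun hA j) i
  rw [dotProduct_mulVec_eq_sum]
  simp only [← Finset.sum_neg_distrib]
  refine Finset.sum_congr rfl fun i _ => Finset.sum_congr rfl fun j _ => ?_
  simp only [covA_apply, mulVec, dotProduct, Finset.sum_mul, Finset.mul_sum,
    ← Finset.sum_neg_distrib]
  rw [Finset.sum_comm]
  exact Finset.sum_congr rfl fun k _ => Finset.sum_congr rfl fun r _ => by rw [hA' r k]; ring

/-- The algebraic condition on `∇ a`, in terms of covectors. -/
lemma covA_cyclic_iff {u : Fin n → ℝ} (hA : (P.a u)ᵀ = -P.a u) :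
    (∀ i j k, ∑ r, P.a u i r * P.covDerivA r j k u = ∑ r, P.a u k r * P.covDerivA r i j u) ↔
      ∀ α β γ : Fin n → ℝ, α ⬝ᵥ P.covA u (P.a u *ᵥ γ) *ᵥ β = β ⬝ᵥ P.covA u (P.a u *ᵥ α) *ᵥ γ := by
  simp only [dotProduct_covA_mulVec_eq_sum hA, neg_inj]
  constructor
  · intro h α β γ
    rw [Finset.sum_comm]
    refine Finset.sum_congr rfl fun j _ => ?_
    rw [Finset.sum_comm]
    exact Finset.sum_congr rfl fun k _ => Finset.sum_congr rfl fun i _ => by rw [h i j k]; ring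
  · intro h i j k
    have := h (Pi.single i 1) (Pi.single j 1) (Pi.single k 1)
    simpa [Pi.single_apply, eq_comm] using this

/-- The derivative of `a⁻¹` in the direction `v`. -/
noncomputable def dInv (P : Operator n) (u v : Fin n → ℝ) : Matrix (Fin n) (Fin n) ℝ :=
  of fun i j => fderiv ℝ (fun y => (P.a y)⁻¹ i j) u v

/-- The covariant derivative of `a⁻¹` in the direction `v`. -/
noncomputable def covInv (P : Operator n) (u v : Fin n → ℝ) : Matrix (Fin n) (Fin n) ℝ :=
  P.dInv u v - P.conn u v * (P.a u)⁻¹ - (P.a u)⁻¹ * (P.conn u v)ᵀ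

/-- The derivative of `covInv` in the direction `v`. -/
noncomputable def dCovInv (P : Operator n) (u v w : Fin n → ℝ) : Matrix (Fin n) (Fin n) ℝ :=
  of fun i j => ∑ k, fderiv ℝ (fun y => P.covInv y (Pi.single k 1) i j) u v * w k

lemma conn_eq_sum (u v : Fin n → ℝ) : P.conn u v = ∑ k, v k • P.conn u (Pi.single k 1) := by
  ext i j
  simp [conn, Matrix.sum_apply, Pi.single_apply, mul_comm]

lemma covInv_apply_eq_sum (u v : Fin n → ℝ) (i j : Fin n) :
    P.covInv u v i j = ∑ k, P.covInv u (Pi.single k 1) i j * v k := by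
  have h1 : P.dInv u v = ∑ k, v k • P.dInv u (Pi.single k 1) := by
    ext i j
    simp [dInv, Matrix.sum_apply, fderiv_eq_sum_pd _ u v, pd, mul_comm]
  have h2 : P.covInv u v = ∑ k, v k • P.covInv u (Pi.single k 1) := by
    simp only [covInv, smul_sub, Finset.sum_sub_distrib]
    rw [h1, conn_eq_sum u v, transpose_sum]
    simp only [Finset.sum_mul, Finset.mul_sum, smul_mul_assoc, mul_smul_comm, transpose_smul]
  rw [h2]
  simp [Matrix.sum_apply, mul_comm]

lemma Regular.a_mul_inv (h : P.Regular U) {u : Fin n → ℝ} (hu : u ∈ U) :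
    P.a u * (P.a u)⁻¹ = 1 := mul_nonsing_inv _ (isUnit_iff_ne_zero.2 (h.det_ne_zero u hu))

lemma Regular.inv_mul_a (h : P.Regular U) {u : Fin n → ℝ} (hu : u ∈ U) :
    (P.a u)⁻¹ * P.a u = 1 := nonsing_inv_mul _ (isUnit_iff_ne_zero.2 (h.det_ne_zero u hu))

lemma hasDerivAt_line (a b : Fin n → ℝ) : HasDerivAt (fun s : ℝ => a + s • b) b 0 := by
  simpa using ((hasDerivAt_id (0 : ℝ)).smul_const b).const_add a

lemma hasDerivAt_fderiv_line (hU : IsOpen U) {f : (Fin n → ℝ) → ℝ} (hf : ContDiffOn ℝ ∞ f U)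
    {u : Fin n → ℝ} (hu : u ∈ U) (v w : Fin n → ℝ) :
    HasDerivAt (fun s : ℝ => fderiv ℝ f (u + s • v) w) (fderiv ℝ (fderiv ℝ f) u v w) 0 := by
  have hd : DifferentiableAt ℝ (fderiv ℝ f) u :=
    ((hf.fderiv_of_isOpen (m := ∞) hU (by simp)).contDiffAt (hU.mem_nhds hu)).differentiableAt
      (by simp)
  have hf' : HasFDerivAt (fderiv ℝ f) (fderiv ℝ (fderiv ℝ f) u) (u + (0 : ℝ) • v) := by
    rw [zero_smul, add_zero]
    exact hd.hasFDerivAt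
  have h1 : HasDerivAt (fun s : ℝ => fderiv ℝ f (u + s • v)) (fderiv ℝ (fderiv ℝ f) u v) 0 :=
    hf'.comp_hasDerivAt (0 : ℝ) (hasDerivAt_line u v)
  have h2 := h1.clm_apply (hasDerivAt_const (0 : ℝ) w)
  rwa [map_zero, add_zero] at h2

lemma Regular.hasDerivAt_inv_line (h : P.Regular U) {u : Fin n → ℝ} (hu : u ∈ U) (v : Fin n → ℝ)
    (i j : Fin n) : HasDerivAt (fun s : ℝ => (P.a (u + s • v))⁻¹ i j) (P.dInv u v i j) 0 := by
  have := hasDerivAt_comp_curve h.isOpen (h.contDiffOn_inv i j) (t := 0)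
    (u := fun s : ℝ => u + s • v) (by simpa using hu) (hasDerivAt_line u v)
  simpa [dInv] using this

/-- Differentiate a a⁻¹ = 1, which holds near `u` along the line because `U` is open. -/
lemma Regular.dA_eq (h : P.Regular U) {u : Fin n → ℝ} (hu : u ∈ U) (v : Fin n → ℝ) :
    P.dA u v = -(P.a u * P.dInv u v * P.a u) := by
  have key : P.dA u v * (P.a u)⁻¹ + P.a u * P.dInv u v = 0 := by
    ext i j
    have hA := h.hasDerivAt_a (t := 0) (u := fun s : ℝ => u + s • v) (by simpa using hu)
      (hasDerivAt_line u v)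
    have h1 := hasDerivAt_matrix_mul hA (h.hasDerivAt_inv_line hu v) i j
    have h2 : HasDerivAt (fun s : ℝ => (P.a (u + s • v) * (P.a (u + s • v))⁻¹) i j) 0 0 := by
      refine (hasDerivAt_const (0 : ℝ) ((1 : Matrix (Fin n) (Fin n) ℝ) i j)).congr_of_eventuallyEq ?_
      have hc : ContinuousAt (fun s : ℝ => u + s • v) 0 := by fun_prop
      filter_upwards [hc.eventually_mem (h.isOpen.mem_nhds (by simpa using hu))] with s hs
      rw [h.a_mul_inv hs]
    simpa using h1.unique h2
  have := congrArg (· * P.a u) key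
  simp only [add_mul, zero_mul] at this
  rw [mul_assoc (P.dA u v), h.inv_mul_a hu, mul_one] at this
  exact eq_neg_of_add_eq_zero_left this

lemma Regular.covA_eq_covInv (h : P.Regular U) {u : Fin n → ℝ} (hu : u ∈ U) (v : Fin n → ℝ) :
    P.covA u v = -(P.a u * P.covInv u v * P.a u) := by
  rw [covA, h.dA_eq hu, covInv]
  have e1 : P.a u * (P.conn u v * (P.a u)⁻¹) * P.a u = P.a u * P.conn u v := by
    rw [mul_assoc, mul_assoc, h.inv_mul_a hu, mul_one]
  have e2 : P.a u * ((P.a u)⁻¹ * (P.conn u v)ᵀ) * P.a u = (P.conn u v)ᵀ * P.a u := by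
    rw [← mul_assoc, h.a_mul_inv hu, one_mul]
  rw [mul_sub, mul_sub, sub_mul, sub_mul, e1, e2]
  abel

/-- Lowering indices replaces ∇a by ∇a⁻¹. Two signs cancel: one from differentiating an inverse, one
from the skewness of a. -/
lemma Regular.dotProduct_covA (h : P.Regular U) {u : Fin n → ℝ} (hu : u ∈ U)
    (hA : (P.a u)ᵀ = -P.a u) (v α β : Fin n → ℝ) :
    α ⬝ᵥ P.covA u v *ᵥ β = (P.a u *ᵥ α) ⬝ᵥ P.covInv u v *ᵥ (P.a u *ᵥ β) := by
  rw [h.covA_eq_covInv hu, neg_mulVec, dotProduct_neg, ← mulVec_mulVec, ← mulVec_mulVec,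
    dotProduct_mulVec_skew hA, neg_neg, dotProduct_comm]

lemma Regular.contDiffOn_covInv (h : P.Regular U) (v : Fin n → ℝ) (i j : Fin n) :
    ContDiffOn ℝ ∞ (fun y => P.covInv y v i j) U := by
  simp only [covInv, Matrix.sub_apply, mul_apply, dInv, conn, of_apply, transpose_apply,
    fderiv_eq_sum_pd]
  have hc : ∀ j k, ContDiffOn ℝ ∞ (fun y => ∑ m, P.christoffel k j m y * v m) U := fun j k =>
    ContDiffOn.sum fun m _ => (h.contDiffOn_christoffel k j m).mul contDiffOn_const
  exact ((ContDiffOn.sum fun k _ =>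
    (contDiffOn_pd h.isOpen (h.contDiffOn_inv i j) k).mul contDiffOn_const).sub
    (ContDiffOn.sum fun k _ => (hc i k).mul (h.contDiffOn_inv k j))).sub
    (ContDiffOn.sum fun k _ => (h.contDiffOn_inv i k).mul (hc j k))

lemma Regular.hasDerivAt_covInv (h : P.Regular U) {u v : ℝ → Fin n → ℝ} {u' v' : Fin n → ℝ} {t : ℝ}
    (ht : u t ∈ U) (hu : HasDerivAt u u' t) (hv : HasDerivAt v v' t) (i j : Fin n) :
    HasDerivAt (fun s => P.covInv (u s) (v s) i j)
      ((P.dCovInv (u t) u' (v t) + P.covInv (u t) v') i j) t := by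
  rw [Matrix.add_apply, covInv_apply_eq_sum _ v']
  simp only [covInv_apply_eq_sum _ (v _), dCovInv, of_apply, ← Finset.sum_add_distrib]
  exact HasDerivAt.fun_sum fun k _ =>
    (hasDerivAt_comp_curve h.isOpen (h.contDiffOn_covInv _ i j) ht hu).mul (hasDerivAt_pi.1 hv k)

/-- The second derivative of `a⁻¹`. -/
noncomputable def d2Inv (P : Operator n) (u v w : Fin n → ℝ) : Matrix (Fin n) (Fin n) ℝ :=
  of fun i j => fderiv ℝ (fderiv ℝ (fun y => (P.a y)⁻¹ i j)) u v w

lemma Regular.d2Inv_symm (h : P.Regular U) {u : Fin n → ℝ} (hu : u ∈ U) (v w : Fin n → ℝ) :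
    P.d2Inv u v w = P.d2Inv u w v := by
  ext i j
  exact ((h.contDiffOn_inv i j).contDiffAt (h.isOpen.mem_nhds hu)).isSymmSndFDerivAt
      (by simpa using WithTop.coe_le_coe.2 (le_top (a := (2 : ℕ∞)))) _ _

/-- This separates the second derivative of a⁻¹, symmetric in the two directions, from the
connection terms whose exchange is governed by curvature. -/
lemma Regular.dCovInv_eq (h : P.Regular U) {u : Fin n → ℝ} (hu : u ∈ U) (v w : Fin n → ℝ) :
    P.dCovInv u v w = P.d2Inv u v w - (P.dConn u v w * (P.a u)⁻¹ + P.conn u w * P.dInv u v)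
      - (P.dInv u v * (P.conn u w)ᵀ + (P.a u)⁻¹ * (P.dConn u v w)ᵀ) := by
  ext i j
  have hu0 : u + (0 : ℝ) • v ∈ U := by simpa using hu
  have e : P.covInv u 0 = 0 := by
    ext i j
    simp [covInv_apply_eq_sum u 0]
  have h1 : HasDerivAt (fun s : ℝ => P.covInv (u + s • v) w i j) (P.dCovInv u v w i j) 0 := by
    have := h.hasDerivAt_covInv (t := 0) (u := fun s : ℝ => u + s • v) hu0
      (hasDerivAt_line u v) (hasDerivAt_const (0 : ℝ) w) i j
    simpa only [zero_smul, add_zero, e] using this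
  have hC : ∀ i j, HasDerivAt (fun s : ℝ => P.conn (u + s • v) w i j) (P.dConn u v w i j) 0 :=
    fun i j => by
      have := h.hasDerivAt_conn (t := 0) (u := fun s : ℝ => u + s • v) hu0
        (hasDerivAt_line u v) (hasDerivAt_const (0 : ℝ) w) i j
      simpa [conn] using this
  have hD : HasDerivAt (fun s : ℝ => P.dInv (u + s • v) w i j) (P.d2Inv u v w i j) 0 := by
    simpa only [dInv, d2Inv, of_apply] using
      hasDerivAt_fderiv_line h.isOpen (h.contDiffOn_inv i j) hu v w
  have hE : ∀ i j, HasDerivAt (fun s : ℝ => (P.conn (u + s • v) w * (P.a (u + s • v))⁻¹) i j)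
      ((P.dConn u v w * (P.a u)⁻¹ + P.conn u w * P.dInv u v) i j) 0 := fun i j => by
    have := hasDerivAt_matrix_mul hC (h.hasDerivAt_inv_line hu v) i j
    simpa only [zero_smul, add_zero] using this
  have hF : ∀ i j, HasDerivAt (fun s : ℝ => ((P.a (u + s • v))⁻¹ * (P.conn (u + s • v) w)ᵀ) i j)
      ((P.dInv u v * (P.conn u w)ᵀ + (P.a u)⁻¹ * (P.dConn u v w)ᵀ) i j) 0 := fun i j => by
    have := hasDerivAt_matrix_mul (h.hasDerivAt_inv_line hu v)
      (B := fun s : ℝ => (P.conn (u + s • v) w)ᵀ) (B' := (P.dConn u v w)ᵀ) (fun i j => hC j i) i j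
    simpa only [zero_smul, add_zero] using this
  have h2 : HasDerivAt (fun s : ℝ => P.covInv (u + s • v) w i j) _ 0 :=
    (hD.fun_sub (hE i j)).fun_sub (hF i j)
  rw [h1.unique h2, Matrix.sub_apply, Matrix.sub_apply]

end Operator

end DegTwo

/-! ### Sufficiency: vanishing of the Schouten bracket -/

namespace DegTwo

open scoped ContDiff Topology
open Set

open Matrix

variable {n : ℕ} {U : Set (Fin n → ℝ)}

namespace Operator

variable {P : Operator n}

lemma Regular.dA_transpose (h : P.Regular U) (hs : P.SkewCoeff U) {u : Fin n → ℝ} (hu : u ∈ U)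
    (v : Fin n → ℝ) : (P.dA u v)ᵀ = -P.dA u v := by
  ext i j
  have e : (fun y => P.a y j i) =ᶠ[𝓝 u] fun y => -P.a y i j := by
    filter_upwards [h.isOpen.mem_nhds hu] with y hy
    simpa using congrFun (congrFun (hs.a_transpose y hy) i) j
  simp only [dA, transpose_apply, of_apply, Matrix.neg_apply]
  rw [e.fderiv_eq, fderiv_fun_neg, _root_.neg_apply]

lemma Regular.covA_transpose (h : P.Regular U) (hs : P.SkewCoeff U) {u : Fin n → ℝ} (hu : u ∈ U)
    (v : Fin n → ℝ) : (P.covA u v)ᵀ = -P.covA u v := by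
  rw [covA_eq (h.det_ne_zero u hu) (hs.a_transpose u hu), transpose_sub, transpose_add,
    h.dA_transpose hs hu, transpose_transpose]
  abel

lemma Regular.exists_eq_a_mulVec (h : P.Regular U) {u : Fin n → ℝ} (hu : u ∈ U)
    (X : Fin n → ℝ) : ∃ α, P.a u *ᵥ α = X :=
  ⟨(P.a u)⁻¹ *ᵥ X, by rw [mulVec_mulVec, h.a_mul_inv hu, one_mulVec]⟩

lemma Regular.covInv_skew (h : P.Regular U) (hs : P.SkewCoeff U) {u : Fin n → ℝ} (hu : u ∈ U)
    (w X Y : Fin n → ℝ) : X ⬝ᵥ P.covInv u w *ᵥ Y = -(Y ⬝ᵥ P.covInv u w *ᵥ X) := by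
  obtain ⟨α, rfl⟩ := h.exists_eq_a_mulVec hu X
  obtain ⟨β, rfl⟩ := h.exists_eq_a_mulVec hu Y
  rw [← h.dotProduct_covA hu (hs.a_transpose u hu), ← h.dotProduct_covA hu (hs.a_transpose u hu)]
  exact dotProduct_mulVec_skew (h.covA_transpose hs hu w) α β

/-- The cyclic symmetry of `∇ a`. -/
def IsCyclic (P : Operator n) (U : Set (Fin n → ℝ)) : Prop :=
  ∀ u ∈ U, ∀ α β γ : Fin n → ℝ,
    α ⬝ᵥ P.covA u (P.a u *ᵥ γ) *ᵥ β = β ⬝ᵥ P.covA u (P.a u *ᵥ α) *ᵥ γ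

/-- Every vector has the form aα, so (C) transfers to ω = a⁻¹. Together with `covInv_skew` it makes
∇ω totally antisymmetric. -/
lemma Regular.covInv_cyclic (h : P.Regular U) (hs : P.SkewCoeff U) (hc : P.IsCyclic U)
    {u : Fin n → ℝ} (hu : u ∈ U) (w X Y : Fin n → ℝ) :
    X ⬝ᵥ P.covInv u w *ᵥ Y = Y ⬝ᵥ P.covInv u X *ᵥ w := by
  obtain ⟨α, rfl⟩ := h.exists_eq_a_mulVec hu X
  obtain ⟨β, rfl⟩ := h.exists_eq_a_mulVec hu Y
  obtain ⟨γ, rfl⟩ := h.exists_eq_a_mulVec hu w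
  rw [← h.dotProduct_covA hu (hs.a_transpose u hu), ← h.dotProduct_covA hu (hs.a_transpose u hu)]
  exact hc u hu α β γ

lemma Regular.hasDerivAt_covInv_form (h : P.Regular U) {u w X Y : ℝ → Fin n → ℝ}
    {u' w' X' Y' : Fin n → ℝ} {t : ℝ} (ht : u t ∈ U) (hu : HasDerivAt u u' t)
    (hw : HasDerivAt w w' t) (hX : HasDerivAt X X' t) (hY : HasDerivAt Y Y' t) :
    HasDerivAt (fun s => X s ⬝ᵥ P.covInv (u s) (w s) *ᵥ Y s)
      (X t ⬝ᵥ P.dCovInv (u t) u' (w t) *ᵥ Y t + X t ⬝ᵥ P.covInv (u t) w' *ᵥ Y t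
        + X' ⬝ᵥ P.covInv (u t) (w t) *ᵥ Y t + X t ⬝ᵥ P.covInv (u t) (w t) *ᵥ Y') t := by
  refine (hasDerivAt_dotProduct hX (hasDerivAt_mulVec
    (h.hasDerivAt_covInv ht hu hw) hY)).congr_deriv ?_
  simp only [add_mulVec, dotProduct_add]
  ring

lemma Regular.hasDerivAt_covInv_form_line (h : P.Regular U) {u : Fin n → ℝ} (hu : u ∈ U)
    (v w X Y : Fin n → ℝ) : HasDerivAt (fun s : ℝ => X ⬝ᵥ P.covInv (u + s • v) w *ᵥ Y)
      (X ⬝ᵥ P.dCovInv u v w *ᵥ Y) 0 := by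
  have e : P.covInv u 0 = 0 := by
    ext i j
    simp [covInv_apply_eq_sum u 0]
  have := h.hasDerivAt_covInv_form (t := 0) (u := fun s : ℝ => u + s • v) (by simpa using hu)
    (hasDerivAt_line u v) (hasDerivAt_const (0 : ℝ) w) (hasDerivAt_const (0 : ℝ) X)
    (hasDerivAt_const (0 : ℝ) Y)
  simpa only [zero_smul, add_zero, e, zero_mulVec, dotProduct_zero, zero_dotProduct,
    mulVec_zero] using this

lemma Regular.eventually_line_mem (h : P.Regular U) {u : Fin n → ℝ} (hu : u ∈ U)
    (v : Fin n → ℝ) : ∀ᶠ s : ℝ in 𝓝 0, u + s • v ∈ U := by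
  have hc : ContinuousAt (fun s : ℝ => u + s • v) 0 := by fun_prop
  exact hc.eventually_mem (h.isOpen.mem_nhds (by simpa using hu))

/-- The pointwise skewness holds throughout the open set `U`, so it can be differentiated along a
line. -/
lemma Regular.dCovInv_skew (h : P.Regular U) (hs : P.SkewCoeff U) {u : Fin n → ℝ} (hu : u ∈ U)
    (v w X Y : Fin n → ℝ) : X ⬝ᵥ P.dCovInv u v w *ᵥ Y = -(Y ⬝ᵥ P.dCovInv u v w *ᵥ X) := by
  refine (h.hasDerivAt_covInv_form_line hu v w X Y).unique
    ((h.hasDerivAt_covInv_form_line hu v w Y X).neg.congr_of_eventuallyEq ?_)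
  filter_upwards [h.eventually_line_mem hu v] with s hsU
  exact h.covInv_skew hs hsU w X Y

lemma Regular.dCovInv_cyclic (h : P.Regular U) (hs : P.SkewCoeff U) (hc : P.IsCyclic U)
    {u : Fin n → ℝ} (hu : u ∈ U) (v w X Y : Fin n → ℝ) :
    X ⬝ᵥ P.dCovInv u v w *ᵥ Y = Y ⬝ᵥ P.dCovInv u v X *ᵥ w := by
  refine (h.hasDerivAt_covInv_form_line hu v w X Y).unique
    ((h.hasDerivAt_covInv_form_line hu v X Y w).congr_of_eventuallyEq ?_)
  filter_upwards [h.eventually_line_mem hu v] with s hsU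
  exact h.covInv_cyclic hs hc hsU w X Y

/-- The second covariant derivative of `a⁻¹`. -/
noncomputable def covInv₂ (P : Operator n) (u v w X Y : Fin n → ℝ) : ℝ :=
  X ⬝ᵥ P.dCovInv u v w *ᵥ Y - X ⬝ᵥ P.covInv u ((P.conn u v)ᵀ *ᵥ w) *ᵥ Y
    - ((P.conn u v)ᵀ *ᵥ X) ⬝ᵥ P.covInv u w *ᵥ Y - X ⬝ᵥ P.covInv u w *ᵥ ((P.conn u v)ᵀ *ᵥ Y)

lemma Regular.covInv₂_skew (h : P.Regular U) (hs : P.SkewCoeff U) {u : Fin n → ℝ} (hu : u ∈ U)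
    (v w X Y : Fin n → ℝ) : P.covInv₂ u v w X Y = -P.covInv₂ u v w Y X := by
  simp only [covInv₂]
  rw [h.dCovInv_skew hs hu v w X Y, h.covInv_skew hs hu _ X Y, h.covInv_skew hs hu _ _ Y,
    h.covInv_skew hs hu _ X]
  ring

lemma Regular.covInv₂_cyclic (h : P.Regular U) (hs : P.SkewCoeff U) (hc : P.IsCyclic U)
    {u : Fin n → ℝ} (hu : u ∈ U) (v w X Y : Fin n → ℝ) :
    P.covInv₂ u v w X Y = P.covInv₂ u v X Y w := by
  simp only [covInv₂]
  rw [h.dCovInv_cyclic hs hc hu v w X Y, h.covInv_cyclic hs hc hu _ X Y,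
    h.covInv_cyclic hs hc hu w _ Y, h.covInv_cyclic hs hc hu w X]
  ring

lemma conn_transpose_mulVec_comm {u : Fin n → ℝ} (ht : ∀ i j k, P.torsion k i j u = 0)
    (v w : Fin n → ℝ) : (P.conn u v)ᵀ *ᵥ w = (P.conn u w)ᵀ *ᵥ v := by
  funext i
  simp only [mulVec, dotProduct, transpose_apply, conn, of_apply, Finset.sum_mul]
  rw [Finset.sum_comm]
  refine Finset.sum_congr rfl fun k _ => Finset.sum_congr rfl fun l _ => ?_
  rw [sub_eq_zero.1 (ht k l i)]
  ring

/-- The Ricci identity. Zero curvature exchanges the two derivatives of Γ up to a commutator, which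
the quadratic terms absorb; zero torsion makes the correction in the direction slot symmetric. -/
lemma Regular.covInv₂_symm (h : P.Regular U) {u : Fin n → ℝ} (hu : u ∈ U)
    (ht : ∀ i j k, P.torsion k i j u = 0) (hR : ∀ v w, P.curvMat u v w = 0)
    (v w X Y : Fin n → ℝ) : P.covInv₂ u v w X Y = P.covInv₂ u w v X Y := by
  have hd : P.dConn u v w = P.dConn u w v + (P.conn u v * P.conn u w - P.conn u w * P.conn u v) := by
    have := hR v w
    rw [curvMat, sub_eq_zero, sub_eq_iff_eq_add] at this
    rw [this]; abel
  have key : P.dCovInv u v w - P.conn u v * P.covInv u w - P.covInv u w * (P.conn u v)ᵀ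
      = P.dCovInv u w v - P.conn u w * P.covInv u v - P.covInv u v * (P.conn u w)ᵀ := by
    rw [h.dCovInv_eq hu, h.dCovInv_eq hu, hd, h.d2Inv_symm hu v w, covInv, covInv]
    simp only [transpose_add, transpose_sub, transpose_mul]
    noncomm_ring
  have e : ∀ v w, P.covInv₂ u v w X Y = X ⬝ᵥ (P.dCovInv u v w - P.conn u v * P.covInv u w
      - P.covInv u w * (P.conn u v)ᵀ) *ᵥ Y - X ⬝ᵥ P.covInv u ((P.conn u v)ᵀ *ᵥ w) *ᵥ Y :=
    fun v w => by
      rw [covInv₂, sub_mulVec, sub_mulVec, dotProduct_sub, dotProduct_sub, ← mulVec_mulVec,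
        ← mulVec_mulVec, mulVec_transpose _ X, ← dotProduct_mulVec]
      ring
  rw [e, e, key, conn_transpose_mulVec_comm ht v w]

/-- In the flat torsion-free case `∇ ∇ a⁻¹ = 0`. -/
lemma Regular.covInv₂_eq_zero (h : P.Regular U) (hs : P.SkewCoeff U) (hc : P.IsCyclic U)
    {u : Fin n → ℝ} (hu : u ∈ U) (ht : ∀ i j k, P.torsion k i j u = 0)
    (hR : ∀ v w, P.curvMat u v w = 0) (v w X Y : Fin n → ℝ) : P.covInv₂ u v w X Y = 0 := by
  have hcyc := h.covInv₂_cyclic hs hc hu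
  have hsym := h.covInv₂_symm hu ht hR
  -- Symmetry in slots one and two alternates with cyclic shifts of the last three slots; one use of
  -- skewness then returns the original arguments with the opposite sign.
  have e : P.covInv₂ u v w X Y = -P.covInv₂ u v w X Y := by
    calc P.covInv₂ u v w X Y = P.covInv₂ u w v X Y := hsym v w X Y
      _ = P.covInv₂ u w X Y v := hcyc w v X Y
      _ = P.covInv₂ u X w Y v := hsym w X Y v
      _ = P.covInv₂ u X v w Y := ((hcyc X w Y v).trans (hcyc X Y v w))
      _ = P.covInv₂ u v X w Y := hsym X v w Y
      _ = -P.covInv₂ u v X Y w := h.covInv₂_skew hs hu v X w Y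
      _ = -P.covInv₂ u v w X Y := by rw [hcyc v w X Y]
  linarith

/-- Sufficiency of the conditions. -/
theorem Regular.schouten_eq_zero (h : P.Regular U) (hs : P.SkewCoeff U) (hc : P.IsCyclic U)
    (ht : ∀ u ∈ U, ∀ i j k, P.torsion k i j u = 0) (hR : ∀ u ∈ U, ∀ v w, P.curvMat u v w = 0)
    (hE : ∀ u ∈ U, ∀ i j k l, P.defect i j k l u = 0) {u p q r : ℝ → Fin n → ℝ}
    (hu : u ∈ loopSpace U) (hp : SmoothPer p) (hq : SmoothPer q) (hr : SmoothPer r) :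
    P.schouten u p q r = 0 := by
  have hdef : ∀ x v w, P.defMat (u x) v w = 0 := fun x v w => by
    ext i j
    simp [defMat, hE _ (hu.2 x)]
  have hdd : ∀ x v w z, P.dDef (u x) v w z = 0 := fun x v w z => by
    ext i j
    have : ∀ k l, fderiv ℝ (P.defect i j k l) (u x) = 0 := fun k l => by
      have e : P.defect i j k l =ᶠ[𝓝 (u x)] fun _ => (0 : ℝ) := by
        filter_upwards [h.isOpen.mem_nhds (hu.2 x)] with y hy
        exact hE y hy i j k l
      rw [e.fderiv_eq, fderiv_fun_const]
      rfl
    simp [dDef, this]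
  have hF : ∀ {p : ℝ → Fin n → ℝ}, SmoothPer p → SmoothPer (P.flux u p) := fun hp =>
    (h.isDiffVec_flux (IsDiffVec.of_smoothPer hp)).smoothPer hu
  -- The primitive of the Schouten density: ∇ω evaluated on the three fluxes.
  have hK : SmoothPer fun x => -(P.flux u p x ⬝ᵥ P.covInv (u x) (P.flux u r x) *ᵥ P.flux u q x) := by
    refine ((hF hp).dotProduct (SmoothPer.mulVec (fun i j => ?_) (hF hq))).neg
    simp only [covInv_apply_eq_sum _ (P.flux u r _)]
    exact SmoothPer.sum fun k _ => ((IsDiffFn.of_contDiffOn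
      (h.contDiffOn_covInv (Pi.single k 1) i j)).smoothPer hu).mul (smoothPer_pi.1 (hF hr) k)
  rw [h.schouten_eq hs hu hp hq hr]
  refine hK.integral_eq_zero fun x => ?_
  have hux := hu.2 x
  -- With zero defect, the covariant derivative of a flux is P applied to the covector field.
  have hfl : ∀ {p : ℝ → Fin n → ℝ}, SmoothPer p → HasDerivAt (P.flux u p)
      (P.apply u p x - (P.conn (u x) (deriv u x))ᵀ *ᵥ P.flux u p x) x := fun hp => by
    have := h.hasDerivAt_flux hs hu hp x
    rwa [hdef, zero_mulVec, sub_zero] at this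
  refine (h.hasDerivAt_covInv_form hux (SmoothPer.hasDerivAt hu.1 x) (hfl hr) (hfl hp)
    (hfl hq)).neg.congr_deriv ?_
  have hsub : ∀ v w, P.covInv (u x) (v - w) = P.covInv (u x) v - P.covInv (u x) w := fun v w => by
    ext i j
    rw [Matrix.sub_apply, covInv_apply_eq_sum _ (v - w), covInv_apply_eq_sum _ v,
      covInv_apply_eq_sum _ w, ← Finset.sum_sub_distrib]
    exact Finset.sum_congr rfl fun k _ => by rw [Pi.sub_apply]; ring
  have h0 := h.covInv₂_eq_zero hs hc hux (ht _ hux) (hR _ hux) (deriv u x) (P.flux u r x)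
    (P.flux u p x) (P.flux u q x)
  have hsym : ∀ p v w : Fin n → ℝ, (P.conn (u x) v *ᵥ p) ⬝ᵥ w = (P.conn (u x) w *ᵥ p) ⬝ᵥ v :=
    fun p v w => by
      rw [dotProduct_comm, dotProduct_mulVec, ← mulVec_transpose,
        conn_transpose_mulVec_comm (ht _ hux) v w, mulVec_transpose, ← dotProduct_mulVec,
        dotProduct_comm]
  have hcy := h.covInv_cyclic hs hc hux
  simp only [covIntegrand, hdef, hdd, hR _ hux, zero_mulVec, zero_dotProduct, sub_zero, add_zero,
    dotProduct_zero, h.dotProduct_covA hux (hs.a_transpose _ hux), ← h.flux_eq hu]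
  rw [covInv₂] at h0
  simp only [hsub, sub_mulVec, mulVec_sub, dotProduct_sub, sub_dotProduct]
  -- The product rule differentiates one flux at a time. Cyclicity brings the three results to the
  -- form of the ∇a terms in the Schouten density, and the connection terms cancel in pairs by zero
  -- torsion.
  have c1 := hcy (P.flux u r x) (P.apply u p x) (P.flux u q x)
  have c2 := (hcy (P.flux u r x) (P.flux u p x) (P.apply u q x)).trans
    (hcy (P.flux u p x) (P.apply u q x) (P.flux u r x))
  have s1 := hsym (p x) (P.apply u r x) (P.apply u q x)
  have s2 := hsym (q x) (P.apply u r x) (P.apply u p x)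
  have s3 := hsym (r x) (P.apply u p x) (P.apply u q x)
  linarith

end Operator

end DegTwo

namespace DegTwo

open scoped ContDiff Topology
open Set

open Matrix

variable {n : ℕ} {U : Set (Fin n → ℝ)}

/-! ### Test functions -/

/-- The function `cos 2πx`. -/
noncomputable def wave (x : ℝ) : ℝ := Real.cos (2 * Real.pi * x)

lemma smoothPer_wave : SmoothPer wave := by
  refine ⟨Real.contDiff_cos.comp (contDiff_const.mul contDiff_id), fun x => ?_⟩
  rw [wave, wave, mul_add, mul_one, Real.cos_add_two_pi]

lemma deriv_wave : deriv wave = fun x => -(2 * Real.pi) * Real.sin (2 * Real.pi * x) := by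
  funext x
  have h : HasDerivAt (fun x : ℝ => 2 * Real.pi * x) (2 * Real.pi) x := by
    simpa using (hasDerivAt_id x).const_mul (2 * Real.pi)
  rw [show wave = fun x => Real.cos (2 * Real.pi * x) from rfl, h.cos.deriv]
  ring

lemma deriv_deriv_wave : deriv (deriv wave) = fun x => -(2 * Real.pi) ^ 2 * wave x := by
  funext x
  have h : HasDerivAt (fun x : ℝ => 2 * Real.pi * x) (2 * Real.pi) x := by
    simpa using (hasDerivAt_id x).const_mul (2 * Real.pi)
  rw [deriv_wave, (h.sin.const_mul _).deriv, wave]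
  ring

lemma deriv_deriv_deriv_wave :
    deriv (deriv (deriv wave)) = fun x => -(2 * Real.pi) ^ 2 * deriv wave x := by
  funext x
  rw [deriv_deriv_wave, deriv_const_mul _ (smoothPer_wave.differentiable x)]

/-- At 1/8 both sine and cosine are nonzero, so this one point serves for the wave and all its
derivatives used below. -/
lemma deriv_wave_ne_zero : deriv wave (1 / 8) ≠ 0 := by
  rw [deriv_wave]
  have : 2 * Real.pi * (1 / 8) = Real.pi / 4 := by ring
  simp only [this, Real.sin_pi_div_four]
  have := Real.pi_pos
  exact mul_ne_zero (neg_ne_zero.2 (by positivity)) (by positivity)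

lemma wave_ne_zero : wave (1 / 8) ≠ 0 := by
  have : 2 * Real.pi * (1 / 8) = Real.pi / 4 := by ring
  rw [wave, this, Real.cos_pi_div_four]
  positivity

lemma deriv_deriv_wave_ne_zero : deriv (deriv wave) (1 / 8) ≠ 0 := by
  rw [deriv_deriv_wave]
  have := Real.pi_pos
  exact mul_ne_zero (neg_ne_zero.2 (by positivity)) wave_ne_zero

lemma deriv_deriv_deriv_wave_ne_zero : deriv (deriv (deriv wave)) (1 / 8) ≠ 0 := by
  rw [deriv_deriv_deriv_wave]
  have := Real.pi_pos
  exact mul_ne_zero (neg_ne_zero.2 (by positivity)) deriv_wave_ne_zero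

/-- The common end of the test-function arguments: an integrand that is a constant times a nonzero
square. -/
lemma SmoothPer.eq_zero_of_integral {g f : ℝ → ℝ} (hg : SmoothPer g) {c x₀ : ℝ} (hx : g x₀ ≠ 0)
    (hf : ∀ x, f x = c * (g x * g x)) (h : ∫ x in (0 : ℝ)..1, f x = 0) : c = 0 := by
  simp only [hf] at h
  rw [intervalIntegral.integral_const_mul] at h
  rcases mul_eq_zero.1 h with h | h
  · exact h
  · exact absurd (hg.eq_zero_of_integral_sq h x₀) hx

lemma SmoothPer.smul_vec {g : ℝ → ℝ} (hg : SmoothPer g) (β : Fin n → ℝ) :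
    SmoothPer (fun x => g x • β) := hg.smul (SmoothPer.const β)

lemma SmoothPer.deriv_smul_vec {g : ℝ → ℝ} (hg : SmoothPer g) (β : Fin n → ℝ) :
    _root_.deriv (fun x => g x • β) = fun x => _root_.deriv g x • β :=
  funext fun x => ((hg.hasDerivAt x).smul_const β).deriv

lemma iteratedDeriv_two_eq {V : Type*} [NormedAddCommGroup V] [NormedSpace ℝ V] (f : ℝ → V) :
    iteratedDeriv 2 f = deriv (deriv f) := by
  rw [iteratedDeriv_succ, iteratedDeriv_one]

/-! ### Constant loops and the consequences of skew-adjointness -/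

namespace Operator

variable {P : Operator n}

@[simp] lemma bMat_zero (u : Fin n → ℝ) : P.bMat u 0 = 0 := by ext; simp [bMat]
@[simp] lemma cMat_zero (u : Fin n → ℝ) : P.cMat u 0 = 0 := by ext; simp [cMat]
@[simp] lemma ccMat_zero_left (u v : Fin n → ℝ) : P.ccMat u 0 v = 0 := by ext; simp [ccMat]
@[simp] lemma dC_zero (u v : Fin n → ℝ) : P.dC u v 0 = 0 := by ext; simp [dC]
@[simp] lemma conn_zero (u : Fin n → ℝ) : P.conn u 0 = 0 := by ext; simp [conn]
@[simp] lemma dConn_zero_right (u v : Fin n → ℝ) : P.dConn u v 0 = 0 := by ext; simp [dConn]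
@[simp] lemma dConn_zero_left (u v : Fin n → ℝ) : P.dConn u 0 v = 0 := by ext; simp [dConn]
@[simp] lemma dA_zero (u : Fin n → ℝ) : P.dA u 0 = 0 := by ext; simp [dA]
@[simp] lemma covA_zero (u : Fin n → ℝ) : P.covA u 0 = 0 := by simp [covA]
@[simp] lemma curvMat_zero_right (u v : Fin n → ℝ) : P.curvMat u v 0 = 0 := by simp [curvMat]
@[simp] lemma curvMat_zero_left (u v : Fin n → ℝ) : P.curvMat u 0 v = 0 := by simp [curvMat]
@[simp] lemma defMat_zero_left (u v : Fin n → ℝ) : P.defMat u 0 v = 0 := by ext; simp [defMat]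
@[simp] lemma defMat_zero_right (u v : Fin n → ℝ) : P.defMat u v 0 = 0 := by ext; simp [defMat]
@[simp] lemma dDef_zero_mid (u v w : Fin n → ℝ) : P.dDef u v 0 w = 0 := by ext; simp [dDef]

lemma bMat_smul (u v : Fin n → ℝ) (s : ℝ) : P.bMat u (s • v) = s • P.bMat u v := by
  ext i j
  simp only [bMat, of_apply, Matrix.smul_apply, Pi.smul_apply, smul_eq_mul, Finset.mul_sum]
  exact Finset.sum_congr rfl fun k _ => by ring

lemma cMat_smul (u v : Fin n → ℝ) (s : ℝ) : P.cMat u (s • v) = s • P.cMat u v := by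
  ext i j
  simp only [cMat, of_apply, Matrix.smul_apply, Pi.smul_apply, smul_eq_mul, Finset.mul_sum]
  exact Finset.sum_congr rfl fun k _ => by ring

lemma conn_smul (u v : Fin n → ℝ) (s : ℝ) : P.conn u (s • v) = s • P.conn u v := by
  ext i j
  simp only [conn, of_apply, Matrix.smul_apply, Pi.smul_apply, smul_eq_mul, Finset.mul_sum]
  exact Finset.sum_congr rfl fun k _ => by ring

lemma dA_smul (u v : Fin n → ℝ) (s : ℝ) : P.dA u (s • v) = s • P.dA u v := by
  ext i j
  simp [dA]

lemma covA_smul (u v : Fin n → ℝ) (s : ℝ) : P.covA u (s • v) = s • P.covA u v := by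
  simp [covA, dA_smul, conn_smul, smul_add]

section Line

variable {u₀ : Fin n → ℝ} {φ : ℝ → Fin n → ℝ}

lemma const_mem_loopSpace (hu : u₀ ∈ U) : (fun _ : ℝ => u₀) ∈ loopSpace U :=
  ⟨SmoothPer.const u₀, fun _ => hu⟩

lemma deriv_const_add_smul (hφ : SmoothPer φ) (s x : ℝ) :
    deriv ((fun _ : ℝ => u₀) + s • φ) x = s • deriv φ x := by
  have : HasDerivAt ((fun _ : ℝ => u₀) + s • φ) (0 + s • deriv φ x) x :=
    (hasDerivAt_const x u₀).add ((hφ.hasDerivAt x).const_smul s)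
  rw [this.deriv, zero_add]

lemma iteratedDeriv_two_const_add_smul (hφ : SmoothPer φ) (s x : ℝ) :
    iteratedDeriv 2 ((fun _ : ℝ => u₀) + s • φ) x = s • deriv (deriv φ) x := by
  rw [iteratedDeriv_two_eq, funext (deriv_const_add_smul hφ s)]
  exact ((hφ.deriv.hasDerivAt x).const_smul s).deriv

lemma hasDerivAt_smul_zero (v : Fin n → ℝ) : HasDerivAt (fun s : ℝ => s • v) v 0 := by
  simpa using (hasDerivAt_id (0 : ℝ)).smul_const v

/-- The derivative of `P_u q` at a constant loop. -/
lemma Regular.hasDerivAt_apply_line (h : P.Regular U) (hu : u₀ ∈ U) (hφ : SmoothPer φ) (x : ℝ)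
    {q : ℝ → ℝ → Fin n → ℝ} {d₀ d₁ d₂ : Fin n → ℝ}
    (h₀ : HasDerivAt (fun s => q s x) d₀ 0) (h₁ : HasDerivAt (fun s => deriv (q s) x) d₁ 0)
    (h₂ : HasDerivAt (fun s => iteratedDeriv 2 (q s) x) d₂ 0) :
    HasDerivAt (fun s : ℝ => P.apply ((fun _ => u₀) + s • φ) (q s) x)
      (P.dA u₀ (φ x) *ᵥ iteratedDeriv 2 (q 0) x + P.a u₀ *ᵥ d₂
        + P.bMat u₀ (deriv φ x) *ᵥ deriv (q 0) x
        + P.cMat u₀ (deriv (deriv φ) x) *ᵥ q 0 x) 0 := by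
  have hu0 : u₀ + (0 : ℝ) • φ x ∈ U := by simpa using hu
  have hl := hasDerivAt_line u₀ (φ x)
  have hA := h.hasDerivAt_a (t := 0) (u := fun s : ℝ => u₀ + s • φ x) hu0 hl
  have hc := h.hasDerivAt_cMat (t := 0) (u := fun s : ℝ => u₀ + s • φ x) hu0 hl
    (hasDerivAt_smul_zero (deriv (deriv φ) x))
  have hb : ∀ i j, HasDerivAt (fun s : ℝ => P.bMat (u₀ + s • φ x) (s • deriv φ x) i j)
      (P.bMat u₀ (deriv φ x) i j) 0 := fun i j => by
    simp only [bMat, of_apply]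
    refine HasDerivAt.fun_sum fun k _ => ?_
    simpa using (hasDerivAt_comp_curve h.isOpen (h.smooth.b i j k) hu0 hl).fun_mul
      (hasDerivAt_pi.1 (hasDerivAt_smul_zero (deriv φ x)) k)
  -- This term is quadratic in u_x and contributes nothing to first order at a constant loop.
  have hcc : ∀ i j, HasDerivAt (fun s : ℝ => P.ccMat (u₀ + s • φ x) (s • deriv φ x)
      (s • deriv φ x) i j) ((0 : Matrix (Fin n) (Fin n) ℝ) i j) 0 := fun i j => by
    have : HasDerivAt (fun s : ℝ => P.ccMat (u₀ + s • φ x) (s • deriv φ x)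
        (s • deriv φ x) i j) (∑ k : Fin n, ∑ l : Fin n, (0 : ℝ)) 0 := by
      simp only [ccMat, of_apply]
      refine HasDerivAt.fun_sum fun k _ => HasDerivAt.fun_sum fun l _ => ?_
      simpa using ((hasDerivAt_comp_curve h.isOpen (h.smooth.cc i j k l) hu0 hl).fun_mul
        (hasDerivAt_pi.1 (hasDerivAt_smul_zero (deriv φ x)) k)).fun_mul
        (hasDerivAt_pi.1 (hasDerivAt_smul_zero (deriv φ x)) l)
    simpa using this
  have hall := ((hasDerivAt_mulVec hA h₂).add (hasDerivAt_mulVec hb h₁)).add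
    (hasDerivAt_mulVec (fun i j => (hcc i j).fun_add (hc i j)) h₀)
  simp only [apply_eq, deriv_const_add_smul hφ, iteratedDeriv_two_const_add_smul hφ, Pi.add_apply,
    Pi.smul_apply]
  refine hall.congr_deriv ?_
  simp
  funext i
  simp [mulVec, dotProduct]

lemma apply_const_loop (q : ℝ → Fin n → ℝ) (x : ℝ) :
    P.apply (fun _ => u₀) q x = P.a u₀ *ᵥ iteratedDeriv 2 q x := by
  rw [apply_eq, iteratedDeriv_two_eq (fun _ : ℝ => u₀)]
  simp

lemma Regular.opFormDeriv_const_loop (h : P.Regular U) (hu : u₀ ∈ U) (hφ : SmoothPer φ)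
    {p q : ℝ → Fin n → ℝ} (hp : SmoothPer p) (hq : SmoothPer q) :
    P.opFormDeriv (fun _ => u₀) p q φ = ∫ x in (0 : ℝ)..1, p x ⬝ᵥ
      (P.dA u₀ (φ x) *ᵥ iteratedDeriv 2 q x + P.bMat u₀ (deriv φ x) *ᵥ deriv q x
        + P.cMat u₀ (deriv (deriv φ) x) *ᵥ q x) := by
  have hl := const_mem_loopSpace hu
  obtain ⟨r, hr, hV⟩ := exists_pos_forall_add_smul_mem h.isOpen hl hφ
  refine ((jointSmooth_opForm h.smooth hl hp hq hφ hV).hasDerivAt_integral Metric.isOpen_ball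
    (Metric.mem_ball_self hr) fun x => ?_).deriv
  have h1 := h.hasDerivAt_apply_line hu hφ x (q := fun _ => q) (hasDerivAt_const _ _)
    (hasDerivAt_const _ _) (hasDerivAt_const _ _)
  refine (hasDerivAt_dotProduct (hasDerivAt_const (0 : ℝ) (p x)) h1).congr_deriv ?_
  simp

end Line

lemma matrix_ext_dotProduct {M N : Matrix (Fin n) (Fin n) ℝ}
    (h : ∀ α β : Fin n → ℝ, α ⬝ᵥ M *ᵥ β = α ⬝ᵥ N *ᵥ β) : M = N := by
  ext i j
  simpa using h (Pi.single i 1) (Pi.single j 1)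

/-- Skew-adjointness determines `b` and forces `a` to be skew. -/
lemma Regular.skewCoeff_of_isSkew (h : P.Regular U) (hs : P.IsSkew U) : P.SkewCoeff U := by
  have hw := smoothPer_wave
  constructor
  · intro u hu
    refine matrix_ext_dotProduct fun α β => ?_
    -- At a constant loop P is a ∂², so for multiples of the wave the symmetric part of a appears
    -- times the square of the wave.
    have hsk := hs _ (const_mem_loopSpace hu) _ _ (hw.smul_vec β) (hw.smul_vec α)
    rw [eq_neg_iff_add_eq_zero] at hsk
    simp only [opForm, apply_const_loop, iteratedDeriv_two_eq, hw.deriv_smul_vec,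
      hw.deriv.deriv_smul_vec] at hsk
    have hi : ∀ α β : Fin n → ℝ, IntervalIntegrable (fun x => ∑ i, (wave x • α) i *
        (P.a u *ᵥ (deriv (deriv wave) x • β)) i) MeasureTheory.volume 0 1 := fun α β =>
      ((hw.smul_vec α).dotProduct (SmoothPer.mulVec (fun i j => SmoothPer.const (P.a u i j))
        (hw.deriv.deriv.smul_vec β))).continuous.intervalIntegrable _ _
    rw [← intervalIntegral.integral_add (hi _ _) (hi _ _)] at hsk
    have := hw.eq_zero_of_integral wave_ne_zero
      (c := -(2 * Real.pi) ^ 2 * (α ⬝ᵥ P.a u *ᵥ β + β ⬝ᵥ P.a u *ᵥ α)) (fun x => ?_) hsk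
    · have hpi := Real.pi_pos
      rcases mul_eq_zero.1 this with h0 | h0
      · exact absurd h0 (neg_ne_zero.2 (by positivity))
      · rw [mulVec_transpose, neg_mulVec, dotProduct_neg, dotProduct_comm, ← dotProduct_mulVec]
        linarith
    · change (wave x • β) ⬝ᵥ (P.a u *ᵥ (deriv (deriv wave) x • α))
        + (wave x • α) ⬝ᵥ (P.a u *ᵥ (deriv (deriv wave) x • β)) = _
      rw [deriv_deriv_wave]
      simp only [smul_dotProduct, mulVec_smul, dotProduct_smul, smul_eq_mul]
      ring
  · intro u hu v
    refine matrix_ext_dotProduct fun α β => ?_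
    have hl := const_mem_loopSpace hu
    have hφ := hw.smul_vec v
    have hα : SmoothPer (fun _ : ℝ => α) := SmoothPer.const α
    have hβ := hw.smul_vec β
    obtain ⟨r, hr, hV⟩ := exists_pos_forall_add_smul_mem h.isOpen hl hφ
    -- Skew-adjointness holds along all nearby loops, hence can be varied at the constant one. With
    -- `α` constant and both `β` and the variation carried by the wave, only ∫ wave·wave″ and ∫
    -- (wave′)² occur, and these are opposite.
    have hder := (hasDerivAt_opForm h.isOpen h.smooth hl hα hβ hφ).unique
      ((hasDerivAt_opForm h.isOpen h.smooth hl hβ hα hφ).neg.congr_of_eventuallyEq (by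
        filter_upwards [Metric.ball_mem_nhds _ hr] with η hη
        exact hs _ (hV η hη) _ _ hα hβ))
    rw [h.opFormDeriv_const_loop hu hφ hα hβ, h.opFormDeriv_const_loop hu hφ hβ hα,
      eq_neg_iff_add_eq_zero] at hder
    set K : ℝ := α ⬝ᵥ P.dA u v *ᵥ β + α ⬝ᵥ P.cMat u v *ᵥ β + β ⬝ᵥ P.cMat u v *ᵥ α with hK
    have e1 : ∀ x, (fun _ : ℝ => α) x ⬝ᵥ (P.dA u (wave x • v) *ᵥ iteratedDeriv 2 (fun x => wave x • β) x
        + P.bMat u (deriv (fun x => wave x • v) x) *ᵥ deriv (fun x => wave x • β) x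
        + P.cMat u (deriv (deriv fun x => wave x • v) x) *ᵥ (wave x • β))
        = (α ⬝ᵥ P.dA u v *ᵥ β + α ⬝ᵥ P.cMat u v *ᵥ β) * (wave x * deriv (deriv wave) x)
          + α ⬝ᵥ P.bMat u v *ᵥ β * (deriv wave x * deriv wave x) := fun x => by
      simp only [iteratedDeriv_two_eq, hw.deriv_smul_vec, hw.deriv.deriv_smul_vec, dA_smul,
        bMat_smul, cMat_smul, smul_mulVec, mulVec_smul, dotProduct_add, dotProduct_smul,
        smul_eq_mul]
      ring
    have e2 : ∀ x, (wave x • β) ⬝ᵥ (P.dA u (wave x • v) *ᵥ iteratedDeriv 2 (fun _ : ℝ => α) x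
        + P.bMat u (deriv (fun x => wave x • v) x) *ᵥ deriv (fun _ : ℝ => α) x
        + P.cMat u (deriv (deriv fun x => wave x • v) x) *ᵥ (fun _ : ℝ => α) x)
        = (β ⬝ᵥ P.cMat u v *ᵥ α) * (wave x * deriv (deriv wave) x) := fun x => by
      simp only [iteratedDeriv_two_eq, hw.deriv_smul_vec, hw.deriv.deriv_smul_vec, dA_smul,
        bMat_smul, cMat_smul, smul_mulVec, dotProduct_add, dotProduct_smul,
        smul_eq_mul, deriv_const', smul_dotProduct, mulVec_zero, dotProduct_zero]
      ring
    simp only [e1, e2] at hder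
    have c1 := (hw.mul hw.deriv.deriv).continuous
    have c2 := (hw.deriv.mul hw.deriv).continuous
    have i1 := c1.intervalIntegrable (μ := MeasureTheory.volume) 0 1
    have i2 := c2.intervalIntegrable (μ := MeasureTheory.volume) 0 1
    rw [intervalIntegral.integral_add (i1.const_mul _) (i2.const_mul _),
      intervalIntegral.integral_const_mul, intervalIntegral.integral_const_mul,
      intervalIntegral.integral_const_mul, hw.integral_mul_deriv hw.deriv] at hder
    have hne : ∫ x in (0 : ℝ)..1, deriv wave x * deriv wave x ≠ 0 := fun h0 =>
      deriv_wave_ne_zero (hw.deriv.eq_zero_of_integral_sq h0 _)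
    have hfac : (α ⬝ᵥ P.bMat u v *ᵥ β - K) * ∫ x in (0 : ℝ)..1, deriv wave x * deriv wave x = 0 := by
      rw [hK]; linarith
    have hz := sub_eq_zero.1 ((mul_eq_zero.1 hfac).resolve_right hne)
    rw [hz, hK, add_mulVec, add_mulVec, dotProduct_add, dotProduct_add]
    congr 1
    rw [mulVec_transpose, dotProduct_comm α, ← dotProduct_mulVec]

end Operator

end DegTwo

/-! ### Necessity at constant loops: torsion and cyclicity -/

namespace DegTwo

open scoped ContDiff Topology
open Set

open Matrix

variable {n : ℕ} {U : Set (Fin n → ℝ)}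

namespace Operator

variable {P : Operator n} {u₀ : Fin n → ℝ}

lemma covIntegrand_const_loop (p q w : ℝ → Fin n → ℝ) (x : ℝ) :
    P.covIntegrand (fun _ => u₀) p q w x = -(deriv p x ⬝ᵥ P.covA u₀ (w x) *ᵥ deriv q x)
      - (P.conn u₀ (w x) *ᵥ p x) ⬝ᵥ (P.a u₀ *ᵥ deriv (deriv q) x)
      + (P.conn u₀ (w x) *ᵥ q x) ⬝ᵥ (P.a u₀ *ᵥ deriv (deriv p) x) := by
  simp [covIntegrand, covD, apply_const_loop, iteratedDeriv_two_eq]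

/-- `P` has vanishing Schouten bracket with itself. -/
def IsClosed (P : Operator n) (U : Set (Fin n → ℝ)) : Prop :=
  ∀ u ∈ loopSpace U, ∀ p q r, SmoothPer p → SmoothPer q → SmoothPer r → P.schouten u p q r = 0

/-- A constant field `α` is killed by both P and D at a constant loop. Against two multiples of the
wave only connection terms survive, giving the difference of Γ(aβ)α·aγ and Γ(aγ)α·aβ times (wave″)².
Since a is invertible, aβ and aγ are arbitrary. -/
lemma Regular.torsion_eq_zero (h : P.Regular U) (hs : P.SkewCoeff U) (hJ : P.IsClosed U)
    (hu : u₀ ∈ U) (i j k : Fin n) : P.torsion k i j u₀ = 0 := by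
  have hw := smoothPer_wave
  have key : ∀ α Y Z : Fin n → ℝ, (P.conn u₀ Y *ᵥ α) ⬝ᵥ Z = (P.conn u₀ Z *ᵥ α) ⬝ᵥ Y := by
    intro α Y Z
    obtain ⟨β, rfl⟩ := h.exists_eq_a_mulVec hu Y
    obtain ⟨γ, rfl⟩ := h.exists_eq_a_mulVec hu Z
    have hl := const_mem_loopSpace hu
    have h0 := hJ _ hl _ _ _ (SmoothPer.const α) (hw.smul_vec β) (hw.smul_vec γ)
    rw [h.schouten_eq hs hl (SmoothPer.const α) (hw.smul_vec β) (hw.smul_vec γ)] at h0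
    refine sub_eq_zero.1 (hw.deriv.deriv.eq_zero_of_integral deriv_deriv_wave_ne_zero (fun x => ?_) h0)
    simp only [covIntegrand_const_loop, apply_const_loop, iteratedDeriv_two_eq, hw.deriv_smul_vec,
      hw.deriv.deriv_smul_vec, deriv_const', mulVec_zero, mulVec_smul, covA_zero, zero_mulVec,
      conn_zero, zero_dotProduct, dotProduct_zero, conn_smul, smul_mulVec, smul_dotProduct,
      dotProduct_smul, smul_eq_mul]
    ring
  have := key (Pi.single k 1) (Pi.single j 1) (Pi.single i 1)
  rw [torsion, sub_eq_zero]
  simpa [conn, Pi.single_apply] using this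

lemma conn_form_symm (ht : ∀ i j k, P.torsion k i j u₀ = 0) (p v w : Fin n → ℝ) :
    (P.conn u₀ v *ᵥ p) ⬝ᵥ w = (P.conn u₀ w *ᵥ p) ⬝ᵥ v := by
  rw [dotProduct_comm, dotProduct_mulVec, ← mulVec_transpose,
    conn_transpose_mulVec_comm ht v w, mulVec_transpose, ← dotProduct_mulVec, dotProduct_comm]

/-- Zero torsion removes the connection terms and leaves only ∇a. With profiles wave, wave and g =
(wave′)², the product of the first two derivatives is g itself, so integration by parts reduces
everything to ∫ (g′)² and yields 2n₁ = n₂ + n₃. This relation and its cyclic shift force n₁ = n₂. -/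
lemma Regular.isCyclic (h : P.Regular U) (hs : P.SkewCoeff U) (hJ : P.IsClosed U) :
    P.IsCyclic U := by
  have hw := smoothPer_wave
  have hw1 := hw.deriv
  have hw2 := hw1.deriv
  obtain ⟨g, hg⟩ : ∃ g : ℝ → ℝ, g = fun x => deriv wave x * deriv wave x := ⟨_, rfl⟩
  have hsq : SmoothPer g := by rw [hg]; exact hw1.mul hw1
  have hsh' := hsq.deriv
  have dsq : deriv g = fun x => 2 * (deriv wave x * deriv (deriv wave) x) := funext fun x => by
    rw [hg, ((hw1.hasDerivAt x).fun_mul (hw1.hasDerivAt x)).deriv]; ring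
  have key : ∀ u ∈ U, ∀ α β γ : Fin n → ℝ, β ⬝ᵥ P.covA u (P.a u *ᵥ α) *ᵥ γ
      + γ ⬝ᵥ P.covA u (P.a u *ᵥ β) *ᵥ α = 2 * (α ⬝ᵥ P.covA u (P.a u *ᵥ γ) *ᵥ β) := by
    intro u hu α β γ
    have hl := const_mem_loopSpace hu
    have hα := hw.smul_vec α
    have hβ := hw.smul_vec β
    have hγ := hsq.smul_vec γ
    have h0 := hJ _ hl _ _ _ hα hβ hγ
    rw [h.schouten_eq hs hl hα hβ hγ] at h0
    set n₁ := α ⬝ᵥ P.covA u (P.a u *ᵥ γ) *ᵥ β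
    set n₂ := β ⬝ᵥ P.covA u (P.a u *ᵥ α) *ᵥ γ
    set n₃ := γ ⬝ᵥ P.covA u (P.a u *ᵥ β) *ᵥ α
    have e : ∀ x, P.covIntegrand (fun _ => u) (fun x => wave x • α) (fun x => wave x • β)
          (P.apply (fun _ => u) fun x => g x • γ) x
        + P.covIntegrand (fun _ => u) (fun x => wave x • β)
          (fun x => g x • γ) (P.apply (fun _ => u) fun x => wave x • α) x
        + P.covIntegrand (fun _ => u) (fun x => g x • γ)
          (fun x => wave x • α) (P.apply (fun _ => u) fun x => wave x • β) x
        = -n₁ * (g x * deriv (deriv g) x)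
          + -(n₂ + n₃) * ((deriv wave x * deriv (deriv wave) x) * deriv g x) := fun x => by
      have hsym := conn_form_symm fun i j k => h.torsion_eq_zero hs hJ hu i j k
      have s1 := hsym α (P.a u *ᵥ γ) (P.a u *ᵥ β)
      have s2 := hsym β (P.a u *ᵥ γ) (P.a u *ᵥ α)
      have s3 := hsym γ (P.a u *ᵥ α) (P.a u *ᵥ β)
      simp only [covIntegrand_const_loop, apply_const_loop, iteratedDeriv_two_eq,
        hw.deriv_smul_vec, hw1.deriv_smul_vec, hsq.deriv_smul_vec, hsh'.deriv_smul_vec,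
        mulVec_smul, conn_smul, covA_smul, smul_mulVec, smul_dotProduct, dotProduct_smul,
        smul_eq_mul, s1, s2, s3, n₁, n₂, n₃]
      rw [congrFun hg x]
      ring
    simp only [e] at h0
    have i1 := (hsq.mul hsh'.deriv).continuous.intervalIntegrable (μ := MeasureTheory.volume) 0 1
    have i2 := ((hw1.mul hw2).mul hsh').continuous.intervalIntegrable
      (μ := MeasureTheory.volume) 0 1
    rw [intervalIntegral.integral_add (i1.const_mul _) (i2.const_mul _),
      intervalIntegral.integral_const_mul, intervalIntegral.integral_const_mul,
      hsq.integral_mul_deriv hsh'] at h0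
    have e2 : ∫ x in (0 : ℝ)..1, deriv wave x * deriv (deriv wave) x * deriv g x
        = (1 / 2) * ∫ x in (0 : ℝ)..1, deriv g x * deriv g x := by
      rw [← intervalIntegral.integral_const_mul]
      refine intervalIntegral.integral_congr fun x _ => ?_
      simp only [dsq]
      ring
    rw [e2] at h0
    have hne : ∫ x in (0 : ℝ)..1, deriv g x * deriv g x ≠ 0 := fun hz => by
      have := hsh'.eq_zero_of_integral_sq hz (1 / 8)
      rw [dsq] at this
      have h1 := deriv_wave_ne_zero
      have h2 := deriv_deriv_wave_ne_zero
      simp_all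
    have hfac : (2 * n₁ - (n₂ + n₃)) * ∫ x in (0 : ℝ)..1, deriv g x * deriv g x = 0 := by linarith
    linarith [(mul_eq_zero.1 hfac).resolve_right hne]
  intro u hu α β γ
  have k1 := key u hu α β γ
  have k2 := key u hu β γ α
  linarith

end Operator

end DegTwo

/-! ### Linearisation of the Jacobi identity at a constant loop -/

namespace DegTwo

open scoped ContDiff Topology
open Set

open Matrix

variable {n : ℕ} {U : Set (Fin n → ℝ)}

lemma IsDiffFn.differentiableAt_line {Q : (ℝ → Fin n → ℝ) → ℝ → ℝ} (hQ : IsDiffFn U Q)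
    (hU : IsOpen U) {u φ : ℝ → Fin n → ℝ} (hu : u ∈ loopSpace U) (hφ : SmoothPer φ) (x : ℝ) :
    DifferentiableAt ℝ (fun s : ℝ => Q (u + s • φ) x) 0 := by
  obtain ⟨r, hr, hV⟩ := exists_pos_forall_add_smul_mem hU hu hφ
  exact ((hQ.jointSmooth hu.1 hφ hV).hasFDerivAt_fst Metric.isOpen_ball
    (Metric.mem_ball_self hr) x).differentiableAt

lemma IsDiffFn.hasDerivAt_mul_line {Q : (ℝ → Fin n → ℝ) → ℝ → ℝ} (hQ : IsDiffFn U Q)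
    (hU : IsOpen U) {u φ : ℝ → Fin n → ℝ} (hu : u ∈ loopSpace U) (hφ : SmoothPer φ) (x : ℝ) :
    HasDerivAt (fun s : ℝ => s * Q (u + s • φ) x) (Q u x) 0 := by
  simpa using (hasDerivAt_id (0 : ℝ)).fun_mul (hQ.differentiableAt_line hU hu hφ x).hasDerivAt

namespace Operator

variable {P : Operator n} {u₀ : Fin n → ℝ} {φ : ℝ → Fin n → ℝ}

lemma dConn_smul_right (u v w : Fin n → ℝ) (s : ℝ) : P.dConn u v (s • w) = s • P.dConn u v w := by
  ext i j
  simp only [dConn, of_apply, Pi.smul_apply, Matrix.smul_apply, smul_eq_mul, Finset.mul_sum]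
  exact Finset.sum_congr rfl fun k _ => by ring

lemma dConn_smul_left (u v w : Fin n → ℝ) (s : ℝ) : P.dConn u (s • v) w = s • P.dConn u v w := by
  ext i j
  simp only [dConn, of_apply, map_smul, Matrix.smul_apply, smul_eq_mul, Finset.mul_sum]
  exact Finset.sum_congr rfl fun k _ => by ring

lemma curvMat_smul_right (u v w : Fin n → ℝ) (s : ℝ) :
    P.curvMat u v (s • w) = s • P.curvMat u v w := by
  simp only [curvMat, dConn_smul_left, dConn_smul_right, conn_smul, mul_smul_comm, smul_mul_assoc,
    smul_sub]

lemma curvMat_smul_left (u v w : Fin n → ℝ) (s : ℝ) :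
    P.curvMat u (s • v) w = s • P.curvMat u v w := by
  simp only [curvMat, dConn_smul_left, dConn_smul_right, conn_smul, mul_smul_comm, smul_mul_assoc,
    smul_sub]

lemma defMat_smul_left (u v w : Fin n → ℝ) (s : ℝ) :
    P.defMat u (s • v) w = s • P.defMat u v w := by
  ext i j
  simp only [defMat, of_apply, Pi.smul_apply, Matrix.smul_apply, smul_eq_mul, Finset.mul_sum]
  exact Finset.sum_congr rfl fun k _ => Finset.sum_congr rfl fun l _ => by ring

lemma defMat_smul_right (u v w : Fin n → ℝ) (s : ℝ) :
    P.defMat u v (s • w) = s • P.defMat u v w := by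
  ext i j
  simp only [defMat, of_apply, Pi.smul_apply, Matrix.smul_apply, smul_eq_mul, Finset.mul_sum]
  exact Finset.sum_congr rfl fun k _ => Finset.sum_congr rfl fun l _ => by ring

lemma dDef_smul_mid (u w v v' : Fin n → ℝ) (s : ℝ) :
    P.dDef u w (s • v) v' = s • P.dDef u w v v' := by
  ext i j
  simp only [dDef, of_apply, Pi.smul_apply, Matrix.smul_apply, smul_eq_mul, Finset.mul_sum]
  exact Finset.sum_congr rfl fun k _ => Finset.sum_congr rfl fun l _ => by ring

@[simp] lemma dDef_zero_right (u w v : Fin n → ℝ) : P.dDef u w v 0 = 0 := by ext; simp [dDef]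

/-- Linearity in the direction `w`, made explicit so that a direction vanishing to second order can
be split off as a factor. -/
lemma dotProduct_covA_mulVec (u w y z : Fin n → ℝ) : y ⬝ᵥ P.covA u w *ᵥ z
    = w ⬝ᵥ fun k => y ⬝ᵥ P.covA u (Pi.single k 1) *ᵥ z := by
  have hw : P.covA u w = ∑ k, w k • P.covA u (Pi.single k 1) := by
    ext i j
    simp [Matrix.sum_apply, covA_apply, Pi.single_apply, mul_comm]
  rw [hw, sum_mulVec, dotProduct_sum, dotProduct]
  exact Finset.sum_congr rfl fun k _ => by rw [smul_mulVec, dotProduct_smul, smul_eq_mul]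

/-- The covector field along loops near the constant loop `u₀` which is parallel to first order. -/
noncomputable def parallelField (P : Operator n) (u₀ p₀ : Fin n → ℝ) (u : ℝ → Fin n → ℝ) (x : ℝ) :
    Fin n → ℝ := p₀ + P.conn u₀ (u x - u₀) *ᵥ p₀

lemma isDiffVec_parallelField (p₀ : Fin n → ℝ) : IsDiffVec U (P.parallelField u₀ p₀) := by
  have hM : IsDiffMat U fun u x => P.conn u₀ (u x - u₀) := fun i j => by
    simp only [conn, of_apply]
    exact IsDiffFn.sum fun k _ => (IsDiffFn.const _).mul
      (isDiffVec_loop.sub (IsDiffVec.of_smoothPer (SmoothPer.const u₀)) k)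
  have h0 : IsDiffVec U fun _ _ => p₀ := IsDiffVec.of_smoothPer (SmoothPer.const p₀)
  exact h0.add (hM.mulVec h0)

lemma parallelField_const (p₀ : Fin n → ℝ) :
    P.parallelField u₀ p₀ (fun _ => u₀) = fun _ => p₀ := by
  funext x
  simp [parallelField]

lemma parallelField_line (p₀ : Fin n → ℝ) (s : ℝ) :
    P.parallelField u₀ p₀ ((fun _ => u₀) + s • φ) = fun x => p₀ + s • P.conn u₀ (φ x) *ᵥ p₀ := by
  funext x
  simp [parallelField, conn_smul, smul_mulVec]

lemma hasDerivAt_conn_mulVec (hφ : SmoothPer φ) (p₀ : Fin n → ℝ) (x : ℝ) :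
    HasDerivAt (fun x => P.conn u₀ (φ x) *ᵥ p₀) (P.conn u₀ (deriv φ x) *ᵥ p₀) x := by
  have hM : ∀ i j, HasDerivAt (fun x => P.conn u₀ (φ x) i j) (P.conn u₀ (deriv φ x) i j) x :=
    fun i j => by
      simp only [conn, of_apply]
      exact HasDerivAt.fun_sum fun k _ => (hasDerivAt_pi.1 (hφ.hasDerivAt x) k).const_mul _
  simpa using hasDerivAt_mulVec hM (hasDerivAt_const x p₀)

lemma deriv_parallelField_line (hφ : SmoothPer φ) (p₀ : Fin n → ℝ) (s : ℝ) :
    deriv (P.parallelField u₀ p₀ ((fun _ => u₀) + s • φ))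
      = fun x => s • P.conn u₀ (deriv φ x) *ᵥ p₀ := by
  funext x
  rw [parallelField_line]
  exact (((hasDerivAt_conn_mulVec hφ p₀ x).const_smul s).const_add p₀).deriv

lemma deriv_deriv_parallelField_line (hφ : SmoothPer φ) (p₀ : Fin n → ℝ) (s : ℝ) :
    deriv (deriv (P.parallelField u₀ p₀ ((fun _ => u₀) + s • φ)))
      = fun x => s • P.conn u₀ (deriv (deriv φ) x) *ᵥ p₀ := by
  funext x
  rw [deriv_parallelField_line hφ]
  exact ((hasDerivAt_conn_mulVec hφ.deriv p₀ x).const_smul s).deriv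

/-- The operator annihilates `parallelField` to first order. -/
lemma Regular.hasDerivAt_apply_parallelField (h : P.Regular U) (hu : u₀ ∈ U) (hφ : SmoothPer φ)
    (p₀ : Fin n → ℝ) (x : ℝ) :
    HasDerivAt (fun s : ℝ => P.apply ((fun _ => u₀) + s • φ)
      (P.parallelField u₀ p₀ ((fun _ => u₀) + s • φ)) x) 0 0 := by
  refine (h.hasDerivAt_apply_line hu hφ x
    (q := fun s => P.parallelField u₀ p₀ ((fun _ => u₀) + s • φ)) (d₀ := P.conn u₀ (φ x) *ᵥ p₀)
    (d₁ := P.conn u₀ (deriv φ x) *ᵥ p₀) (d₂ := P.conn u₀ (deriv (deriv φ) x) *ᵥ p₀)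
    ?_ ?_ ?_).congr_deriv ?_
  · simp only [parallelField_line]
    exact (hasDerivAt_smul_zero _).const_add p₀
  · simp only [deriv_parallelField_line hφ]
    exact hasDerivAt_smul_zero _
  · simp only [iteratedDeriv_two_eq, deriv_deriv_parallelField_line hφ]
    exact hasDerivAt_smul_zero _
  · rw [iteratedDeriv_two_eq, deriv_deriv_parallelField_line hφ, deriv_parallelField_line hφ,
      parallelField_line, mulVec_mulVec, a_mul_conn (h.det_ne_zero _ hu)]
    simp [neg_mulVec]

/-- The bracket on the right vanishes at s = 0, so the covariant derivative of the field is of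
second order in s. -/
lemma covD_parallelField_line (hφ : SmoothPer φ) (p₀ : Fin n → ℝ) (s x : ℝ) :
    P.covD ((fun _ => u₀) + s • φ) (P.parallelField u₀ p₀ ((fun _ => u₀) + s • φ)) x
      = s • (P.conn u₀ (deriv φ x) *ᵥ p₀ - P.conn (((fun _ => u₀) + s • φ : ℝ → Fin n → ℝ) x)
        (deriv φ x) *ᵥ P.parallelField u₀ p₀ ((fun _ => u₀) + s • φ) x) := by
  rw [covD, deriv_parallelField_line hφ, deriv_const_add_smul hφ, conn_smul, smul_mulVec, smul_sub]

/-- The part of `covIntegrand` along a loop with `u_x = s φ_x` that is divisible by `s`, divided by `s`,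
apart from the terms which cancel in a cyclic sum. -/
noncomputable def lineIntegrand (P : Operator n) (φ u p q w : ℝ → Fin n → ℝ) (x : ℝ) : ℝ :=
  (P.curvMat (u x) (w x) (deriv φ x) *ᵥ p x) ⬝ᵥ P.flux u q x
    - (P.curvMat (u x) (w x) (deriv φ x) *ᵥ q x) ⬝ᵥ P.flux u p x
    + (P.conn (u x) (w x) *ᵥ p x) ⬝ᵥ (P.defMat (u x) (deriv φ x) (deriv u x) *ᵥ q x)
    - (P.conn (u x) (w x) *ᵥ q x) ⬝ᵥ (P.defMat (u x) (deriv φ x) (deriv u x) *ᵥ p x)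
    + p x ⬝ᵥ (P.dDef (u x) (w x) (deriv φ x) (deriv u x)
        + P.defMat (u x) (deriv w x) (deriv φ x) + P.defMat (u x) (deriv φ x) (deriv w x)) *ᵥ q x

/-- Every curvature and defect term carries a factor u_x = sφ_x. Extracting one such factor makes
the s-derivative at 0 a mere evaluation of `lineIntegrand` at the constant loop. -/
lemma covIntegrand_eq_add_mul {u : ℝ → Fin n → ℝ} {s x : ℝ} (hu : deriv u x = s • deriv φ x)
    (p q w : ℝ → Fin n → ℝ) : P.covIntegrand u p q w x
      = -(P.covD u p x ⬝ᵥ P.covA (u x) (w x) *ᵥ P.covD u q x)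
        - (P.conn (u x) (w x) *ᵥ p x) ⬝ᵥ P.apply u q x
        + (P.conn (u x) (w x) *ᵥ q x) ⬝ᵥ P.apply u p x
        + s * P.lineIntegrand φ u p q w x := by
  simp only [covIntegrand, lineIntegrand, hu, curvMat_smul_right,
    defMat_smul_left, defMat_smul_right, dDef_smul_mid, add_mulVec, smul_mulVec, smul_dotProduct,
    dotProduct_add, dotProduct_sub, dotProduct_smul, smul_eq_mul]
  ring

lemma Regular.isDiffFn_lineIntegrand (h : P.Regular U) (hφ : SmoothPer φ)
    {p q w : (ℝ → Fin n → ℝ) → ℝ → Fin n → ℝ} (hp : IsDiffVec U p) (hq : IsDiffVec U q)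
    (hw : IsDiffVec U w) : IsDiffFn U (fun u x => P.lineIntegrand φ u (p u) (q u) (w u) x) := by
  have hu := isDiffVec_deriv_loop (U := U)
  have hφ' : IsDiffVec U fun _ => deriv φ := IsDiffVec.of_smoothPer hφ.deriv
  have hw' := hw.deriv h.isOpen
  have hS := h.isDiffMat_defMat hφ' hu
  have hR := h.isDiffMat_curvMat hw hφ'
  have hH := h.isDiffMat_conn hw
  exact (((((hR.mulVec hp).dotProduct (h.isDiffVec_flux hq)).sub
    ((hR.mulVec hq).dotProduct (h.isDiffVec_flux hp))).add
    ((hH.mulVec hp).dotProduct (hS.mulVec hq))).sub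
    ((hH.mulVec hq).dotProduct (hS.mulVec hp))).add
    (hp.dotProduct ((((h.isDiffMat_dDef hw hφ' hu).add (h.isDiffMat_defMat hw' hφ')).add
      (h.isDiffMat_defMat hφ' hw')).mulVec hq))

lemma lineIntegrand_const_loop (p q w : ℝ → Fin n → ℝ) (x : ℝ) :
    P.lineIntegrand φ (fun _ => u₀) p q w x
      = (P.curvMat u₀ (w x) (deriv φ x) *ᵥ p x) ⬝ᵥ (P.a u₀ *ᵥ deriv q x)
        - (P.curvMat u₀ (w x) (deriv φ x) *ᵥ q x) ⬝ᵥ (P.a u₀ *ᵥ deriv p x)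
        + p x ⬝ᵥ (P.defMat u₀ (deriv w x) (deriv φ x) + P.defMat u₀ (deriv φ x) (deriv w x)) *ᵥ q x := by
  simp [lineIntegrand, flux]

lemma deriv_apply_const_loop {q : ℝ → Fin n → ℝ} (hq : SmoothPer q) (x : ℝ) :
    deriv (P.apply (fun _ => u₀) q) x = P.a u₀ *ᵥ deriv (deriv (deriv q)) x := by
  have h1 : P.apply (fun _ => u₀) q = fun x => P.a u₀ *ᵥ deriv (deriv q) x := by
    funext x
    rw [apply_const_loop, iteratedDeriv_two_eq]
  rw [h1]
  simpa using (hasDerivAt_mulVec (fun i j => hasDerivAt_const x (P.a u₀ i j))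
    (A' := 0) (hq.deriv.deriv.hasDerivAt x)).deriv

/-- The linearisation of the Jacobi identity at a constant loop, applied to a covector field that is
parallel to first order. -/
lemma Regular.integral_line_eq_zero (h : P.Regular U) (hs : P.SkewCoeff U) (hJ : P.IsClosed U)
    (hu : u₀ ∈ U) (hφ : SmoothPer φ) (p₀ : Fin n → ℝ) {q r : ℝ → Fin n → ℝ} (hq : SmoothPer q)
    (hr : SmoothPer r) :
    ∫ x in (0 : ℝ)..1, ((P.curvMat u₀ (P.a u₀ *ᵥ deriv (deriv r) x) (deriv φ x) *ᵥ p₀) ⬝ᵥ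
          (P.a u₀ *ᵥ deriv q x)
        - (P.curvMat u₀ (P.a u₀ *ᵥ deriv (deriv q) x) (deriv φ x) *ᵥ p₀) ⬝ᵥ (P.a u₀ *ᵥ deriv r x)
        + p₀ ⬝ᵥ (P.defMat u₀ (P.a u₀ *ᵥ deriv (deriv (deriv r)) x) (deriv φ x)
          + P.defMat u₀ (deriv φ x) (P.a u₀ *ᵥ deriv (deriv (deriv r)) x)) *ᵥ q x
        + r x ⬝ᵥ (P.defMat u₀ (P.a u₀ *ᵥ deriv (deriv (deriv q)) x) (deriv φ x)
          + P.defMat u₀ (deriv φ x) (P.a u₀ *ᵥ deriv (deriv (deriv q)) x)) *ᵥ p₀) = 0 := by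
  have hl := const_mem_loopSpace hu
  obtain ⟨ρ, hρ, hV⟩ := exists_pos_forall_add_smul_mem h.isOpen hl hφ
  have hp := isDiffVec_parallelField (U := U) (P := P) (u₀ := u₀) p₀
  have hq' : IsDiffVec U fun _ => q := IsDiffVec.of_smoothPer hq
  have hr' : IsDiffVec U fun _ => r := IsDiffVec.of_smoothPer hr
  have hPp : IsDiffVec U fun u => P.apply u (P.parallelField u₀ p₀ u) :=
    isDiffFn_apply h.isOpen h.smooth hp
  have hPq : IsDiffVec U fun u => P.apply u q := isDiffFn_apply h.isOpen h.smooth hq'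
  have hPr : IsDiffVec U fun u => P.apply u r := isDiffFn_apply h.isOpen h.smooth hr'
  have hI := ((h.isDiffFn_covIntegrand hp hq' hPr).add (h.isDiffFn_covIntegrand hq' hr' hPp)).add
    (h.isDiffFn_covIntegrand hr' hp hPq)
  have hE : IsDiffVec U fun u x => P.conn u₀ (deriv φ x) *ᵥ p₀
      - P.conn (u x) (deriv φ x) *ᵥ P.parallelField u₀ p₀ u x := by
    refine (IsDiffVec.of_smoothPer (SmoothPer.mulVec (fun i j => ?_) (SmoothPer.const p₀))).sub
      ((h.isDiffMat_conn (IsDiffVec.of_smoothPer hφ.deriv)).mulVec hp)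
    exact SmoothPer.sum (s := Finset.univ) fun k _ =>
      (SmoothPer.const _).mul (smoothPer_pi.1 hφ.deriv k)
  -- The ∇a term in the direction P(parallel field) has no explicit factor s, but the direction
  -- vanishes together with its first derivative.
  have hZ : ∀ k, IsDiffFn U fun u x => P.covD u q x ⬝ᵥ P.covA (u x) (Pi.single k 1) *ᵥ P.covD u r x :=
    fun k => (h.isDiffVec_covD hq').dotProduct ((h.isDiffMat_covA
      (IsDiffVec.of_smoothPer (SmoothPer.const (Pi.single k 1)))).mulVec (h.isDiffVec_covD hr'))
  have hQ := ((((hE.dotProduct ((h.isDiffMat_covA hPr).mulVec (h.isDiffVec_covD hq'))).neg.sub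
    ((h.isDiffVec_covD hr').dotProduct ((h.isDiffMat_covA hPq).mulVec hE))).add
    (h.isDiffFn_lineIntegrand hφ hp hq' hPr)).add (h.isDiffFn_lineIntegrand hφ hq' hr' hPp)).add
    (h.isDiffFn_lineIntegrand hφ hr' hp hPq)
  have hd := (hI.jointSmooth hl.1 hφ hV).hasDerivAt_integral Metric.isOpen_ball
    (Metric.mem_ball_self hρ) (f' := fun x =>
      (P.curvMat u₀ (P.a u₀ *ᵥ deriv (deriv r) x) (deriv φ x) *ᵥ p₀) ⬝ᵥ (P.a u₀ *ᵥ deriv q x)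
        - (P.curvMat u₀ (P.a u₀ *ᵥ deriv (deriv q) x) (deriv φ x) *ᵥ p₀) ⬝ᵥ (P.a u₀ *ᵥ deriv r x)
        + p₀ ⬝ᵥ (P.defMat u₀ (P.a u₀ *ᵥ deriv (deriv (deriv r)) x) (deriv φ x)
          + P.defMat u₀ (deriv φ x) (P.a u₀ *ᵥ deriv (deriv (deriv r)) x)) *ᵥ q x
        + r x ⬝ᵥ (P.defMat u₀ (P.a u₀ *ᵥ deriv (deriv (deriv q)) x) (deriv φ x)
          + P.defMat u₀ (deriv φ x) (P.a u₀ *ᵥ deriv (deriv (deriv q)) x)) *ᵥ p₀) fun x => by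
    have d1 := hasDerivAt_dotProduct (h.hasDerivAt_apply_parallelField hu hφ p₀ x)
      (hasDerivAt_pi.2 fun k => ((hZ k).differentiableAt_line h.isOpen hl hφ x).hasDerivAt)
    have d2 := hQ.hasDerivAt_mul_line h.isOpen hl hφ x
    refine ((d2.fun_sub d1).congr_of_eventuallyEq ?_).congr_deriv ?_
    · filter_upwards [Metric.ball_mem_nhds (0 : ℝ) hρ] with s hs'
      -- Zero torsion cancels the terms pairing Γ(w) with the operator, exactly and not only to
      -- first order.
      have hsym := conn_form_symm fun i j k => h.torsion_eq_zero hs hJ ((hV s hs').2 x) i j k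
      rw [← dotProduct_covA_mulVec]
      simp only [covIntegrand_eq_add_mul (deriv_const_add_smul hφ s x), covD_parallelField_line hφ, smul_dotProduct, mulVec_smul,
        dotProduct_smul, smul_eq_mul]
      rw [hsym (P.parallelField u₀ p₀ _ x) (P.apply _ r x) (P.apply _ q x),
        hsym (q x) (P.apply _ r x) (P.apply _ _ x), hsym (r x) (P.apply _ _ x) (P.apply _ q x)]
      ring
    · simp only [zero_smul, add_zero, lineIntegrand_const_loop, parallelField_const,
        deriv_apply_const_loop hq, deriv_apply_const_loop hr,
        deriv_apply_const_loop (SmoothPer.const p₀), apply_const_loop, iteratedDeriv_two_eq,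
        deriv_const', sub_self, zero_dotProduct, mulVec_zero, dotProduct_zero, curvMat_zero_left,
        defMat_zero_left, defMat_zero_right, zero_mulVec, neg_zero, zero_add, sub_zero, zero_sub]
      ring
  -- The parallel field varies with the loop. This is legitimate because the Schouten identity holds
  -- separately along each loop, for arbitrary fields.
  have hz : (fun s : ℝ => ∫ x in (0 : ℝ)..1, (P.covIntegrand ((fun _ => u₀) + s • φ)
        (P.parallelField u₀ p₀ ((fun _ => u₀) + s • φ)) q (P.apply ((fun _ => u₀) + s • φ) r) x
      + P.covIntegrand ((fun _ => u₀) + s • φ) q r (P.apply ((fun _ => u₀) + s • φ)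
        (P.parallelField u₀ p₀ ((fun _ => u₀) + s • φ))) x
      + P.covIntegrand ((fun _ => u₀) + s • φ) r (P.parallelField u₀ p₀ ((fun _ => u₀) + s • φ))
        (P.apply ((fun _ => u₀) + s • φ) q) x)) =ᶠ[𝓝 0] fun _ => 0 := by
    filter_upwards [Metric.ball_mem_nhds (0 : ℝ) hρ] with s hs'
    have hps := hp.smoothPer (hV s hs')
    rw [← h.schouten_eq hs (hV s hs') hps hq hr]
    exact hJ _ (hV s hs') _ _ _ hps hq hr
  exact hd.unique ((hasDerivAt_const (0 : ℝ) (0 : ℝ)).congr_of_eventuallyEq hz)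

end Operator

end DegTwo

/-! ### Necessity: vanishing of defect and curvature -/

namespace DegTwo

open scoped ContDiff Topology
open Set

open Matrix

variable {n : ℕ} {U : Set (Fin n → ℝ)}

lemma SmoothPer.deriv_mul_self {g : ℝ → ℝ} (hg : SmoothPer g) :
    _root_.deriv (fun x => g x * g x) = fun x => 2 * (g x * _root_.deriv g x) := funext fun x => by
  rw [((hg.hasDerivAt x).fun_mul (hg.hasDerivAt x)).deriv]
  ring

namespace Operator

variable {P : Operator n} {u₀ : Fin n → ℝ}

lemma defMat_comm (hcc : ∀ i j k l, P.cc u₀ i j k l = P.cc u₀ i j l k) (v w : Fin n → ℝ) :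
    P.defMat u₀ v w = P.defMat u₀ w v := by
  have hd : ∀ i j k l, P.defect i j k l u₀ = P.defect i j l k u₀ := fun i j k l => by
    simp only [defect, hcc i j k l, add_comm]
  ext i j
  simp only [defMat, of_apply]
  rw [Finset.sum_comm]
  exact Finset.sum_congr rfl fun k _ => Finset.sum_congr rfl fun l _ => by rw [hd]; ring

/-- A constant second field removes the curvature terms. With φ carried by wave″ and the third field
by the wave, φ_x and the third derivative of that field both have profile wave‴, so the defect
appears times (wave‴)². The factor 2 uses the symmetry of c^{ij}_{kl}. -/
lemma Regular.defMat_eq_zero (h : P.Regular U) (hs : P.SkewCoeff U) (hJ : P.IsClosed U)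
    (hcc : ∀ u ∈ U, ∀ i j k l, P.cc u i j k l = P.cc u i j l k) (hu : u₀ ∈ U)
    (v w : Fin n → ℝ) : P.defMat u₀ v w = 0 := by
  obtain ⟨γ, rfl⟩ := h.exists_eq_a_mulVec hu w
  refine matrix_ext_dotProduct fun α β => ?_
  have hw := smoothPer_wave
  have h2 := hw.deriv.deriv
  have h0 := h.integral_line_eq_zero hs hJ hu (h2.smul_vec v) α (SmoothPer.const β) (hw.smul_vec γ)
  have hz := h2.deriv.eq_zero_of_integral deriv_deriv_deriv_wave_ne_zero
    (c := 2 * (α ⬝ᵥ P.defMat u₀ v (P.a u₀ *ᵥ γ) *ᵥ β)) (fun x => ?_) h0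
  · simpa using hz
  · simp only [hw.deriv_smul_vec, hw.deriv.deriv_smul_vec, h2.deriv_smul_vec, deriv_const',
      mulVec_zero, mulVec_smul, dotProduct_zero, curvMat_zero_left, zero_mulVec, zero_dotProduct,
      defMat_zero_right, defMat_smul_left, defMat_smul_right, smul_mulVec,
      add_mulVec, dotProduct_add, dotProduct_smul, smul_eq_mul, defMat_comm (hcc _ hu) _ v]
    ring

lemma Regular.defect_eq_zero (h : P.Regular U) (hs : P.SkewCoeff U) (hJ : P.IsClosed U)
    (hcc : ∀ u ∈ U, ∀ i j k l, P.cc u i j k l = P.cc u i j l k) (hu : u₀ ∈ U)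
    (i j k l : Fin n) : P.defect i j k l u₀ = 0 := by
  have := congrFun (congrFun (h.defMat_eq_zero hs hJ hcc hu (Pi.single k 1) (Pi.single l 1)) i) j
  simpa [defMat, Pi.single_apply] using this

/-- With zero defect the linearised identity involves only two contractions `X` and `Y` of the
curvature, which differ by exchanging `β` and `γ`. Two choices of profiles first identify and then
annihilate them. -/
lemma Regular.curvMat_eq_zero (h : P.Regular U) (hs : P.SkewCoeff U) (hJ : P.IsClosed U)
    (hcc : ∀ u ∈ U, ∀ i j k l, P.cc u i j k l = P.cc u i j l k) (hu : u₀ ∈ U)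
    (w v : Fin n → ℝ) : P.curvMat u₀ w v = 0 := by
  obtain ⟨γ, rfl⟩ := h.exists_eq_a_mulVec hu w
  refine matrix_ext_dotProduct fun Z α => ?_
  obtain ⟨β, rfl⟩ := h.exists_eq_a_mulVec hu Z
  have hw := smoothPer_wave
  have hw1 := hw.deriv
  have hw2 := hw1.deriv
  have n1 := deriv_wave_ne_zero
  have n2 := deriv_deriv_wave_ne_zero
  have hsq := hw.mul hw
  have hsq' := hw1.mul hw1
  have hD := h.defMat_eq_zero hs hJ hcc hu
  obtain ⟨X, hX⟩ : ∃ X, X = (P.curvMat u₀ (P.a u₀ *ᵥ γ) v *ᵥ α) ⬝ᵥ (P.a u₀ *ᵥ β) := ⟨_, rfl⟩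
  obtain ⟨Y, hY⟩ : ∃ Y, Y = (P.curvMat u₀ (P.a u₀ *ᵥ β) v *ᵥ α) ⬝ᵥ (P.a u₀ *ᵥ γ) := ⟨_, rfl⟩
  have key : ∀ Φ g k : ℝ → ℝ, SmoothPer Φ → SmoothPer g → SmoothPer k →
      ∫ x in (0 : ℝ)..1, deriv Φ x * (X * (deriv g x * deriv (deriv k) x)
        - Y * (deriv (deriv g) x * deriv k x)) = 0 := fun Φ g k hΦ hg hk => by
    have h0 := h.integral_line_eq_zero hs hJ hu (hΦ.smul_vec v) α (hg.smul_vec β) (hk.smul_vec γ)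
    refine Eq.trans ?_ h0
    refine intervalIntegral.integral_congr fun x _ => ?_
    simp only [hΦ.deriv_smul_vec, hg.deriv_smul_vec, hg.deriv.deriv_smul_vec, hk.deriv_smul_vec,
      hk.deriv.deriv_smul_vec, hD, add_zero, zero_mulVec, dotProduct_zero, mulVec_smul,
      curvMat_smul_left, curvMat_smul_right, smul_mulVec, smul_dotProduct, dotProduct_smul,
      smul_eq_mul, hX, hY]
    ring
  -- With Φ = (wave′)² the factor Φ′ is 2 wave′ wave″, and the integrand is 2(X − Y)(wave′ wave″)².
  have hXY : 2 * (X - Y) = 0 := (hw1.mul hw2).eq_zero_of_integral (x₀ := 1 / 8) (mul_ne_zero n1 n2)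
    (fun x => by rw [hw1.deriv_mul_self]; ring) (key _ _ _ hsq' hw hw)
  -- With k = wave² and Y = X the terms containing wave″ cancel, leaving 2X (wave′)⁴.
  have hXX : 2 * X = 0 := hsq'.eq_zero_of_integral (x₀ := 1 / 8) (mul_ne_zero n1 n1) (fun x => by
    have hd2 : deriv (deriv fun x => wave x * wave x) x
        = 2 * (deriv wave x * deriv wave x + wave x * deriv (deriv wave) x) := by
      rw [hw.deriv_mul_self]
      exact (((hw.hasDerivAt x).fun_mul (hw1.hasDerivAt x)).const_mul 2).deriv
    rw [hd2, hw.deriv_mul_self, show Y = X by linarith]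
    ring) (key _ _ _ hw hw hsq)
  rw [dotProduct_comm, ← hX, zero_mulVec, dotProduct_zero]
  linarith

lemma Regular.curvature_eq_zero (h : P.Regular U) (hs : P.SkewCoeff U) (hJ : P.IsClosed U)
    (hcc : ∀ u ∈ U, ∀ i j k l, P.cc u i j k l = P.cc u i j l k) (hu : u₀ ∈ U)
    (i j k l : Fin n) : P.curvature i j k l u₀ = 0 := by
  have := congrFun (congrFun (h.curvMat_eq_zero hs hJ hcc hu (Pi.single k 1) (Pi.single l 1)) j) i
  rw [curvMat_apply] at this
  simpa [Pi.single_apply] using this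

/-- Without the defect the form is −∫ Dp·aDq, which is skew because a is. -/
lemma Regular.isSkew (h : P.Regular U) (hs : P.SkewCoeff U)
    (hE : ∀ u ∈ U, ∀ i j k l, P.defect i j k l u = 0) : P.IsSkew U := by
  intro u hu p q hp hq
  rw [h.opForm_eq hs hu hp hq, h.opForm_eq hs hu hq hp, ← intervalIntegral.integral_neg]
  refine intervalIntegral.integral_congr fun x _ => ?_
  have hd : P.defMat (u x) (deriv u x) (deriv u x) = 0 := by
    ext i j
    simp [defMat, hE _ (hu.2 x)]
  simp only [hd, zero_mulVec, dotProduct_zero, add_zero]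
  rw [dotProduct_mulVec_skew (hs.a_transpose _ (hu.2 x))]

end Operator

end DegTwo

theorem mainTheorem2 {n : ℕ} (U : Set (Fin n → ℝ)) (hU : IsOpen U) (P : DegTwo.Operator n)
    (hP : P.SmoothOn U)
    (hdet : ∀ u ∈ U, (P.a u).det ≠ 0)
    (hcc : ∀ u ∈ U, ∀ i j k l, P.cc u i j k l = P.cc u i j l k) :
    DegTwo.IsPoissonBracket U P.bracket ↔
      (∀ u ∈ U, ∀ i j, P.a u i j = -P.a u j i) ∧
      (∀ u ∈ U, ∀ i j k, P.covDerivA k i j u = P.b u i j k - 2 * P.c u i j k) ∧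
      (∀ u ∈ U, ∀ i j k,
        ∑ r, P.a u i r * (P.b u j k r - 2 * P.c u j k r)
          = ∑ r, P.a u k r * (P.b u i j r - 2 * P.c u i j r)) ∧
      ((∀ u ∈ U, ∀ i j k, P.torsion k i j u = 0) ∧
        ∀ u ∈ U, ∀ i j k l, P.curvature i j k l u = 0) ∧
      (∀ u ∈ U, ∀ i j k l,
        P.cc u i j k l =
          (DegTwo.pd l (fun v => P.c v i j k) u + DegTwo.pd k (fun v => P.c v i j l) u) / 2
          - ∑ p, ∑ r, (P.a u)⁻¹ p r *
              ((P.c u r i k * P.c u p j l + P.c u r i l * P.c u p j k) / 2)) := by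
  have h : P.Regular U := ⟨hU, hP, hdet⟩
  rw [DegTwo.Operator.isPoissonBracket_iff hU hP]
  constructor
  · rintro ⟨hskew, hJ⟩
    have hs := h.skewCoeff_of_isSkew hskew
    obtain ⟨hA, hB⟩ := h.skewCoeff_iff.1 hs
    refine ⟨hA, hB, fun u hu i j k => ?_, ⟨fun u hu i j k => h.torsion_eq_zero hs hJ hu i j k,
      fun u hu i j k l => h.curvature_eq_zero hs hJ hcc hu i j k l⟩,
      fun u hu i j k l => sub_eq_zero.1 (h.defect_eq_zero hs hJ hcc hu i j k l)⟩
    -- By (B), the expression b − 2c in (C) is ∇a, so (C) is the cyclic symmetry of ∇a.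
    simp only [← hB u hu]
    exact (DegTwo.Operator.covA_cyclic_iff (hs.a_transpose u hu)).2 (h.isCyclic hs hJ u hu) i j k
  · rintro ⟨hA, hB, hC, ⟨ht, hR⟩, hE⟩
    have hs : P.SkewCoeff U := h.skewCoeff_iff.2 ⟨hA, hB⟩
    have hD : ∀ u ∈ U, ∀ i j k l, P.defect i j k l u = 0 := fun u hu i j k l =>
      sub_eq_zero.2 (hE u hu i j k l)
    have hc : P.IsCyclic U := fun u hu => (DegTwo.Operator.covA_cyclic_iff
      (hs.a_transpose u hu)).1 fun i j k => by simpa only [hB u hu] using hC u hu i j k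
    refine ⟨h.isSkew hs hD, fun u hu p q r hp hq hr =>
      h.schouten_eq_zero hs hc ht (fun u hu v w => ?_) hD hu hp hq hr⟩
    ext j i
    simp [DegTwo.Operator.curvMat_apply, hR u hu]
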